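/- For $n\ge 0$ let $\mathbb{CP}^n=(\mathbb C^{n+1}\setminus\{0\})/\mathbb C^*$ carry its standard complex structure (affine charts $z_k/z_i$), with multiplication by $i$ on tangent spaces written $J$. Let $g$ be the Fubini–Study metric: in the affine chart $t$, $$g_t(v,w)=\operatorname{Re}\frac{(1+|t|^2)\langle v,w\rangle-\langle v,t\rangle\langle t,w\rangle}{(1+|t|^2)^2}.$$ 0. The projection $q:S^{2n+1}\to\mathbb{CP}^n$, $z\mapsto[z]$, of the unit sphere is a Riemannian submersion for $g$: for each $z\in S^{2n+1}$, $dq_z$ vanishes on $iz$ and maps the space $H_z$ of vectors orthogonal to $z$ and $iz$ isometrically onto $T_{[z]}\mathbb{CP}^n$. 1. Let $n\ge 2$. Then $\mathbb{CP}^n$ is a (Hausdorff, second countable) complex manifold and $g$ is a Kähler metric on it: $g$ is a smooth Riemannian metric, $g(J\cdot,J\cdot)=g$, and the form $g(J\cdot,\cdot)$ is closed. The Levi-Civita connection of $g$ equals its Chern connection. The metric is Einstein with positive constant: $\mathrm{Ric}=c\,g$ for some $c>0$. If $u,w\in T_p\mathbb{CP}^n$ are unit vectors with $w\perp u$ and $w\perp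 Ju$, then for all $s\in\mathbb R$ the sectional curvature satisfies $$K(u,\cos s\, w+\sin s\, Ju)=1+3\sin^2 s .$$ The sectional curvature of $g$ is not constant, $(\mathbb{CP}^n,g)$ is not locally conformally flat, and $\mathbb{CP}^n$ is orientable. (Locally conformally flat means that every point has an open neighbourhood with a smooth function $f$ on it such that $e^{2f}g$ has zero curvature there.) 2. $(\mathbb{CP}^1,4g)$ is isometric to the unit sphere $S^2\subset\mathbb R^3$ with its round metric (that is, $(\mathbb{CP}^1,g)$ is isometric to the round sphere of radius $1/2$). In particular $(\mathbb{CP}^1,g)$ has constant sectional curvature ($=4$), and it is locally conformally flat. 3. Let $n\ge 1$, $G=SU(n+1)$ and $H=S(U(1)\times U(n))$ (block diagonal matrices in $G$), and let $G/H$ carry its smooth structure of homogeneous space, for which $G\to G/H$ is a smooth submersion; such a structure exists. Then $F:G/H\to\mathbb{CP}^n$, $F([x])=[x\cdot(1,0,\dots,0)]$, is a diffeomorphism, there is a $G$-invariant smooth Riemannian metric on $G/H$, and for every such metric $h$ there is $\mu>0$ with $F^*g=\mu h$. -/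

import Mathlib

open scoped Manifold ContDiff LinearAlgebra.Projectivization

set_option maxSynthPendingDepth 3

noncomputable section

namespace FubiniStudy

/-- The Hermitian space `ℂⁿ`. -/
abbrev Cn (n : ℕ) : Type := EuclideanSpace ℂ (Fin n)

/-- Complex projective space: the complex lines of `ℂⁿ⁺¹`. -/
abbrev CP (n : ℕ) : Type := ℙ ℂ (Cn (n + 1))

/-- The quotient topology of `ℂⁿ⁺¹ ∖ {0}`. -/
instance instTopologicalSpaceCP (n : ℕ) : TopologicalSpace (CP n) :=
  inferInstanceAs (TopologicalSpace (Quotient (projectivizationSetoid ℂ (Cn (n + 1)))))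

theorem isQuotientMap_mk' (n : ℕ) :
    Topology.IsQuotientMap (Projectivization.mk' ℂ : {v : Cn (n + 1) // v ≠ 0} → CP n) :=
  isQuotientMap_quot_mk

/-- The inclusion `ℂⁿ → ℂⁿ⁺¹` that inserts a `0` at position `i`. -/
def slot {n : ℕ} (i : Fin (n + 1)) : Cn n →L[ℂ] Cn (n + 1) :=
  LinearMap.toContinuousLinearMap
    { toFun := fun v => WithLp.toLp 2 (i.insertNth (α := fun _ => ℂ) 0 (fun j => v j))
      map_add' := fun v w => by
        ext k
        refine Fin.succAboveCases i ?_ (fun j => ?_) k <;> simp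
      map_smul' := fun c v => by
        ext k
        refine Fin.succAboveCases i ?_ (fun j => ?_) k <;> simp }

@[simp]
theorem slot_same {n : ℕ} (i : Fin (n + 1)) (v : Cn n) : slot i v i = 0 := by
  simp [slot]

@[simp]
theorem slot_succAbove {n : ℕ} (i : Fin (n + 1)) (v : Cn n) (j : Fin n) :
    slot i v (i.succAbove j) = v j := by
  simp [slot]

/-- The affine section `t ↦ (t₀, …, 1, …, tₙ₋₁)` with the `1` at position `i`. -/
def affineLift {n : ℕ} (i : Fin (n + 1)) (t : Cn n) : Cn (n + 1) :=
  EuclideanSpace.single i 1 + slot i t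

@[simp]
theorem affineLift_same {n : ℕ} (i : Fin (n + 1)) (t : Cn n) : affineLift i t i = 1 := by
  simp [affineLift]

@[simp]
theorem affineLift_succAbove {n : ℕ} (i : Fin (n + 1)) (t : Cn n) (j : Fin n) :
    affineLift i t (i.succAbove j) = t j := by
  simp [affineLift, Fin.succAbove_ne]

theorem affineLift_ne_zero {n : ℕ} (i : Fin (n + 1)) (t : Cn n) : affineLift i t ≠ 0 := by
  intro h
  have := affineLift_same i t
  simp [h] at this

/-- The affine coordinates `(z_k / z_i)_{k ≠ i}`. -/
def affineCoord {n : ℕ} (i : Fin (n + 1)) (z : Cn (n + 1)) : Cn n :=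
  WithLp.toLp 2 fun j => z (i.succAbove j) / z i

/-- The affine coordinates as a function on projective space. -/
def affineMap {n : ℕ} (i : Fin (n + 1)) : CP n → Cn n :=
  Projectivization.lift (fun v => affineCoord i v.1) (by
    intro a b t h
    have ht : t ≠ 0 := by
      rintro rfl
      exact a.2 (by simpa using h)
    ext j
    simp [affineCoord, h, mul_div_mul_left _ _ ht])

/-- The open set `z_i ≠ 0`. -/
def affineSet {n : ℕ} (i : Fin (n + 1)) : Set (CP n) := {p | p.rep i ≠ 0}

theorem mk_mem_affineSet {n : ℕ} (i : Fin (n + 1)) (z : Cn (n + 1)) (hz : z ≠ 0) :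
    Projectivization.mk ℂ z hz ∈ affineSet i ↔ z i ≠ 0 := by
  obtain ⟨a, ha⟩ := Projectivization.exists_smul_eq_mk_rep ℂ z hz
  show (Projectivization.mk ℂ z hz).rep i ≠ 0 ↔ _
  rw [← ha]
  simp [Units.smul_def]

theorem isOpen_affineSet {n : ℕ} (i : Fin (n + 1)) : IsOpen (affineSet (n := n) i) := by
  rw [← (isQuotientMap_mk' n).isOpen_preimage]
  have : (Projectivization.mk' ℂ : {v : Cn (n + 1) // v ≠ 0} → CP n) ⁻¹' affineSet i
      = {v | v.1 i ≠ 0} := by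
    ext v
    exact mk_mem_affineSet i v.1 v.2
  rw [this]
  exact isOpen_ne_fun (by fun_prop) continuous_const

theorem continuous_affineLift {n : ℕ} (i : Fin (n + 1)) :
    Continuous (affineLift (n := n) i) := by
  unfold affineLift
  fun_prop

theorem continuousOn_affineMap {n : ℕ} (i : Fin (n + 1)) :
    ContinuousOn (affineMap (n := n) i) (affineSet i) := by
  rw [(isQuotientMap_mk' n).continuousOn_isOpen_iff (isOpen_affineSet i)]
  have : (affineMap (n := n) i) ∘ (Projectivization.mk' ℂ) = fun v => affineCoord i v.1 := rfl
  rw [this]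
  have h : ∀ v ∈ (Projectivization.mk' ℂ : {v : Cn (n + 1) // v ≠ 0} → CP n) ⁻¹' affineSet i,
      v.1 i ≠ 0 := fun v hv => (mk_mem_affineSet i v.1 v.2).1 hv
  unfold affineCoord
  refine (PiLp.continuous_toLp 2 _).comp_continuousOn (continuousOn_pi.2 fun j => ?_)
  exact ContinuousOn.div (by fun_prop) (by fun_prop) h

/-- The affine chart `[z] ↦ (z_k / z_i)_{k ≠ i}` on the open set `z_i ≠ 0`. -/
def affineChart {n : ℕ} (i : Fin (n + 1)) : OpenPartialHomeomorph (CP n) (Cn n) where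
  toFun := affineMap i
  invFun t := Projectivization.mk ℂ (affineLift i t) (affineLift_ne_zero i t)
  source := affineSet i
  target := Set.univ
  map_source' _ _ := Set.mem_univ _
  map_target' t _ := (mk_mem_affineSet i _ _).2 (by simp)
  left_inv' p hp := by
    induction p using Projectivization.ind with
    | h z hz =>
      have hi : z i ≠ 0 := (mk_mem_affineSet i z hz).1 hp
      refine (Projectivization.mk_eq_mk_iff' ℂ _ _ _ _).2 ⟨(z i)⁻¹, ?_⟩
      ext k
      refine Fin.succAboveCases i ?_ (fun j => ?_) k
      · simp [hi]
      · simp [affineMap, affineCoord, div_eq_inv_mul]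
  right_inv' t _ := by
    ext j
    simp [affineMap, affineCoord]
  open_source := isOpen_affineSet i
  open_target := isOpen_univ
  continuousOn_toFun := continuousOn_affineMap i
  continuousOn_invFun := by
    refine Continuous.continuousOn ?_
    exact (isQuotientMap_mk' n).continuous.comp
      ((continuous_affineLift i).subtype_mk (affineLift_ne_zero i))

theorem exists_mem_affineSet {n : ℕ} (p : CP n) : ∃ i, p ∈ affineSet i := by
  by_contra! h
  refine p.rep_nonzero ?_
  ext i
  simpa [affineSet] using h i

/-- An index of an affine chart around `p`. -/
def chartIndex {n : ℕ} (p : CP n) : Fin (n + 1) := (exists_mem_affineSet p).choose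

/-- The atlas of the `n + 1` affine charts. -/
instance instChartedSpaceCP (n : ℕ) : ChartedSpace (Cn n) (CP n) where
  atlas := Set.range affineChart
  chartAt p := affineChart (chartIndex p)
  mem_chart_source p := (exists_mem_affineSet p).choose_spec
  chart_mem_atlas _ := Set.mem_range_self _

theorem affineChart_trans_eq {n : ℕ} (i k : Fin (n + 1)) (t : Cn n) :
    affineChart k ((affineChart i).symm t) = affineCoord k (affineLift i t) := rfl

theorem mem_affineChart_trans_source {n : ℕ} (i k : Fin (n + 1)) (t : Cn n)
    (ht : t ∈ ((affineChart (n := n) i).symm.trans (affineChart k)).source) :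
    affineLift i t k ≠ 0 := by
  have h2 : (affineChart (n := n) i).symm t ∈ affineSet k := by
    rw [OpenPartialHomeomorph.trans_source] at ht
    exact ht.2
  exact (mk_mem_affineSet k (affineLift i t) (affineLift_ne_zero i t)).1 h2

theorem contDiffOn_affineChart_trans {n : ℕ} (i k : Fin (n + 1)) :
    ContDiffOn ℂ ω (fun t : Cn n => affineCoord k (affineLift i t))
      {t | affineLift i t k ≠ 0} := by
  have hl : ContDiff ℂ ω (affineLift (n := n) i) := by
    unfold affineLift
    fun_prop
  have hc : ∀ m : Fin (n + 1), ContDiff ℂ ω (fun t : Cn n => affineLift i t m) := fun m =>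
    (EuclideanSpace.proj (𝕜 := ℂ) m : Cn (n + 1) →L[ℂ] ℂ).contDiff.comp hl
  rw [contDiffOn_piLp]
  intro j
  exact (hc _).contDiffOn.div (hc k).contDiffOn fun t ht => ht

/-- Projective space is a complex manifold. -/
instance instIsManifoldComplexCP (n : ℕ) : IsManifold 𝓘(ℂ, Cn n) ω (CP n) := by
  apply isManifold_of_contDiffOn
  rintro _ _ ⟨i, rfl⟩ ⟨k, rfl⟩
  refine (contDiffOn_affineChart_trans i k).congr_mono (fun t _ => rfl) ?_
  rintro t ht
  exact mem_affineChart_trans_source i k t (by simpa using ht)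

/-- Projective space is a smooth real manifold. -/
instance instIsManifoldRealCP (n : ℕ) : IsManifold 𝓘(ℝ, Cn n) ∞ (CP n) := by
  apply isManifold_of_contDiffOn
  rintro _ _ ⟨i, rfl⟩ ⟨k, rfl⟩
  refine (((contDiffOn_affineChart_trans i k).restrict_scalars ℝ).of_le le_top).congr_mono
    (fun t _ => rfl) ?_
  rintro t ht
  exact mem_affineChart_trans_source i k t (by simpa using ht)

/-! ### Riemannian geometry in charts -/

section Riemannian

variable {E : Type*} [NormedAddCommGroup E] [NormedSpace ℝ E]

/-- The covariant Christoffel symbols `(u, v, w) ↦ (D_u G (v, w) + D_v G (u, w) - D_w G (u, v)) / 2`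
of a metric `G` on an open subset of `E`. -/
def koszul (G : E → E →L[ℝ] E →L[ℝ] ℝ) (y : E) : E →L[ℝ] E →L[ℝ] E →L[ℝ] ℝ :=
  (1 / 2 : ℝ) • (fderiv ℝ G y + (fderiv ℝ G y).flip
    - (ContinuousLinearMap.flipₗᵢ ℝ E E ℝ).toContinuousLinearEquiv.toContinuousLinearMap ∘L
        (fderiv ℝ G y).flip)

theorem koszul_apply (G : E → E →L[ℝ] E →L[ℝ] ℝ) (y u v w : E) :
    koszul G y u v w =
      (fderiv ℝ G y u v w + fderiv ℝ G y v u w - fderiv ℝ G y w u v) / 2 := by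
  simp [koszul]
  ring

/-- The Christoffel symbols of the Levi-Civita connection: `Γ(u, v)` is the vector with
`G (Γ(u, v), w) = (D_u G (v, w) + D_v G (u, w) - D_w G (u, v)) / 2` for all `w`. -/
def christoffel (G : E → E →L[ℝ] E →L[ℝ] ℝ) (y : E) : E →L[ℝ] E →L[ℝ] E :=
  (ContinuousLinearMap.compL ℝ E (E →L[ℝ] ℝ) E (G y).inverse) ∘L koszul G y

theorem christoffel_apply (G : E → E →L[ℝ] E →L[ℝ] ℝ) (y u v : E) :
    christoffel G y u v = (G y).inverse (koszul G y u v) := rfl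

/-- Auxiliary term `(u, v, w) ↦ (D_u Γ)(v, w) + Γ(u, Γ(v, w))` of the curvature. -/
def curvatureAux (G : E → E →L[ℝ] E →L[ℝ] ℝ) (y : E) : E →L[ℝ] E →L[ℝ] E →L[ℝ] E :=
  fderiv ℝ (christoffel G) y +
    (ContinuousLinearMap.compL ℝ E E E).bilinearComp (christoffel G y) (christoffel G y)

/-- The curvature tensor `R(u, v) w = ∇_u ∇_v w - ∇_v ∇_u w - ∇_[u,v] w` in coordinates. -/
def coordCurvature (G : E → E →L[ℝ] E →L[ℝ] ℝ) (y : E) : E →L[ℝ] E →L[ℝ] E →L[ℝ] E :=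
  curvatureAux G y - (curvatureAux G y).flip

theorem coordCurvature_apply (G : E → E →L[ℝ] E →L[ℝ] ℝ) (y u v w : E) :
    coordCurvature G y u v w =
      (fderiv ℝ (christoffel G) y u v w + christoffel G y u (christoffel G y v w))
      - (fderiv ℝ (christoffel G) y v u w + christoffel G y v (christoffel G y u w)) := rfl

variable {M : Type*} [TopologicalSpace M] [ChartedSpace E M]

variable (E M) in
/-- A field of bilinear forms on the tangent spaces of `M`. -/
abbrev TensorField : Type _ :=
  ∀ p : M, TangentSpace 𝓘(ℝ, E) p →L[ℝ] TangentSpace 𝓘(ℝ, E) p →L[ℝ] ℝ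

/-- `g` is a smooth Riemannian metric. -/
def IsSmoothMetric [IsManifold 𝓘(ℝ, E) ∞ M] (g : TensorField E M) : Prop :=
  ∃ g' : Bundle.ContMDiffRiemannianMetric 𝓘(ℝ, E) ∞ E (fun p : M => TangentSpace 𝓘(ℝ, E) p),
    g'.inner = g

/-- The expression of `g` in the preferred chart at `p`, a function on the model space. -/
def coordMetric (g : TensorField E M) (p : M) (y : E) : E →L[ℝ] E →L[ℝ] ℝ :=
  let D : TangentSpace 𝓘(ℝ, E) y →L[ℝ] TangentSpace 𝓘(ℝ, E) ((chartAt E p).symm y) :=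
    mfderiv 𝓘(ℝ, E) 𝓘(ℝ, E) (chartAt E p).symm y
  ContinuousLinearMap.precomp ℝ D ∘L g ((chartAt E p).symm y) ∘L D

theorem coordMetric_apply (g : TensorField E M) (p : M) (y u v : E) :
    coordMetric g p y u v = g ((chartAt E p).symm y)
      (mfderiv 𝓘(ℝ, E) 𝓘(ℝ, E) (chartAt E p).symm y u)
      (mfderiv 𝓘(ℝ, E) 𝓘(ℝ, E) (chartAt E p).symm y v) := rfl

/-- The Christoffel symbols at `p` of the Levi-Civita connection, in the preferred chart at `p`. -/
def leviCivita (g : TensorField E M) (p : M) : E →L[ℝ] E →L[ℝ] E :=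
  christoffel (coordMetric g p) (chartAt E p p)

/-- The Riemann curvature tensor of `g` at `p`, computed in the preferred chart at `p`, through
which the tangent space at `p` is identified with `E`. -/
def riemann (g : TensorField E M) (p : M) :
    TangentSpace 𝓘(ℝ, E) p →L[ℝ] TangentSpace 𝓘(ℝ, E) p →L[ℝ]
      TangentSpace 𝓘(ℝ, E) p →L[ℝ] TangentSpace 𝓘(ℝ, E) p :=
  (coordCurvature (coordMetric g p) (chartAt E p p) : E →L[ℝ] E →L[ℝ] E →L[ℝ] E)

/-- The Ricci curvature `Ric(v, w) = tr (u ↦ R(u, v) w)`. -/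
def ricci (g : TensorField E M) (p : M) (v w : TangentSpace 𝓘(ℝ, E) p) : ℝ :=
  LinearMap.trace ℝ (TangentSpace 𝓘(ℝ, E) p)
    { toFun := fun u => riemann g p u v w
      map_add' := fun a b => by simp
      map_smul' := fun c a => by simp }

/-- The sectional curvature of the plane spanned by `u` and `v`. -/
def sectional (g : TensorField E M) (p : M) (u v : TangentSpace 𝓘(ℝ, E) p) : ℝ :=
  g p (riemann g p u v v) u / (g p u u * g p v v - g p u v ^ 2)

/-- `g` is Einstein with constant `c`. -/
def IsEinstein (g : TensorField E M) (c : ℝ) : Prop :=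
  ∀ (p : M) (v w : TangentSpace 𝓘(ℝ, E) p), ricci g p v w = c * g p v w

/-- All planes at all points have sectional curvature `c`. -/
def HasConstantSectionalCurvature (g : TensorField E M) (c : ℝ) : Prop :=
  ∀ (p : M) (u v : TangentSpace 𝓘(ℝ, E) p), LinearIndependent ℝ ![u, v] → sectional g p u v = c

/-- Every point has an open neighbourhood on which some conformal metric `e^{2f} g` is flat. -/
def IsLocallyConformallyFlat (g : TensorField E M) : Prop :=
  ∀ p : M, ∃ U : Set M, IsOpen U ∧ p ∈ U ∧ ∃ f : M → ℝ,
    ContMDiffOn 𝓘(ℝ, E) 𝓘(ℝ, ℝ) ∞ f U ∧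
      ∀ q ∈ U, riemann (fun x => Real.exp (2 * f x) • g x : TensorField E M) q = 0

variable (E M) in
/-- `M` is covered by smooth charts whose transition maps have positive Jacobian determinants. -/
def IsOrientable : Prop :=
  ∃ A ⊆ IsManifold.maximalAtlas 𝓘(ℝ, E) ∞ M, (∀ p : M, ∃ e ∈ A, p ∈ e.source) ∧
    ∀ e ∈ A, ∀ e' ∈ A, ∀ y ∈ (e.symm.trans e').source,
      0 < (fderiv ℝ (fun x => e' (e.symm x)) y).det

/-- The pull-back `f^* g'` of a field of bilinear forms. -/
def pullback {E' M' : Type*} [NormedAddCommGroup E'] [NormedSpace ℝ E'] [TopologicalSpace M']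
    [ChartedSpace E' M'] (f : M → M') (g' : TensorField E' M') : TensorField E M :=
  fun p => ContinuousLinearMap.precomp ℝ (mfderiv 𝓘(ℝ, E) 𝓘(ℝ, E') f p) ∘L g' (f p) ∘L
    mfderiv 𝓘(ℝ, E) 𝓘(ℝ, E') f p

theorem pullback_apply {E' M' : Type*} [NormedAddCommGroup E'] [NormedSpace ℝ E']
    [TopologicalSpace M'] [ChartedSpace E' M'] (f : M → M') (g' : TensorField E' M') (p : M)
    (u v : TangentSpace 𝓘(ℝ, E) p) :
    pullback f g' p u v =
      g' (f p) (mfderiv 𝓘(ℝ, E) 𝓘(ℝ, E') f p u) (mfderiv 𝓘(ℝ, E) 𝓘(ℝ, E') f p v) := rfl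

end Riemannian

/-! ### Hermitian geometry on complex manifolds -/

section Kahler

variable {E : Type*} [NormedAddCommGroup E] [NormedSpace ℝ E] [NormedSpace ℂ E]
  [IsScalarTower ℝ ℂ E] {M : Type*} [TopologicalSpace M] [ChartedSpace E M]

/-- The complex structure of the tangent spaces: multiplication by `i` in holomorphic charts. -/
def complexStructure (p : M) : TangentSpace 𝓘(ℝ, E) p →L[ℝ] TangentSpace 𝓘(ℝ, E) p :=
  ((Complex.I • ContinuousLinearMap.id ℂ E).restrictScalars ℝ : E →L[ℝ] E)

/-- The fundamental form `ω(v, w) = g(i v, w)` in the preferred holomorphic chart at `p`. -/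
def fundamentalForm (g : TensorField E M) (p : M) (y v w : E) : ℝ :=
  coordMetric g p y (Complex.I • v) w

/-- Kähler metrics on a complex manifold: smooth Hermitian metrics whose fundamental form is
closed. -/
structure IsKahler [IsManifold 𝓘(ℂ, E) ω M] [IsManifold 𝓘(ℝ, E) ∞ M] (g : TensorField E M) :
    Prop where
  smooth : IsSmoothMetric g
  hermitian : ∀ (p : M) (u v : TangentSpace 𝓘(ℝ, E) p),
    g p (complexStructure p u) (complexStructure p v) = g p u v
  closed : ∀ (p : M) (u v w : E),
    fderiv ℝ (fun y => fundamentalForm g p y v w) (chartAt E p p) u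
      + fderiv ℝ (fun y => fundamentalForm g p y w u) (chartAt E p p) v
      + fderiv ℝ (fun y => fundamentalForm g p y u v) (chartAt E p p) w = 0

/-- `A` is the connection form at `p`, in the preferred holomorphic chart at `p`, of the Chern
connection of the Hermitian metric `g`: the unique connection that is complex linear, has
`∂̄` as its `(0, 1)`-part (so that `A` is of type `(1, 0)`) and is compatible with the metric. -/
structure IsChernConnection (g : TensorField E M) (p : M) (A : E →L[ℝ] E →L[ℝ] E) : Prop where
  complex_linear : ∀ u v : E, A u (Complex.I • v) = Complex.I • A u v
  type_one_zero : ∀ u v : E, A (Complex.I • u) v = Complex.I • A u v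
  metric : ∀ u v w : E, fderiv ℝ (coordMetric g p) (chartAt E p p) u v w =
    coordMetric g p (chartAt E p p) (A u v) w + coordMetric g p (chartAt E p p) v (A u w)

end Kahler

/-! ### The Fubini-Study metric -/

/-- The horizontal lift at the unit vector `z = σ / ‖σ‖`, where `σ = affineLift i t`, of the tangent
vector with affine coordinates `v`: the component of `slot i v / ‖σ‖` orthogonal to the complex
line of `z`, that is, orthogonal to `z` and `i z`. -/
def horizontalLift {n : ℕ} (i : Fin (n + 1)) (t : Cn n) : Cn n →L[ℝ] Cn (n + 1) :=
  ((‖affineLift i t‖⁻¹ : ℂ) •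
    ((Submodule.span ℂ {affineLift i t})ᗮ.starProjection ∘L slot i)).restrictScalars ℝ

/-- The Fubini-Study metric: the metric for which horizontal lifts are isometric. -/
def fubiniStudy (n : ℕ) : TensorField (Cn n) (CP n) := fun p =>
  ((innerSL ℝ : Cn (n + 1) →L[ℝ] Cn (n + 1) →L[ℝ] ℝ).bilinearComp
    (horizontalLift (chartIndex p) (affineMap (chartIndex p) p))
    (horizontalLift (chartIndex p) (affineMap (chartIndex p) p)) : Cn n →L[ℝ] Cn n →L[ℝ] ℝ)

/-- The projection `z ↦ [z]`, with an arbitrary value at `z = 0`. -/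
def proj (n : ℕ) (z : Cn (n + 1)) : CP n :=
  if h : z = 0 then Projectivization.mk ℂ (affineLift 0 0) (affineLift_ne_zero 0 0)
  else Projectivization.mk ℂ z h

/-- `q : S^{2n+1} → CP^n`, `z ↦ [z]`, is a Riemannian submersion onto `(CP^n, g)`: at each unit
vector `z` its differential maps the space `H_z` of the vectors orthogonal to `z` and `i z`
isometrically onto the tangent space, and vanishes at `i z`. -/
structure IsSubmersionMetric (n : ℕ) (g : TensorField (Cn n) (CP n)) : Prop where
  smooth : ContMDiffOn 𝓘(ℝ, Cn (n + 1)) 𝓘(ℝ, Cn n) ∞ (proj n) {z | z ≠ 0}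
  vertical : ∀ z : Cn (n + 1), ‖z‖ = 1 →
    mfderiv 𝓘(ℝ, Cn (n + 1)) 𝓘(ℝ, Cn n) (proj n) z (Complex.I • z : Cn (n + 1)) = 0
  surjective : ∀ z : Cn (n + 1), ‖z‖ = 1 → ∀ u : TangentSpace 𝓘(ℝ, Cn n) (proj n z),
    ∃ v : Cn (n + 1), inner ℂ z v = 0 ∧ mfderiv 𝓘(ℝ, Cn (n + 1)) 𝓘(ℝ, Cn n) (proj n) z v = u
  isometric : ∀ z : Cn (n + 1), ‖z‖ = 1 → ∀ v w : Cn (n + 1), inner ℂ z v = 0 → inner ℂ z w = 0 →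
    pullback (proj n) g z v w = (inner ℂ v w).re

/-- The round metric of the unit sphere of `ℝ³`, induced by the Euclidean scalar product. -/
def roundMetric : TensorField (EuclideanSpace ℝ (Fin 2))
    (Metric.sphere (0 : EuclideanSpace ℝ (Fin 3)) 1) :=
  pullback (E' := EuclideanSpace ℝ (Fin 3)) (M' := EuclideanSpace ℝ (Fin 3))
    Subtype.val 
    (fun _ => (innerSL ℝ : EuclideanSpace ℝ (Fin 3) →L[ℝ] EuclideanSpace ℝ (Fin 3) →L[ℝ] ℝ))

/-! ### The homogeneous space `SU(n+1) / S(U(1) × U(n))` -/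

/-- The group `SU(n+1)`. -/
abbrev SU (n : ℕ) : Type := Matrix.specialUnitaryGroup (Fin (n + 1)) ℂ

/-- The subgroup `S(U(1) × U(n))` of the block diagonal matrices. -/
def blockSubgroup (n : ℕ) : Subgroup (SU n) where
  carrier := {x | ∀ j : Fin n, x.1 0 j.succ = 0 ∧ x.1 j.succ 0 = 0}
  one_mem' j := by simp [Fin.succ_ne_zero, (Fin.succ_ne_zero _).symm]
  mul_mem' {x y} hx hy j := by
    simp only [Submonoid.coe_mul, Matrix.mul_apply, Fin.sum_univ_succ]
    constructor
    · simp [(hx _).1, (hy _).1]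
    · simp [(hx _).2, (hy _).2]
  inv_mem' {x} hx j := by
    rw [← Matrix.star_eq_inv]
    simp [Matrix.specialUnitaryGroup.coe_star, Matrix.star_apply, (hx _).1, (hx _).2]

/-- The homogeneous space `SU(n+1) / S(U(1) × U(n))`, with the quotient topology. -/
abbrev HomSpace (n : ℕ) : Type := SU n ⧸ blockSubgroup n

/-- The first column `x · m` of `x`, where `m = (1, 0, …, 0)`. -/
def firstColumn {n : ℕ} (x : SU n) : Cn (n + 1) := WithLp.toLp 2 fun k => x.1 k 0

theorem firstColumn_ne_zero {n : ℕ} (x : SU n) : firstColumn x ≠ 0 := by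
  intro h
  have hu : star x.1 * x.1 = 1 := (Matrix.mem_unitaryGroup_iff').1
    (Matrix.mem_specialUnitaryGroup_iff.1 x.2).1
  have h0 : ∀ k, x.1 k 0 = 0 := fun k => by
    have := congrArg (fun v : Cn (n + 1) => v k) h
    simpa [firstColumn] using this
  have := congrFun (congrFun hu 0) 0
  simp [Matrix.mul_apply, h0] at this

theorem mk_firstColumn_mul {n : ℕ} (x h : SU n) (hh : h ∈ blockSubgroup n) :
    Projectivization.mk ℂ (firstColumn (x * h)) (firstColumn_ne_zero _) =
      Projectivization.mk ℂ (firstColumn x) (firstColumn_ne_zero _) := by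
  refine (Projectivization.mk_eq_mk_iff' ℂ _ _ _ _).2 ⟨h.1 0 0, ?_⟩
  ext k
  simp [firstColumn, Matrix.mul_apply, Fin.sum_univ_succ, (hh _).2, mul_comm]

/-- The map `SU(n+1) / S(U(1) × U(n)) → CP^n`, `[x] ↦ [x · m]`. -/
def homMap (n : ℕ) : HomSpace n → CP n :=
  Quotient.lift (fun x : SU n => Projectivization.mk ℂ (firstColumn x) (firstColumn_ne_zero x)) (by
    intro x y hxy
    have h : x⁻¹ * y ∈ blockSubgroup n := QuotientGroup.leftRel_apply.1 hxy
    have := mk_firstColumn_mul x (x⁻¹ * y) h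
    simp only [mul_inv_cancel_left] at this
    exact this.symm)

section Homogeneous

attribute [local instance] Matrix.normedAddCommGroup Matrix.normedSpace

/-- A map from a normed space to `SU(n+1)`, an embedded submanifold of the space of matrices, is
smooth if it is smooth as a matrix valued map. -/
def IsSmoothIntoSU {n : ℕ} {V : Type*} [NormedAddCommGroup V] [NormedSpace ℝ V]
    (γ : V → SU n) : Prop :=
  ContDiff ℝ ∞ (fun s => (γ s : Matrix (Fin (n + 1)) (Fin (n + 1)) ℂ))

end Homogeneous

/-- The given atlas of `SU(n+1) / S(U(1) × U(n))` is the smooth structure of the homogeneous space,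
the one for which the projection `x ↦ [x]` is a smooth submersion. Smoothness of a map on the
embedded submanifold `SU(n+1)` is tested along the smooth maps `ℝᵏ → SU(n+1)`, and the tangent
vectors of `SU(n+1)` are the velocities of its smooth curves. -/
structure IsHomogeneousStructure (n : ℕ) [ChartedSpace (Cn n) (HomSpace n)] : Prop where
  manifold : IsManifold 𝓘(ℝ, Cn n) ∞ (HomSpace n)
  smooth : ∀ (k : ℕ) (γ : EuclideanSpace ℝ (Fin k) → SU n), IsSmoothIntoSU γ →
    ContMDiff 𝓘(ℝ, EuclideanSpace ℝ (Fin k)) 𝓘(ℝ, Cn n) ∞ (fun s => (γ s : HomSpace n))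
  submersion : ∀ (x : SU n) (u : TangentSpace 𝓘(ℝ, Cn n) (x : HomSpace n)),
    ∃ γ : ℝ → SU n, IsSmoothIntoSU γ ∧ γ 0 = x ∧
      (mfderiv 𝓘(ℝ, ℝ) 𝓘(ℝ, Cn n) (fun s => (γ s : HomSpace n)) 0 (1 : ℝ) : Cn n) = u

/-- Invariance under the left translations by `SU(n+1)`. -/
def IsInvariantMetric (n : ℕ) [ChartedSpace (Cn n) (HomSpace n)]
    (h : TensorField (Cn n) (HomSpace n)) : Prop :=
  ∀ a : SU n, pullback (fun c : HomSpace n => a • c) h = h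

end FubiniStudy

end

open FubiniStudy

namespace FubiniStudy

open Filter Topology

/-! ### Smooth metrics and the inverse function theorem on manifolds -/

section Generic

variable {E : Type*} [NormedAddCommGroup E] [NormedSpace ℝ E]
  {M : Type*} [TopologicalSpace M] [ChartedSpace E M]

/-! Pulled back to `ℂⁿ⁺¹ ∖ {0}`, the metric is the real part of `hermForm`, which is unchanged when
`z, v, w` are replaced by `cz, cv + az, cw + bz` (`hermForm_smul_add`, `pullback_proj`). This yields
the Riemannian submersion, the invariance under unitary maps, and one and the same expression
`coordHerm` in all affine charts.

In a chart everything rests on `chernGamma`, which is symmetric, complex bilinear and compatible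
with the Hermitian form (`hasDerivAt_coordHerm`). Symmetry and compatibility make it the Levi-Civita
connection; complex linearity makes it the Chern connection; the imaginary part of compatibility
closes the fundamental form. Differentiating once more, with `h = coordHerm`, gives `R(u,v)w =
h(v,w)u - h(u,w)v - (h(u,v) - h(v,u))w` (`coordCurvature_of_coordHerm`), and Ricci and sectional
curvatures follow by linear algebra.

Against conformal flatness: if `w ⟂ u, v`, a conformal change alters `R(u,v)w` only by a combination
of `u, v, w`, so its component along a `z` orthogonal to all three is the same for `g` and for
`e^{2f}g`, up to the scale of the metric (`coordCurvature_conformal`). For `u, iu, w, iw` with `u,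
w` Hermitian orthonormal this component is `-2`, not `0`.

On the projective line the Hopf map doubles the length of horizontal vectors, so it is an isometry
from `4g` to the round sphere. The metric is `|dt|²/|z|⁴` there, and the factor `|z|⁴/|z_i|⁴` turns
it into the flat metric of `coordCurvature_eq_zero_of_affine`.

For `G/H`, the bijection `homMap` is treated through its inverse: exponentials of off-diagonal
matrices give local smooth lifts of `CPⁿ` into `SU(n+1)` (`exists_local_lift`), so `homInv` is
smooth, the submersion property makes its differential bijective, and the inverse function theorem
applies. Any two invariant metrics are proportional because `SU(n+1)` is transitive on unit tangent
vectors (`exists_smul_eq_of_homMetric_eq_one`). -/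

theorem isVonNBounded_of_pos [FiniteDimensional ℝ E] (B : E →L[ℝ] E →L[ℝ] ℝ)
    (hB : ∀ v, v ≠ 0 → 0 < B v v) : Bornology.IsVonNBounded ℝ {v : E | B v v < 1} := by
  have : ProperSpace E := FiniteDimensional.proper ℝ E
  rw [NormedSpace.isVonNBounded_iff]
  rcases subsingleton_or_nontrivial E with hE | hE
  -- In the zero space the unit sphere is empty, so the minimum used below would not exist.
  · exact Set.Finite.isBounded (Set.toFinite _)
  obtain ⟨m, hm, hmin⟩ := (isCompact_sphere (0 : E) 1).exists_isMinOn
    (NormedSpace.sphere_nonempty.2 zero_le_one) (f := fun v => B v v)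
    (by fun_prop)
  have hm0 : m ≠ 0 := by
    rintro rfl
    simp at hm
  have hpos := hB m hm0
  refine (Metric.isBounded_closedBall (x := (0 : E)) (r := √(1 / B m m))).subset ?_
  intro v hv
  rw [mem_closedBall_zero_iff]
  apply Real.le_sqrt_of_sq_le
  rw [le_div_iff₀ hpos]
  rcases eq_or_ne v 0 with rfl | hv0
  · simp
  have hn : 0 < ‖v‖ := norm_pos_iff.2 hv0
  have h1 := hmin (a := ‖v‖⁻¹ • v) (by simp [norm_smul, hn.ne'])
  simp only [Set.mem_ofPred_eq, map_smul, smul_apply, smul_eq_mul] at h1 hv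
  calc ‖v‖ ^ 2 * B m m ≤ ‖v‖ ^ 2 * (‖v‖⁻¹ * (‖v‖⁻¹ * B v v)) := by gcongr
    _ = B v v := by field_simp
    _ ≤ 1 := hv.le

/-- In the trivialization of the tangent bundle at `p` the section reads as `coordMetric g p`
composed with the chart, so smoothness at the single point `chartAt E p p`, for every `p`, is
enough. -/
theorem isSmoothMetric_of_coordMetric [FiniteDimensional ℝ E] [IsManifold 𝓘(ℝ, E) ∞ M]
    (g : TensorField E M) (hsymm : ∀ p u v, g p u v = g p v u)
    (hpos : ∀ p u, u ≠ 0 → 0 < g p u u)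
    (hsmooth : ∀ p, ContDiffAt ℝ ∞ (coordMetric g p) (chartAt E p p)) : IsSmoothMetric g := by
  refine ⟨⟨g, hsymm, hpos, fun p => isVonNBounded_of_pos (E := E) (g p) (hpos p), ?_⟩, rfl⟩
  intro p
  rw [Bundle.contMDiffAt_section]
  have h1 : ContMDiffAt 𝓘(ℝ, E) 𝓘(ℝ, E →L[ℝ] E →L[ℝ] ℝ) ∞
      (coordMetric g p ∘ chartAt E p) p :=
    (hsmooth p).contMDiffAt.comp p (contMDiffAt_of_mem_maximalAtlas
      (IsManifold.chart_mem_maximalAtlas p) (mem_chart_source E p))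
  refine h1.congr_of_eventuallyEq ?_
  filter_upwards [(chartAt E p).open_source.mem_nhds (mem_chart_source E p)] with q hq
  ext u v
  rw [hom_trivializationAt_apply]
  rw [inCoordinates_apply_eq₂ (by simpa using hq) (by simpa using hq) (by simp)]
  have h2 := TangentBundle.symmL_trivializationAt (I := 𝓘(ℝ, E)) (x₀ := p) (x := q) hq
  have h3 : ∀ u, (trivializationAt E (TangentSpace 𝓘(ℝ, E)) p).symm q u =
      (trivializationAt E (TangentSpace 𝓘(ℝ, E)) p).symmL ℝ q u := fun u =>
    (Bundle.Trivialization.symmL_apply _ (by simpa using hq) u).symm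
  simp only [h3, h2]
  -- The base point `(chartAt E p).symm (chartAt E p q)` equals `q` only propositionally; `key`
  -- moves the form between the two fibres.
  have key : ∀ (q' : M) (_ : q' = q) (a b : E),
      (g q' : E →L[ℝ] E →L[ℝ] ℝ) a b = (g q : E →L[ℝ] E →L[ℝ] ℝ) a b := by
    rintro _ rfl a b
    rfl
  simp only [mfld_simps, mfderivWithin_univ, Function.comp_apply,
    Bundle.Trivial.linearMapAt_trivialization, Bundle.Trivial.fiberBundle_trivializationAt',
    LinearMap.id_coe, id]
  exact (key _ ((chartAt E p).left_inv hq) _ _).symm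

theorem hasMFDerivAt_iff_chart {E' N : Type*} [NormedAddCommGroup E'] [NormedSpace ℝ E']
    [TopologicalSpace N] [ChartedSpace E' N] {f : M → N} {x : M} (f' : E →L[ℝ] E') :
    HasMFDerivAt 𝓘(ℝ, E) 𝓘(ℝ, E') f x f' ↔ ContinuousAt f x ∧
      HasFDerivAt (fun y => chartAt E' (f x) (f ((chartAt E x).symm y))) f' (chartAt E x x) := by
  have h : HasMFDerivAt 𝓘(ℝ, E) 𝓘(ℝ, E') f x f' ↔ ContinuousAt f x ∧
      HasFDerivWithinAt (fun y => chartAt E' (f x) (f ((chartAt E x).symm y))) f'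
        (Set.range (id : E → E)) (chartAt E x x) := Iff.rfl
  rw [h, Set.range_id, hasFDerivWithinAt_univ]

/-- The inverse function theorem of Banach spaces, read in the extended charts at `x` and `f x`. -/
theorem exists_contMDiffAt_rightInverse [CompleteSpace E] [IsManifold 𝓘(ℝ, E) ∞ M] {E' N : Type*}
    [NormedAddCommGroup E'] [NormedSpace ℝ E'] [CompleteSpace E'] [TopologicalSpace N]
    [ChartedSpace E' N] [IsManifold 𝓘(ℝ, E') ∞ N] {f : M → N} {x : M}
    (hf : ContMDiffAt 𝓘(ℝ, E) 𝓘(ℝ, E') ∞ f x)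
    (hbij : Function.Bijective (mfderiv 𝓘(ℝ, E) 𝓘(ℝ, E') f x)) :
    ∃ g : N → M, ContMDiffAt 𝓘(ℝ, E') 𝓘(ℝ, E) ∞ g (f x) ∧ g (f x) = x ∧
      ∀ᶠ y in 𝓝 (f x), f (g y) = y := by
  set φ := extChartAt 𝓘(ℝ, E) x
  set ψ := extChartAt 𝓘(ℝ, E') (f x)
  set F : E → E' := writtenInExtChartAt 𝓘(ℝ, E) 𝓘(ℝ, E') x f with hF
  have hFs : ContDiffAt ℝ ∞ F (φ x) := by
    have := (contMDiffAt_iff.1 hf).2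
    rw [show Set.range 𝓘(ℝ, E) = Set.univ by simp, contDiffWithinAt_univ] at this
    exact this
  let f' : E →L[ℝ] E' := mfderiv 𝓘(ℝ, E) 𝓘(ℝ, E') f x
  have hfd : HasFDerivAt F f' (φ x) := by
    exact (hasMFDerivAt_iff_chart f').1 (hf.mdifferentiableAt (by simp)).hasMFDerivAt |>.2
  replace hbij : Function.Bijective f' := hbij
  let F' : E ≃L[ℝ] E' := ContinuousLinearEquiv.ofBijective f'
    (LinearMap.ker_eq_bot.2 hbij.1) (LinearMap.range_eq_top.2 hbij.2)
  have hF' : HasFDerivAt F (F' : E →L[ℝ] E') (φ x) := hfd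
  have hFx : F (φ x) = ψ (f x) := by simp [hF, writtenInExtChartAt, φ, ψ]
  let L : E' → E := hFs.localInverse hF' (by simp)
  have hL : ContDiffAt ℝ ∞ L (ψ (f x)) := by
    rw [← hFx]; exact hFs.to_localInverse hF' (by simp)
  have hLx : L (ψ (f x)) = φ x := by
    rw [← hFx]; exact hFs.localInverse_apply_image hF' (by simp)
  have hLr : ∀ᶠ y in 𝓝 (ψ (f x)), F (L y) = y := by
    rw [← hFx]
    exact (hFs.hasStrictFDerivAt' hF' (by simp)).eventually_right_inverse
  have hψ : ContMDiffAt 𝓘(ℝ, E') 𝓘(ℝ, E') ∞ ψ (f x) := contMDiffAt_extChartAt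
  have hφ : ContMDiffAt 𝓘(ℝ, E) 𝓘(ℝ, E) ∞ φ.symm (φ x) :=
    (contMDiffOn_extChartAt_symm x).contMDiffAt (extChartAt_target_mem_nhds x)
  have hg : ContMDiffAt 𝓘(ℝ, E') 𝓘(ℝ, E) ∞ (fun y => φ.symm (L (ψ y))) (f x) := by
    have h1 : ContMDiffAt 𝓘(ℝ, E') 𝓘(ℝ, E) ∞ (fun y => L (ψ y)) (f x) :=
      hL.contMDiffAt.comp (f x) hψ
    exact ContMDiffAt.comp (f x) (by rw [hLx]; exact hφ) h1
  have hgx : φ.symm (L (ψ (f x))) = x := by rw [hLx]; exact extChartAt_to_inv x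
  refine ⟨fun y => φ.symm (L (ψ y)), hg, hgx, ?_⟩
  have hc : ContinuousAt (fun y => f (φ.symm (L (ψ y)))) (f x) :=
    ContinuousAt.comp (g := f) (by rw [hgx]; exact hf.continuousAt) hg.continuousAt
  -- The identity `F (L y) = y` lives in the chart; it gives equality in `N` only where both points
  -- lie in the chart domain, on which `ψ` is injective.
  have h1 : ∀ᶠ y in 𝓝 (f x), f (φ.symm (L (ψ y))) ∈ ψ.source := by
    refine hc.eventually_mem ?_
    rw [hgx]
    exact extChartAt_source_mem_nhds _
  filter_upwards [h1, extChartAt_source_mem_nhds (I := 𝓘(ℝ, E')) (f x),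
    hψ.continuousAt.eventually hLr] with y hy1 hy2 hy3
  exact ψ.injOn hy1 hy2 hy3

/-- A smooth bijection with bijective differentials is a diffeomorphism. -/
theorem exists_diffeomorph_of_bijective [CompleteSpace E] [IsManifold 𝓘(ℝ, E) ∞ M] {E' N : Type*}
    [NormedAddCommGroup E'] [NormedSpace ℝ E'] [CompleteSpace E'] [TopologicalSpace N]
    [ChartedSpace E' N] [IsManifold 𝓘(ℝ, E') ∞ N] {f : M → N}
    (hf : ContMDiff 𝓘(ℝ, E) 𝓘(ℝ, E') ∞ f) (hb : Function.Bijective f)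
    (hbij : ∀ x, Function.Bijective (mfderiv 𝓘(ℝ, E) 𝓘(ℝ, E') f x)) :
    ∃ Φ : Diffeomorph 𝓘(ℝ, E) 𝓘(ℝ, E') M N ∞, ⇑Φ = f := by
  refine ⟨⟨Equiv.ofBijective f hb, hf, fun y => ?_⟩, rfl⟩
  obtain ⟨x, rfl⟩ := hb.2 y
  obtain ⟨g, hg, -, hfg⟩ := exists_contMDiffAt_rightInverse (hf x) (hbij x)
  refine hg.congr_of_eventuallyEq ?_
  filter_upwards [hfg] with y hy
  exact (Equiv.ofBijective f hb).symm_apply_eq.2 hy.symm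

end Generic


/-! ### The differential of the projection and the Fubini-Study form -/

/-- The Fubini-Study Hermitian form on `ℂᵐ ∖ {0}`, complex linear in the second vector. -/
noncomputable def hermForm {m : ℕ} (z v w : Cn m) : ℂ :=
  inner ℂ v w / (‖z‖ : ℂ) ^ 2 - inner ℂ v z * inner ℂ z w / (‖z‖ : ℂ) ^ 4

theorem inner_self_complex {m : ℕ} (z : Cn m) : inner ℂ z z = (‖z‖ : ℂ) ^ 2 :=
  inner_self_eq_norm_sq_to_K z

theorem norm_complex_ne_zero {m : ℕ} {z : Cn m} (hz : z ≠ 0) : (‖z‖ : ℂ) ≠ 0 :=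
  Complex.ofReal_ne_zero.2 (norm_ne_zero_iff.2 hz)

/-- This invariance under rescaling and under vertical shifts is what lets the form descend to
projective space: a change of representative or of affine chart has exactly this effect. -/
theorem hermForm_smul_add {m : ℕ} {z : Cn m} (hz : z ≠ 0) {c : ℂ} (hc : c ≠ 0) (a b : ℂ)
    (v w : Cn m) : hermForm (c • z) (c • v + a • z) (c • w + b • z) = hermForm z v w := by
  have h := norm_complex_ne_zero hz
  have hc' : (starRingEnd ℂ) c ≠ 0 := by simpa using hc
  have hn : ((‖c‖ : ℝ) : ℂ) ^ 2 = c * (starRingEnd ℂ) c := (Complex.mul_conj' c).symm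
  have h4 : ((‖c‖ : ℝ) : ℂ) ^ 4 = (c * (starRingEnd ℂ) c) ^ 2 := by rw [← hn]; ring
  simp only [hermForm, inner_add_left, inner_add_right, inner_smul_left, inner_smul_right,
    norm_smul, inner_self_complex, Complex.ofReal_mul, mul_pow, hn, h4]
  field_simp
  ring

theorem hermForm_of_norm_one {m : ℕ} {z v w : Cn m} (hz : ‖z‖ = 1) (hw : inner ℂ z w = 0) :
    hermForm z v w = inner ℂ v w := by
  simp [hermForm, hz, hw]

theorem inner_slot {n : ℕ} (i : Fin (n + 1)) (u v : Cn n) :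
    inner ℂ (slot i u) (slot i v) = inner ℂ u v := by
  simp [PiLp.inner_apply, Fin.sum_univ_succAbove _ i]

theorem inner_affineLift_slot {n : ℕ} (i : Fin (n + 1)) (t v : Cn n) :
    inner ℂ (affineLift i t) (slot i v) = inner ℂ t v := by
  simp [PiLp.inner_apply, Fin.sum_univ_succAbove _ i]

theorem inner_slot_affineLift {n : ℕ} (i : Fin (n + 1)) (t v : Cn n) :
    inner ℂ (slot i v) (affineLift i t) = inner ℂ v t := by
  simp [PiLp.inner_apply, Fin.sum_univ_succAbove _ i]

theorem norm_affineLift_sq {n : ℕ} (i : Fin (n + 1)) (t : Cn n) :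
    ‖affineLift i t‖ ^ 2 = 1 + ‖t‖ ^ 2 := by
  simp [EuclideanSpace.norm_sq_eq, Fin.sum_univ_succAbove _ i]

theorem innerSL_real_apply {m : ℕ} (x y : Cn m) : innerSL ℝ x y = (inner ℂ x y).re := by
  simp [PiLp.inner_apply]

theorem fubiniStudy_apply {n : ℕ} (p : CP n) (u v : Cn n) :
    (fubiniStudy n p : Cn n →L[ℝ] Cn n →L[ℝ] ℝ) u v =
      (hermForm (affineLift (chartIndex p) (affineMap (chartIndex p) p))
        (slot (chartIndex p) u) (slot (chartIndex p) v)).re := by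
  set i := chartIndex p
  set σ := affineLift i (affineMap i p) with hσ
  have hs : σ ≠ 0 := affineLift_ne_zero _ _
  have h0 : (fubiniStudy n p : Cn n →L[ℝ] Cn n →L[ℝ] ℝ) u v =
    innerSL ℝ (horizontalLift i (affineMap i p) u) (horizontalLift i (affineMap i p) v) := rfl
  have hh : ∀ u, horizontalLift i (affineMap i p) u =
      (‖σ‖⁻¹ : ℂ) • (slot i u - (inner ℂ σ (slot i u) / (‖σ‖ : ℂ) ^ 2) • σ) := by
    intro u
    have : horizontalLift i (affineMap i p) u = (‖σ‖⁻¹ : ℂ) •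
      ((Submodule.span ℂ {σ})ᗮ.starProjection (slot i u)) := rfl
    rw [this, Submodule.starProjection_orthogonal_val, Submodule.starProjection_singleton]
    simp
  have hn := norm_complex_ne_zero hs
  rw [h0, innerSL_real_apply, hh, hh]
  congr 1
  simp only [inner_sub_left, inner_sub_right, inner_smul_left, inner_smul_right,
    inner_self_complex, hermForm, map_div₀, map_inv₀, Complex.conj_ofReal, map_pow,
    inner_conj_symm]
  field_simp
  ring

theorem slot_affineCoord {n : ℕ} (k : Fin (n + 1)) (z : Cn (n + 1)) (hz : z k ≠ 0) :
    slot k (affineCoord k z) = (z k)⁻¹ • z - EuclideanSpace.single k 1 := by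
  ext m
  refine Fin.succAboveCases k ?_ (fun j => ?_) m
  · simp [hz]
  · simp [affineCoord, Fin.succAbove_ne, div_eq_inv_mul]

theorem affineLift_affineCoord {n : ℕ} (k : Fin (n + 1)) (z : Cn (n + 1)) (hz : z k ≠ 0) :
    affineLift k (affineCoord k z) = (z k)⁻¹ • z := by
  rw [affineLift, slot_affineCoord k z hz, add_sub_cancel]

theorem contDiffAt_affineCoord {n : ℕ} (k : Fin (n + 1)) {z : Cn (n + 1)} (hz : z k ≠ 0) :
    ContDiffAt ℂ ω (affineCoord k) z := by
  have hc : ∀ m : Fin (n + 1), ContDiff ℂ ω (fun z : Cn (n + 1) => z m) := fun m =>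
    (EuclideanSpace.proj (𝕜 := ℂ) m : Cn (n + 1) →L[ℂ] ℂ).contDiff
  rw [contDiffAt_piLp]
  intro j
  exact (hc _).contDiffAt.div (hc k).contDiffAt hz

theorem contDiffAt_affineCoord_real {n : ℕ} (k : Fin (n + 1)) {z : Cn (n + 1)} (hz : z k ≠ 0) :
    ContDiffAt ℝ ∞ (affineCoord k) z :=
  ((contDiffAt_affineCoord k hz).restrict_scalars ℝ).of_le le_top

/-- Comes from differentiating `z ↦ z / z_k - e_k`. The result has the shape `c v + a z` required by
`hermForm_smul_add`. -/
theorem slot_fderiv_affineCoord {n : ℕ} (k : Fin (n + 1)) {z : Cn (n + 1)} (hz : z k ≠ 0)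
    (v : Cn (n + 1)) : slot k (fderiv ℝ (affineCoord k) z v) =
      (z k)⁻¹ • v + (-(v k) / (z k) ^ 2) • z := by
  have h1 : HasFDerivAt (affineCoord k) (fderiv ℝ (affineCoord k) z) z :=
    ((contDiffAt_affineCoord_real k hz).differentiableAt (by simp)).hasFDerivAt
  have h2 : HasFDerivAt (fun y => slot k (affineCoord k y))
      (((slot k).restrictScalars ℝ) ∘L (fderiv ℝ (affineCoord k) z)) z :=
    ((slot k).restrictScalars ℝ).hasFDerivAt.comp z h1
  have hp : HasFDerivAt (fun y : Cn (n + 1) => y k)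
      (EuclideanSpace.proj (𝕜 := ℂ) k : Cn (n + 1) →L[ℂ] ℂ) z :=
    (EuclideanSpace.proj (𝕜 := ℂ) k : Cn (n + 1) →L[ℂ] ℂ).hasFDerivAt
  have h3 := (((hasDerivAt_inv hz).comp_hasFDerivAt z hp).smul (hasFDerivAt_id z)).sub_const
    (EuclideanSpace.single k (1 : ℂ))
  have h4 := h2.congr_of_eventuallyEq (f₁ := fun y : Cn (n + 1) =>
      (y k)⁻¹ • y - EuclideanSpace.single k 1) (by
    have : ∀ᶠ y : Cn (n + 1) in 𝓝 z, y k ≠ 0 :=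
      ContinuousAt.eventually_ne (by fun_prop) hz
    filter_upwards [this] with y hy
    exact (slot_affineCoord k y hy).symm)
  have h5 := DFunLike.congr_fun (h4.unique (h3.restrictScalars ℝ)) v
  simp at h5
  rw [h5]
  rw [← neg_smul]
  congr 2
  field_simp

theorem proj_of_ne {n : ℕ} {z : Cn (n + 1)} (hz : z ≠ 0) : proj n z = Projectivization.mk ℂ z hz := by
  simp [proj, hz]

theorem proj_mem_affineSet {n : ℕ} {i : Fin (n + 1)} {z : Cn (n + 1)} (hz : z ≠ 0) :
    proj n z ∈ affineSet i ↔ z i ≠ 0 := by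
  rw [proj_of_ne hz, mk_mem_affineSet]

theorem affineMap_proj {n : ℕ} (i : Fin (n + 1)) {z : Cn (n + 1)} (hz : z ≠ 0) :
    affineMap i (proj n z) = affineCoord i z := by
  rw [proj_of_ne hz]; rfl

theorem chartIndex_mem {n : ℕ} (p : CP n) : p ∈ affineSet (chartIndex p) :=
  (exists_mem_affineSet p).choose_spec

theorem chartIndex_proj_ne {n : ℕ} {z : Cn (n + 1)} (hz : z ≠ 0) :
    z (chartIndex (proj n z)) ≠ 0 :=
  (proj_mem_affineSet hz).1 (chartIndex_mem _)

theorem proj_affineLift {n : ℕ} (i : Fin (n + 1)) (t : Cn n) :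
    proj n (affineLift i t) = (affineChart i).symm t := by
  rw [proj_of_ne (affineLift_ne_zero i t)]; rfl

theorem proj_smul {n : ℕ} {c : ℂ} (hc : c ≠ 0) {z : Cn (n + 1)} (hz : z ≠ 0) :
    proj n (c • z) = proj n z := by
  rw [proj_of_ne hz, proj_of_ne (smul_ne_zero hc hz)]
  exact (Projectivization.mk_eq_mk_iff' ℂ _ _ _ _).2 ⟨c, rfl⟩

theorem exists_proj_eq {n : ℕ} (p : CP n) : ∃ z : Cn (n + 1), ‖z‖ = 1 ∧ proj n z = p := by
  have h := p.rep_nonzero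
  have hn := norm_complex_ne_zero h
  refine ⟨(‖p.rep‖ : ℂ)⁻¹ • p.rep, ?_, ?_⟩
  · simp [norm_smul, h]
  · rw [proj_smul (inv_ne_zero hn) h, proj_of_ne h, Projectivization.mk_rep]

theorem continuousAt_proj {n : ℕ} {z : Cn (n + 1)} (hz : z ≠ 0) : ContinuousAt (proj n) z := by
  have h : ContinuousOn (proj n) {z | z ≠ 0} := by
    rw [continuousOn_iff_continuous_domRestrict]
    refine (isQuotientMap_mk' n).continuous.congr fun v => ?_
    exact (proj_of_ne v.2).symm
  exact h.continuousAt (isOpen_ne.mem_nhds hz)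

theorem hasMFDerivAt_proj {n : ℕ} {z : Cn (n + 1)} (hz : z ≠ 0) :
    HasMFDerivAt 𝓘(ℝ, Cn (n + 1)) 𝓘(ℝ, Cn n) (proj n) z
      (fderiv ℝ (affineCoord (chartIndex (proj n z))) z : Cn (n + 1) →L[ℝ] Cn n) := by
  rw [hasMFDerivAt_iff_chart]
  refine ⟨continuousAt_proj hz, ?_⟩
  have h1 := ((contDiffAt_affineCoord_real _ (chartIndex_proj_ne hz)).differentiableAt
    (by simp)).hasFDerivAt
  refine h1.congr_of_eventuallyEq ?_
  filter_upwards [isOpen_ne.mem_nhds hz] with y hy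
  exact affineMap_proj _ hy

theorem contMDiffAt_proj {n : ℕ} {z : Cn (n + 1)} (hz : z ≠ 0) :
    ContMDiffAt 𝓘(ℝ, Cn (n + 1)) 𝓘(ℝ, Cn n) ∞ (proj n) z := by
  rw [contMDiffAt_iff_target]
  refine ⟨continuousAt_proj hz, ?_⟩
  have h1 := (contDiffAt_affineCoord_real _ (chartIndex_proj_ne hz)).contMDiffAt
  refine h1.congr_of_eventuallyEq ?_
  filter_upwards [isOpen_ne.mem_nhds hz] with y hy
  exact affineMap_proj _ hy

theorem pullback_apply_of_hasMFDerivAt {E M E' M' : Type*} [NormedAddCommGroup E]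
    [NormedSpace ℝ E] [TopologicalSpace M] [ChartedSpace E M] [NormedAddCommGroup E']
    [NormedSpace ℝ E'] [TopologicalSpace M'] [ChartedSpace E' M'] {f : M → M'} {p : M}
    {f' : E →L[ℝ] E'} (hf : HasMFDerivAt 𝓘(ℝ, E) 𝓘(ℝ, E') f p f') (g : TensorField E' M')
    (u v : E) : (pullback f g p : E →L[ℝ] E →L[ℝ] ℝ) u v =
      (g (f p) : E' →L[ℝ] E' →L[ℝ] ℝ) (f' u) (f' v) := by
  have h : (mfderiv 𝓘(ℝ, E) 𝓘(ℝ, E') f p : E →L[ℝ] E') = f' := hf.mfderiv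
  rw [← h]
  rfl

theorem mfderiv_proj {n : ℕ} {z : Cn (n + 1)} (hz : z ≠ 0) (v : Cn (n + 1)) :
    mfderiv 𝓘(ℝ, Cn (n + 1)) 𝓘(ℝ, Cn n) (proj n) z v =
      fderiv ℝ (affineCoord (chartIndex (proj n z))) z v :=
  DFunLike.congr_fun (hasMFDerivAt_proj hz).mfderiv v

/-- The pull-back of the Fubini-Study metric to `ℂⁿ⁺¹ ∖ {0}`. -/
theorem pullback_proj {n : ℕ} {z : Cn (n + 1)} (hz : z ≠ 0) (v w : Cn (n + 1)) :
    pullback (proj n) (fubiniStudy n) z v w = (hermForm z v w).re := by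
  have hk := chartIndex_proj_ne hz
  refine (pullback_apply_of_hasMFDerivAt (hasMFDerivAt_proj hz) _ _ _).trans ?_
  refine (fubiniStudy_apply _ _ _).trans ?_
  -- Base point and both tangent vectors are now scaled by the same `(z k)⁻¹`, up to multiples of
  -- `z`.
  rw [slot_fderiv_affineCoord _ hk, slot_fderiv_affineCoord _ hk, affineMap_proj _ hz,
    affineLift_affineCoord _ _ hk, hermForm_smul_add hz (inv_ne_zero hk)]

theorem hasMFDerivAt_proj_comp {n : ℕ} {V : Type*} [NormedAddCommGroup V] [NormedSpace ℝ V]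
    {ζ : V → Cn (n + 1)} {ζ' : V →L[ℝ] Cn (n + 1)} {y : V} (hζ : HasFDerivAt ζ ζ' y)
    (hy : ζ y ≠ 0) :
    HasMFDerivAt 𝓘(ℝ, V) 𝓘(ℝ, Cn n) (fun y => proj n (ζ y)) y
      (fderiv ℝ (affineCoord (chartIndex (proj n (ζ y)))) (ζ y) ∘L ζ' : V →L[ℝ] Cn n) :=
  (hasMFDerivAt_proj hy).comp y hζ.hasMFDerivAt

theorem pullback_proj_comp {n : ℕ} {V : Type*} [NormedAddCommGroup V] [NormedSpace ℝ V]
    {ζ : V → Cn (n + 1)} {ζ' : V →L[ℝ] Cn (n + 1)} {y : V} (hζ : HasFDerivAt ζ ζ' y)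
    (hy : ζ y ≠ 0) (u v : V) :
    pullback (fun y => proj n (ζ y)) (fubiniStudy n) y u v = (hermForm (ζ y) (ζ' u) (ζ' v)).re :=
  (pullback_apply_of_hasMFDerivAt (hasMFDerivAt_proj_comp hζ hy) _ _ _).trans <|
    (pullback_apply_of_hasMFDerivAt (hasMFDerivAt_proj hy) _ _ _).symm.trans (pullback_proj hy _ _)


/-! ### Christoffel symbols and curvature in coordinates -/

section Coordinates

variable {E : Type*} [NormedAddCommGroup E] [NormedSpace ℝ E]

/-- Positivity makes `B : E → E*` injective, and the two spaces have equal dimension. -/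
theorem isInvertible_of_pos [FiniteDimensional ℝ E] {B : E →L[ℝ] E →L[ℝ] ℝ}
    (hB : ∀ v, v ≠ 0 → 0 < B v v) : B.IsInvertible := by
  have hinj : Function.Injective (B : E →ₗ[ℝ] E →L[ℝ] ℝ) := by
    rw [injective_iff_map_eq_zero]
    intro v hv
    by_contra h
    have hv' : B v = 0 := hv
    simpa [hv'] using hB v h
  have hfr : Module.finrank ℝ E = Module.finrank ℝ (E →L[ℝ] ℝ) := by
    rw [← (LinearMap.toContinuousLinearMap (𝕜 := ℝ) (E := E) (F' := ℝ)).finrank_eq]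
    exact (Subspace.dual_finrank_eq (K := ℝ) (V := E)).symm
  exact ⟨(LinearEquiv.ofInjectiveOfFinrankEq _ hinj hfr).toContinuousLinearEquiv,
    by ext; rfl⟩

theorem christoffel_eq_of_koszul {G : E → E →L[ℝ] E →L[ℝ] ℝ} {y u v x : E}
    (hG : (G y).IsInvertible) (h : ∀ w, G y x w = koszul G y u v w) :
    christoffel G y u v = x := by
  rw [christoffel_apply, hG.inverse_apply_eq]
  ext w
  exact (h w).symm

theorem fderiv_clm_apply_eq {F F' V : Type*} [NormedAddCommGroup F] [NormedSpace ℝ F]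
    [NormedAddCommGroup F'] [NormedSpace ℝ F'] [NormedAddCommGroup V] [NormedSpace ℝ V]
    {G : V → F →L[ℝ] F'} {y : V} (hG : DifferentiableAt ℝ G y) (u : V) (v : F) :
    fderiv ℝ G y u v = fderiv ℝ (fun y => G y v) y u := by
  rw [fderiv_clm_apply hG (differentiableAt_const v)]
  simp

theorem hasDerivAt_line {V : Type*} [NormedAddCommGroup V] [NormedSpace ℝ V] (t u : V) :
    HasDerivAt (fun s : ℝ => t + s • u) u 0 := by
  simpa using ((hasDerivAt_id (0 : ℝ)).smul_const u).const_add t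

/-- Smoothness is always known beforehand here, so a total derivative can be read off along real
lines, where inner products are easy to differentiate. -/
theorem fderiv_eq_of_hasDerivAt {V F : Type*} [NormedAddCommGroup V] [NormedSpace ℝ V]
    [NormedAddCommGroup F] [NormedSpace ℝ F] {f : V → F} {t u : V} {x : F}
    (hf : DifferentiableAt ℝ f t) (h : HasDerivAt (fun s : ℝ => f (t + s • u)) x 0) :
    fderiv ℝ f t u = x := by
  have h2 : HasFDerivAt f (fderiv ℝ f t) (t + (0 : ℝ) • u) := by simpa using hf.hasFDerivAt
  exact (h2.comp_hasDerivAt (0 : ℝ) (hasDerivAt_line t u)).unique h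

end Coordinates

/-! ### The Fubini-Study metric in affine coordinates -/

/-- The factor `1 / (1 + |t|²)`. -/
noncomputable def conformalFactor {n : ℕ} (t : Cn n) : ℂ := (1 + inner ℂ t t)⁻¹

/-- The Hermitian form `((1 + |t|²) ⟨u, v⟩ - ⟨u, t⟩ ⟨t, v⟩) / (1 + |t|²)²`. -/
noncomputable def coordHerm {n : ℕ} (t u v : Cn n) : ℂ :=
  conformalFactor t * inner ℂ u v - conformalFactor t ^ 2 * (inner ℂ u t * inner ℂ t v)

/-- The Christoffel symbols `-(⟨t, u⟩ v + ⟨t, v⟩ u) / (1 + |t|²)`. -/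
noncomputable def chernGamma {n : ℕ} (t u v : Cn n) : Cn n :=
  (-conformalFactor t) • (inner ℂ t u • v + inner ℂ t v • u)

section

variable {n : ℕ}

theorem one_add_inner_self (t : Cn n) : (1 : ℂ) + inner ℂ t t = ((1 + ‖t‖ ^ 2 : ℝ) : ℂ) := by
  rw [inner_self_complex]; push_cast; ring

theorem one_add_inner_self_ne_zero (t : Cn n) : (1 : ℂ) + inner ℂ t t ≠ 0 := by
  rw [one_add_inner_self]
  exact Complex.ofReal_ne_zero.2 (by positivity)

theorem conformalFactor_eq (t : Cn n) : conformalFactor t = (((1 + ‖t‖ ^ 2)⁻¹ : ℝ) : ℂ) := by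
  rw [conformalFactor, one_add_inner_self]; push_cast; rfl

theorem conj_conformalFactor (t : Cn n) :
    (starRingEnd ℂ) (conformalFactor t) = conformalFactor t := by
  rw [conformalFactor_eq, Complex.conj_ofReal]

theorem hermForm_affineLift (i : Fin (n + 1)) (t u v : Cn n) :
    hermForm (affineLift i t) (slot i u) (slot i v) = coordHerm t u v := by
  have h : ((‖affineLift i t‖ : ℝ) : ℂ) ^ 2 = 1 + inner ℂ t t := by
    rw [one_add_inner_self, ← norm_affineLift_sq i]; push_cast; ring
  have h4 : ((‖affineLift i t‖ : ℝ) : ℂ) ^ 4 = (1 + inner ℂ t t) ^ 2 := by rw [← h]; ring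
  simp only [hermForm, h, h4, inner_slot, inner_slot_affineLift, inner_affineLift_slot,
    coordHerm, conformalFactor]
  field_simp

theorem coordHerm_conj (t u v : Cn n) : (starRingEnd ℂ) (coordHerm t u v) = coordHerm t v u := by
  simp only [coordHerm, map_sub, map_mul, map_pow, conj_conformalFactor, inner_conj_symm]
  ring

theorem coordHerm_re_comm (t u v : Cn n) : (coordHerm t u v).re = (coordHerm t v u).re := by
  rw [← coordHerm_conj, Complex.conj_re]

theorem coordHerm_add_left (t u u' v : Cn n) :
    coordHerm t (u + u') v = coordHerm t u v + coordHerm t u' v := by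
  simp only [coordHerm, inner_add_left]; ring

theorem coordHerm_add_right (t u v v' : Cn n) :
    coordHerm t u (v + v') = coordHerm t u v + coordHerm t u v' := by
  simp only [coordHerm, inner_add_right]; ring

theorem coordHerm_smul_left (t u v : Cn n) (c : ℂ) :
    coordHerm t (c • u) v = (starRingEnd ℂ) c * coordHerm t u v := by
  simp only [coordHerm, inner_smul_left]; ring

theorem coordHerm_smul_right (t u v : Cn n) (c : ℂ) :
    coordHerm t u (c • v) = c * coordHerm t u v := by
  simp only [coordHerm, inner_smul_right]; ring

theorem coordHerm_self (t u : Cn n) : coordHerm t u u = ((coordHerm t u u).re : ℂ) :=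
  (Complex.conj_eq_iff_re.1 (coordHerm_conj t u u)).symm

/-- Cauchy–Schwarz for `t, u`; the summand `1` of `1 + |t|²` makes the inequality strict. -/
theorem coordHerm_self_pos (t : Cn n) {u : Cn n} (hu : u ≠ 0) : 0 < (coordHerm t u u).re := by
  have h1 : coordHerm t u u = (((1 + ‖t‖ ^ 2)⁻¹ * ‖u‖ ^ 2 -
      ((1 + ‖t‖ ^ 2)⁻¹) ^ 2 * ‖inner ℂ t u‖ ^ 2 : ℝ) : ℂ) := by
    have : inner ℂ u t * inner ℂ t u = ((‖inner ℂ t u‖ ^ 2 : ℝ) : ℂ) := by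
      rw [← inner_conj_symm u t, Complex.conj_mul']; push_cast; rfl
    rw [coordHerm, this, inner_self_complex, conformalFactor_eq]
    push_cast
    rfl
  rw [h1, Complex.ofReal_re]
  have h2 : ‖inner ℂ t u‖ ^ 2 ≤ ‖t‖ ^ 2 * ‖u‖ ^ 2 := by
    rw [← mul_pow]
    gcongr
    exact norm_inner_le_norm t u
  have h3 : 0 < ‖u‖ ^ 2 := by positivity
  have h4 : (1 + ‖t‖ ^ 2)⁻¹ * ‖u‖ ^ 2 - ((1 + ‖t‖ ^ 2)⁻¹) ^ 2 * ‖inner ℂ t u‖ ^ 2 =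
      ((1 + ‖t‖ ^ 2)⁻¹) ^ 2 * (‖u‖ ^ 2 + ‖t‖ ^ 2 * ‖u‖ ^ 2 - ‖inner ℂ t u‖ ^ 2) := by
    field_simp
  rw [h4]
  have : 0 < ‖u‖ ^ 2 + ‖t‖ ^ 2 * ‖u‖ ^ 2 - ‖inner ℂ t u‖ ^ 2 := by linarith
  positivity

theorem chernGamma_comm (t u v : Cn n) : chernGamma t u v = chernGamma t v u := by
  rw [chernGamma, chernGamma, add_comm]

theorem contDiff_inner_left (v : Cn n) : ContDiff ℝ ∞ (fun t : Cn n => inner ℂ t v) :=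
  contDiff_id.inner ℂ contDiff_const

theorem contDiff_conformalFactor : ContDiff ℝ ∞ (conformalFactor (n := n)) :=
  ContDiff.inv (contDiff_const.add (contDiff_id.inner ℂ contDiff_id)) one_add_inner_self_ne_zero

theorem contDiff_coordHerm (u v : Cn n) : ContDiff ℝ ∞ (fun t : Cn n => coordHerm t u v) := by
  unfold coordHerm
  exact (contDiff_conformalFactor.mul contDiff_const).sub ((contDiff_conformalFactor.pow 2).mul
    ((contDiff_const.inner ℂ contDiff_id).mul (contDiff_inner_left v)))

theorem contDiff_chernGamma (u v : Cn n) : ContDiff ℝ ∞ (fun t : Cn n => chernGamma t u v) := by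
  unfold chernGamma
  exact contDiff_conformalFactor.neg.smul (((contDiff_inner_left u).smul contDiff_const).add
    ((contDiff_inner_left v).smul contDiff_const))

theorem hasDerivAt_inner_left (t u v : Cn n) :
    HasDerivAt (fun s : ℝ => inner ℂ (t + s • u) v) (inner ℂ u v) 0 := by
  refine ((hasDerivAt_line t u).inner ℂ (hasDerivAt_const (0 : ℝ) v)).congr_deriv ?_
  simp

theorem hasDerivAt_inner_right (t u v : Cn n) :
    HasDerivAt (fun s : ℝ => inner ℂ v (t + s • u)) (inner ℂ v u) 0 := by
  refine ((hasDerivAt_const (0 : ℝ) v).inner ℂ (hasDerivAt_line t u)).congr_deriv ?_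
  simp

theorem hasDerivAt_conformalFactor (t u : Cn n) :
    HasDerivAt (fun s : ℝ => conformalFactor (t + s • u))
      (-conformalFactor t ^ 2 * (inner ℂ u t + inner ℂ t u)) 0 := by
  have h := ((hasDerivAt_line t u).inner ℂ (hasDerivAt_line t u)).const_add 1
  have h2 := HasDerivAt.fun_inv h (by simpa using one_add_inner_self_ne_zero t)
  refine h2.congr_deriv ?_
  simp only [zero_smul, add_zero, conformalFactor]
  field_simp
  ring

/-- Metric compatibility of `chernGamma`, over `ℂ`. Its real part determines the Levi-Civita
connection, its imaginary part the differential of the fundamental form. -/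
theorem hasDerivAt_coordHerm (t u v w : Cn n) :
    HasDerivAt (fun s : ℝ => coordHerm (t + s • u) v w)
      (coordHerm t (chernGamma t u v) w + coordHerm t v (chernGamma t u w)) 0 := by
  have h := ((hasDerivAt_conformalFactor t u).mul_const (inner ℂ v w)).sub
    (((hasDerivAt_conformalFactor t u).pow 2).mul
      ((hasDerivAt_inner_right t u v).mul (hasDerivAt_inner_left t u w)))
  refine h.congr_deriv ?_
  simp [coordHerm, chernGamma, inner_smul_left, inner_smul_right,
    conj_conformalFactor]
  ring

theorem hasDerivAt_chernGamma (t u v w : Cn n) :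
    HasDerivAt (fun s : ℝ => chernGamma (t + s • u) v w)
      ((conformalFactor t ^ 2 * (inner ℂ u t + inner ℂ t u)) •
          (inner ℂ t v • w + inner ℂ t w • v)
        - conformalFactor t • (inner ℂ u v • w + inner ℂ u w • v)) 0 := by
  have h := ((hasDerivAt_conformalFactor t u).neg).smul
    (((hasDerivAt_inner_left t u v).smul_const w).add
      ((hasDerivAt_inner_left t u w).smul_const v))
  refine h.congr_deriv ?_
  simp
  module

section Metric

variable {G : Cn n → Cn n →L[ℝ] Cn n →L[ℝ] ℝ}

theorem contDiff_of_coordHerm (hG : ∀ t u v, G t u v = (coordHerm t u v).re) : ContDiff ℝ ∞ G := by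
  rw [contDiff_clm_apply_iff]
  intro u
  rw [contDiff_clm_apply_iff]
  intro v
  simp only [hG]
  exact Complex.reCLM.contDiff.comp (contDiff_coordHerm u v)

theorem isInvertible_of_coordHerm (hG : ∀ t u v, G t u v = (coordHerm t u v).re)
    (t : Cn n) : (G t).IsInvertible :=
  isInvertible_of_pos fun v hv => by rw [hG]; exact coordHerm_self_pos t hv

theorem fderiv_of_coordHerm (hG : ∀ t u v, G t u v = (coordHerm t u v).re)
    (t u v w : Cn n) :
    fderiv ℝ G t u v w =
      (coordHerm t (chernGamma t u v) w + coordHerm t v (chernGamma t u w)).re := by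
  have hd : Differentiable ℝ G := (contDiff_of_coordHerm hG).differentiable (by simp)
  rw [fderiv_clm_apply_eq (hd t), fderiv_clm_apply_eq (by fun_prop)]
  refine fderiv_eq_of_hasDerivAt (by fun_prop) ?_
  simp only [hG]
  exact Complex.reCLM.hasFDerivAt.comp_hasDerivAt (0 : ℝ) (hasDerivAt_coordHerm t u v w)

/-- Inserting compatibility into the Koszul formula leaves six terms; by the symmetry of
`chernGamma` and of the real part of the form, four cancel and two coincide. -/
theorem christoffel_of_coordHerm (hG : ∀ t u v, G t u v = (coordHerm t u v).re)
    (t u v : Cn n) : christoffel G t u v = chernGamma t u v := by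
  refine christoffel_eq_of_koszul (isInvertible_of_coordHerm hG t) fun w => ?_
  rw [koszul_apply, hG]
  simp only [fderiv_of_coordHerm hG, Complex.add_re]
  rw [coordHerm_re_comm t v, coordHerm_re_comm t u (chernGamma t v w), chernGamma_comm t u w,
    chernGamma_comm t v w, chernGamma_comm t v u, coordHerm_re_comm t u]
  ring

/-- The curvature tensor of the Fubini-Study metric. -/
theorem coordCurvature_of_coordHerm (hG : ∀ t u v, G t u v = (coordHerm t u v).re)
    (t u v w : Cn n) :
    coordCurvature G t u v w = coordHerm t v w • u - coordHerm t u w • v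
      - (coordHerm t u v - coordHerm t v u) • w := by
  have hc : ContDiff ℝ ∞ (christoffel G) := by
    rw [contDiff_clm_apply_iff]
    intro u
    rw [contDiff_clm_apply_iff]
    intro v
    simp only [christoffel_of_coordHerm hG]
    exact contDiff_chernGamma u v
  have hd : Differentiable ℝ (christoffel G) := hc.differentiable (by simp)
  have hD : ∀ u v w, fderiv ℝ (christoffel G) t u v w =
      (conformalFactor t ^ 2 * (inner ℂ u t + inner ℂ t u)) •
          (inner ℂ t v • w + inner ℂ t w • v)
        - conformalFactor t • (inner ℂ u v • w + inner ℂ u w • v) := by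
    intro u v w
    rw [fderiv_clm_apply_eq (hd t), fderiv_clm_apply_eq (by fun_prop)]
    refine fderiv_eq_of_hasDerivAt (by fun_prop) ?_
    simp only [christoffel_of_coordHerm hG]
    exact hasDerivAt_chernGamma t u v w
  rw [coordCurvature_apply, hD, hD]
  simp only [christoffel_of_coordHerm hG, chernGamma, coordHerm, inner_add_right, inner_smul_right]
  module

end Metric

end

/-- The inverse chart is the projection composed with the affine lift, so this is a case of
`pullback_proj_comp`. The formula holds on all of `ℂⁿ` and does not depend on the chart. -/
theorem coordMetric_fubiniStudy {n : ℕ} (p : CP n) (t u v : Cn n) :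
    coordMetric (fubiniStudy n) p t u v = (coordHerm t u v).re := by
  have h1 : ⇑(chartAt (Cn n) p).symm = fun y => proj n (affineLift (chartIndex p) y) := by
    ext1 y
    exact (proj_affineLift _ y).symm
  have h2 : HasFDerivAt (affineLift (chartIndex p)) ((slot (chartIndex p)).restrictScalars ℝ) t :=
    (((slot (chartIndex p)).restrictScalars ℝ).hasFDerivAt (x := t)).const_add _
  have h3 := pullback_proj_comp h2 (affineLift_ne_zero _ _) u v
  rw [← h1] at h3
  exact h3.trans (congrArg Complex.re (hermForm_affineLift _ _ _ _))

theorem fubiniStudy_eq_coordHerm {n : ℕ} (p : CP n) (u v : Cn n) :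
    (fubiniStudy n p : Cn n →L[ℝ] Cn n →L[ℝ] ℝ) u v =
      (coordHerm (chartAt (Cn n) p p) u v).re :=
  (fubiniStudy_apply p u v).trans (congrArg Complex.re (hermForm_affineLift _ _ _ _))

theorem riemann_fubiniStudy {n : ℕ} (p : CP n) (u v w : Cn n) :
    (riemann (fubiniStudy n) p : Cn n →L[ℝ] Cn n →L[ℝ] Cn n →L[ℝ] Cn n) u v w =
      coordHerm (chartAt (Cn n) p p) v w • u - coordHerm (chartAt (Cn n) p p) u w • v
      - (coordHerm (chartAt (Cn n) p p) u v - coordHerm (chartAt (Cn n) p p) v u) • w :=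
  coordCurvature_of_coordHerm (coordMetric_fubiniStudy p) _ u v w

theorem isSmoothMetric_fubiniStudy (n : ℕ) : IsSmoothMetric (fubiniStudy n) := by
  refine isSmoothMetric_of_coordMetric _ (fun p u v => ?_) (fun p u hu => ?_) fun p => ?_
  · exact (fubiniStudy_eq_coordHerm p u v).trans
      ((coordHerm_re_comm _ _ _).trans (fubiniStudy_eq_coordHerm p v u).symm)
  · exact (coordHerm_self_pos _ hu).trans_eq (fubiniStudy_eq_coordHerm p u u).symm
  · exact (contDiff_of_coordHerm (coordMetric_fubiniStudy p)).contDiffAt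


/-! ### The projection of the sphere -/

theorem slot_injective {n : ℕ} (i : Fin (n + 1)) : Function.Injective (slot (n := n) i) := by
  intro u v h
  ext j
  rw [← slot_succAbove i u j, h, slot_succAbove]

theorem fderiv_affineCoord_smul_self {n : ℕ} {k : Fin (n + 1)} {z : Cn (n + 1)} (hz : z k ≠ 0)
    (c : ℂ) : fderiv ℝ (affineCoord k) z (c • z) = 0 := by
  apply slot_injective k
  rw [slot_fderiv_affineCoord k hz, map_zero, smul_smul, ← add_smul]
  have : (z k)⁻¹ * c + -(c • z) k / z k ^ 2 = 0 := by
    simp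
    field_simp
    ring
  rw [this, zero_smul]

theorem exists_fderiv_affineCoord_eq {n : ℕ} {k : Fin (n + 1)} {z : Cn (n + 1)} (hk : z k ≠ 0)
    (hz : ‖z‖ = 1) (u : Cn n) :
    ∃ v : Cn (n + 1), inner ℂ z v = 0 ∧ fderiv ℝ (affineCoord k) z v = u := by
  -- The vector `z k • slot k u` already maps to `u`; subtracting its component along `z`, which is
  -- vertical, makes it horizontal without changing the image.
  refine ⟨z k • slot k u - inner ℂ z (z k • slot k u) • z, ?_, slot_injective k ?_⟩
  · rw [inner_sub_right, inner_smul_right z z, inner_self_complex, hz, Complex.ofReal_one,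
      one_pow, mul_one, sub_self]
  · rw [map_sub, fderiv_affineCoord_smul_self hk, sub_zero, slot_fderiv_affineCoord k hk]
    simp [smul_smul, hk]

theorem isSubmersionMetric_fubiniStudy (n : ℕ) : IsSubmersionMetric n (fubiniStudy n) where
  smooth _ hz := (contMDiffAt_proj hz).contMDiffWithinAt
  vertical z hz := by
    have hz0 : z ≠ 0 := norm_ne_zero_iff.1 (by simp [hz])
    exact (mfderiv_proj hz0 _).trans (fderiv_affineCoord_smul_self (chartIndex_proj_ne hz0) _)
  surjective z hz u := by
    have hz0 : z ≠ 0 := norm_ne_zero_iff.1 (by simp [hz])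
    obtain ⟨v, hv, hvu⟩ := exists_fderiv_affineCoord_eq (chartIndex_proj_ne hz0) hz u
    exact ⟨v, hv, (mfderiv_proj hz0 v).trans hvu⟩
  isometric z hz v w _ hw := by
    have hz0 : z ≠ 0 := norm_ne_zero_iff.1 (by simp [hz])
    rw [← hermForm_of_norm_one hz hw]
    exact pullback_proj hz0 v w

/-! ### Topology and orientation of projective space -/

/-- The function `[z] ↦ |⟨a, z⟩| / |z|`. -/
noncomputable def cosDist {n : ℕ} (a : Cn (n + 1)) (p : CP n) : ℝ := ‖inner ℂ a p.rep‖ / ‖p.rep‖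

theorem cosDist_mk {n : ℕ} (a z : Cn (n + 1)) (hz : z ≠ 0) :
    cosDist a (Projectivization.mk ℂ z hz) = ‖inner ℂ a z‖ / ‖z‖ := by
  obtain ⟨c, hc⟩ := Projectivization.exists_smul_eq_mk_rep ℂ z hz
  rw [cosDist, ← hc, Units.smul_def, inner_smul_right, norm_smul, norm_mul,
    mul_div_mul_left _ _ (norm_ne_zero_iff.2 c.ne_zero)]

theorem continuous_cosDist {n : ℕ} (a : Cn (n + 1)) : Continuous (cosDist (n := n) a) := by
  rw [(isQuotientMap_mk' n).continuous_iff]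
  have : cosDist a ∘ (Projectivization.mk' ℂ : {v : Cn (n + 1) // v ≠ 0} → CP n) =
      fun v => ‖inner ℂ a v.1‖ / ‖v.1‖ := by
    ext v
    exact cosDist_mk a v.1 v.2
  rw [this]
  exact Continuous.div (by fun_prop) (by fun_prop) fun v => norm_ne_zero_iff.2 v.2

/-- The continuous function `cosDist p.rep` separates `p` from `q`: if it agreed at both points,
equality would hold in Cauchy–Schwarz and the representatives would be proportional. -/
instance instT2SpaceCP (n : ℕ) : T2Space (CP n) where
  t2 p q hpq := by
    refine separated_by_continuous (continuous_cosDist p.rep) fun h => hpq ?_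
    have hp := p.rep_nonzero
    have hq := q.rep_nonzero
    have h1 : ‖inner ℂ p.rep q.rep‖ = ‖p.rep‖ * ‖q.rep‖ := by
      have hp' := norm_ne_zero_iff.2 hp
      have hq' := norm_ne_zero_iff.2 hq
      rw [cosDist, cosDist, inner_self_complex] at h
      simp only [norm_pow, Complex.norm_real, norm_norm] at h
      field_simp at h
      linarith
    obtain ⟨r, -, hr⟩ := (norm_inner_eq_norm_iff hp hq).1 h1
    rw [← p.mk_rep, ← q.mk_rep]
    exact ((Projectivization.mk_eq_mk_iff' ℂ _ _ _ _).2 ⟨r, hr.symm⟩).symm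

instance instSecondCountableTopologyCP (n : ℕ) : SecondCountableTopology (CP n) := by
  have : ∀ i : Fin (n + 1), SecondCountableTopology (affineSet (n := n) i) := fun i =>
    (affineChart i).secondCountableTopology_source
  refine TopologicalSpace.secondCountableTopology_of_countable_cover
    (U := fun i : Fin (n + 1) => affineSet (n := n) i) isOpen_affineSet ?_
  exact Set.eq_univ_of_forall fun p => Set.mem_iUnion.2 (exists_mem_affineSet p)

/-- The real determinant of a complex linear map is the squared modulus of its complex determinant.
-/
theorem det_restrictScalars_pos {n : ℕ} (D : Cn n →L[ℂ] Cn n) (hD : Function.Injective D) :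
    0 < (D.restrictScalars ℝ).det := by
  have h1 : (D.restrictScalars ℝ).det = Algebra.norm ℝ (LinearMap.det (D : Cn n →ₗ[ℂ] Cn n)) :=
    LinearMap.det_restrictScalars
  rw [h1, Algebra.norm_complex_apply, Complex.normSq_pos]
  have h2 := LinearEquiv.isUnit_det' (LinearEquiv.ofInjectiveEndo (D : Cn n →ₗ[ℂ] Cn n) hD)
  exact h2.ne_zero

theorem isOrientable_CP (n : ℕ) : IsOrientable (Cn n) (CP n) := by
  refine ⟨Set.range affineChart,
    IsManifold.subset_maximalAtlas (I := 𝓘(ℝ, Cn n)) (n := ∞) (M := CP n), fun p => ?_, ?_⟩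
  · exact ⟨_, Set.mem_range_self (chartIndex p), chartIndex_mem p⟩
  · rintro _ ⟨i, rfl⟩ _ ⟨k, rfl⟩ y hy
    have hk : affineLift i y k ≠ 0 := mem_affineChart_trans_source i k y hy
    have hs : HasFDerivAt (affineLift i) (slot (n := n) i) y :=
      ((slot i).hasFDerivAt (x := y)).const_add _
    have hd : DifferentiableAt ℂ (fun t : Cn n => affineCoord k (affineLift i t)) y :=
      ((contDiffAt_affineCoord k hk).differentiableAt (by simp)).comp y hs.differentiableAt
    have he : (fun x => affineChart k ((affineChart i).symm x)) =
      fun t : Cn n => affineCoord k (affineLift i t) := rfl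
    rw [he, hd.fderiv_restrictScalars ℝ]
    refine det_restrictScalars_pos _ ?_
    rw [injective_iff_map_eq_zero]
    intro u hu
    -- A kernel vector `slot i u` of the differential of the projection is a multiple of the lift.
    -- The lift has `i`-th coordinate `1` and `slot i u` has `0`, so the multiple is zero.
    have h1 : fderiv ℝ (affineCoord k) (affineLift i y) (slot i u) = 0 := by
      have h2 := (((contDiffAt_affineCoord_real k hk).differentiableAt
        (by simp)).hasFDerivAt).comp y (hs.restrictScalars ℝ)
      have h3 := DFunLike.congr_fun (h2.unique (hd.hasFDerivAt.restrictScalars ℝ)) u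
      exact h3.trans hu
    have h2 := slot_fderiv_affineCoord k hk (slot i u)
    rw [h1, map_zero] at h2
    have h3 := congrArg (fun z : Cn (n + 1) => z i) h2
    simp only [PiLp.zero_apply, PiLp.add_apply, PiLp.smul_apply, slot_same, affineLift_same,
      smul_eq_mul, mul_zero, zero_add, mul_one] at h3
    rw [← h3, zero_smul, add_zero] at h2
    have h4 := (smul_eq_zero.1 h2.symm).resolve_left (inv_ne_zero hk)
    exact slot_injective i (h4.trans (map_zero _).symm)

/-! ### Kähler and Einstein properties -/

theorem chernGamma_smul_right {n : ℕ} (t u v : Cn n) (c : ℂ) :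
    chernGamma t u (c • v) = c • chernGamma t u v := by
  simp only [chernGamma, inner_smul_right]
  module

/-- Since `h` is conjugate linear in its first argument, `Re h(iv, w) = Im h(v, w)`; complex
linearity of `chernGamma` carries this over to the derivative. -/
theorem fderiv_fundamentalForm {n : ℕ} (p : CP n) (t u v w : Cn n) :
    fderiv ℝ (fun y => fundamentalForm (fubiniStudy n) p y v w) t u =
      (coordHerm t (chernGamma t u v) w + coordHerm t v (chernGamma t u w)).im := by
  have h : (fun y => fundamentalForm (fubiniStudy n) p y v w) =
      fun y => (coordHerm y (Complex.I • v) w).re :=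
    funext fun y => coordMetric_fubiniStudy p y _ _
  rw [h]
  have h1 := Complex.reCLM.hasFDerivAt.comp_hasDerivAt (0 : ℝ)
    (hasDerivAt_coordHerm t u (Complex.I • v) w)
  refine fderiv_eq_of_hasDerivAt ?_ (h1.congr_deriv ?_)
  · exact (Complex.reCLM.contDiff.comp (contDiff_coordHerm (Complex.I • v) w)).differentiable
      (by simp) t
  · simp [chernGamma_smul_right, coordHerm_smul_left]

theorem coordHerm_im_comm {n : ℕ} (t u v : Cn n) :
    (coordHerm t u v).im = -(coordHerm t v u).im := by
  rw [← coordHerm_conj, Complex.conj_im]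

theorem coordHerm_I_smul {n : ℕ} (t u v : Cn n) :
    coordHerm t (Complex.I • u) (Complex.I • v) = coordHerm t u v := by
  rw [coordHerm_smul_left, coordHerm_smul_right, ← mul_assoc]
  simp

theorem isKahler_fubiniStudy (n : ℕ) : IsKahler (fubiniStudy n) where
  smooth := isSmoothMetric_fubiniStudy n
  hermitian p u v := by
    refine (fubiniStudy_eq_coordHerm p _ _).trans
      (Eq.trans ?_ (fubiniStudy_eq_coordHerm p u v).symm)
    exact congrArg Complex.re (coordHerm_I_smul _ _ _)
  closed p u v w := by
    rw [fderiv_fundamentalForm, fderiv_fundamentalForm, fderiv_fundamentalForm]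
    set t := chartAt (Cn n) p p
    simp only [Complex.add_im]
    -- The imaginary part is antisymmetric and `chernGamma` is symmetric, so the six terms cancel in
    -- pairs.
    rw [coordHerm_im_comm t v, coordHerm_im_comm t w, coordHerm_im_comm t u, chernGamma_comm t u w,
      chernGamma_comm t v u, chernGamma_comm t w v]
    ring

theorem leviCivita_fubiniStudy {n : ℕ} (p : CP n) (u v : Cn n) :
    leviCivita (fubiniStudy n) p u v = chernGamma (chartAt (Cn n) p p) u v :=
  christoffel_of_coordHerm (coordMetric_fubiniStudy p) _ u v

theorem isChernConnection_fubiniStudy {n : ℕ} (p : CP n) :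
    IsChernConnection (fubiniStudy n) p (leviCivita (fubiniStudy n) p) where
  complex_linear u v := by
    rw [leviCivita_fubiniStudy, leviCivita_fubiniStudy, chernGamma_smul_right]
  type_one_zero u v := by
    rw [leviCivita_fubiniStudy, leviCivita_fubiniStudy, chernGamma_comm, chernGamma_smul_right,
      chernGamma_comm]
  metric u v w := by
    rw [fderiv_of_coordHerm (coordMetric_fubiniStudy p), leviCivita_fubiniStudy,
      leviCivita_fubiniStudy, coordMetric_fubiniStudy, coordMetric_fubiniStudy, Complex.add_re]

/-- Splitting `φ` into real and imaginary parts writes `L` as a sum of two real maps of rank at most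
one, in the directions `w` and `iw`. -/
theorem trace_of_eq_smul {n : ℕ} (φ : Cn n →ₗ[ℝ] ℂ) (w : Cn n) (L : Cn n →ₗ[ℝ] Cn n)
    (hL : ∀ u, L u = φ u • w) :
    LinearMap.trace ℝ (Cn n) L = (φ w).re + (φ (Complex.I • w)).im := by
  have h : L = (Complex.reLm ∘ₗ φ).smulRight w +
      (Complex.imLm ∘ₗ φ).smulRight (Complex.I • w) := by
    ext1 u
    rw [hL]
    have : φ u = ((φ u).re : ℂ) + ((φ u).im : ℂ) * Complex.I := (Complex.re_add_im _).symm
    rw [this, add_smul, mul_smul]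
    simp
  rw [h, map_add, LinearMap.trace_smulRight, LinearMap.trace_smulRight]
  rfl

theorem trace_of_eq_linear_smul {n : ℕ} (φ : Cn n →ₗ[ℂ] ℂ) (w : Cn n) (L : Cn n →ₗ[ℝ] Cn n)
    (hL : ∀ u, L u = φ u • w) : LinearMap.trace ℝ (Cn n) L = 2 * (φ w).re := by
  rw [trace_of_eq_smul (φ.restrictScalars ℝ) w L hL]
  simp
  ring

/-- A conjugate linear map anticommutes with `i`, so the contributions of `w` and `iw` to the trace
are opposite. -/
theorem trace_of_eq_conjLinear_smul {n : ℕ} (φ : Cn n →ₗ[ℂ] ℂ) (w : Cn n) (L : Cn n →ₗ[ℝ] Cn n)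
    (hL : ∀ u, L u = (starRingEnd ℂ) (φ u) • w) : LinearMap.trace ℝ (Cn n) L = 0 := by
  rw [trace_of_eq_smul (Complex.conjAe.toLinearMap ∘ₗ φ.restrictScalars ℝ) w L hL]
  simp

theorem trace_of_eq_const_smul {n : ℕ} (c : ℂ) (L : Cn n →ₗ[ℝ] Cn n)
    (hL : ∀ u, L u = c • u) : LinearMap.trace ℝ (Cn n) L = 2 * n * c.re := by
  let A : Fin n → (Cn n →ₗ[ℝ] Cn n) := fun k =>
    ((EuclideanSpace.proj (𝕜 := ℂ) k : Cn n →L[ℂ] ℂ).toLinearMap.smulRight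
      (c • EuclideanSpace.single k 1)).restrictScalars ℝ
  have hA : L = ∑ k, A k := by
    ext1 u
    rw [hL, LinearMap.sum_apply]
    ext j
    simp [A, Pi.single_apply, mul_comm]
  have ht : ∀ k, LinearMap.trace ℝ (Cn n) (A k) = 2 * c.re := fun k => by
    rw [trace_of_eq_linear_smul (EuclideanSpace.proj (𝕜 := ℂ) k : Cn n →L[ℂ] ℂ).toLinearMap
      (c • EuclideanSpace.single k 1) (A k) fun u => rfl]
    simp
  rw [hA, map_sum, Finset.sum_congr rfl fun k _ => ht k]
  simp
  ring

/-- `coordHerm t v` as a complex linear form. -/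
noncomputable def coordHermLin {n : ℕ} (t v : Cn n) : Cn n →ₗ[ℂ] ℂ where
  toFun := coordHerm t v
  map_add' := coordHerm_add_right t v
  map_smul' c w := coordHerm_smul_right t v w c

/-- The map is sorted by its type in `u`: the scalar map contributes `2n`, the complex linear
rank-one map `u ↦ h(v,u)w` contributes `2`, both times `Re h(v,w)`, and the two conjugate linear
maps contribute nothing. -/
theorem trace_curvature {n : ℕ} (t v w : Cn n) (L : Cn n →ₗ[ℝ] Cn n)
    (hL : ∀ u, L u = coordHerm t v w • u - coordHerm t u w • v
      - (coordHerm t u v - coordHerm t v u) • w) :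
    LinearMap.trace ℝ (Cn n) L = 2 * (n + 1) * (coordHerm t v w).re := by
  let A : Cn n →ₗ[ℝ] Cn n := (LinearMap.lsmul ℂ (Cn n) (coordHerm t v w)).restrictScalars ℝ
  let C : Cn n → Cn n → (Cn n →ₗ[ℝ] Cn n) := fun x y =>
    (LinearMap.toSpanSingleton ℂ (Cn n) y).restrictScalars ℝ ∘ₗ
      (Complex.conjAe.toLinearMap ∘ₗ (coordHermLin t x).restrictScalars ℝ)
  let B : Cn n →ₗ[ℝ] Cn n := ((coordHermLin t v).smulRight w).restrictScalars ℝ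
  have hC : ∀ x y u, C x y u = (starRingEnd ℂ) (coordHermLin t x u) • y := fun x y u => rfl
  have hAu : ∀ u, A u = coordHerm t v w • u := fun u => rfl
  have hBu : ∀ u, B u = coordHermLin t v u • w := fun u => rfl
  have h : L = A - C w v - C v w + B := by
    ext1 u
    rw [hL]
    simp only [LinearMap.add_apply, LinearMap.sub_apply, hAu, hBu, hC]
    change _ = _ - (starRingEnd ℂ) (coordHerm t w u) • v
      - (starRingEnd ℂ) (coordHerm t v u) • w + coordHerm t v u • w
    rw [coordHerm_conj, coordHerm_conj]
    module
  rw [h, map_add, map_sub, map_sub, trace_of_eq_const_smul _ A hAu,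
    trace_of_eq_conjLinear_smul _ _ _ (hC w v), trace_of_eq_conjLinear_smul _ _ _ (hC v w),
    trace_of_eq_linear_smul _ _ _ hBu]
  change 2 * n * (coordHerm t v w).re - 0 - 0 + 2 * (coordHerm t v w).re = _
  ring

theorem isEinstein_fubiniStudy (n : ℕ) : IsEinstein (fubiniStudy n) (2 * (n + 1)) := by
  intro p v w
  refine (trace_curvature (chartAt (Cn n) p p) v w _
    (fun u => riemann_fubiniStudy p u v w)).trans ?_
  exact congrArg (fun x : ℝ => 2 * ((n : ℝ) + 1) * x) (fubiniStudy_eq_coordHerm p v w).symm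


/-! ### Sectional curvature -/

section Sectional

variable {n : ℕ}

theorem sectional_fubiniStudy (p : CP n) (u v : Cn n) :
    sectional (fubiniStudy n) p u v =
      (coordHerm (chartAt (Cn n) p p) (coordHerm (chartAt (Cn n) p p) v v • u
        - coordHerm (chartAt (Cn n) p p) u v • v
        - (coordHerm (chartAt (Cn n) p p) u v - coordHerm (chartAt (Cn n) p p) v u) • v) u).re /
      ((coordHerm (chartAt (Cn n) p p) u u).re * (coordHerm (chartAt (Cn n) p p) v v).re
        - (coordHerm (chartAt (Cn n) p p) u v).re ^ 2) := by
  have h1 := (fubiniStudy_eq_coordHerm p _ u).trans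
    (congrArg (fun x => (coordHerm (chartAt (Cn n) p p) x u).re) (riemann_fubiniStudy p u v v))
  exact congrArg₂ (· / ·) h1 (congrArg₂ (· - ·) (congrArg₂ (· * ·) (fubiniStudy_eq_coordHerm p u u)
    (fubiniStudy_eq_coordHerm p v v)) (congrArg (· ^ 2) (fubiniStudy_eq_coordHerm p u v)))

/-- For `v = cos s w + sin s iu` the value `h(u,v) = i sin s` is purely imaginary, so `u, v` are
orthonormal over `ℝ` and the denominator is `1`. In the numerator the `v`-terms add up to `-3i sin s
v`, whose product with `u` is `3 sin² s`. -/
theorem sectional_holomorphic_angle (p : CP n) (u w : Cn n)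
    (hu : coordHerm (chartAt (Cn n) p p) u u = 1) (hw : coordHerm (chartAt (Cn n) p p) w w = 1)
    (huw : coordHerm (chartAt (Cn n) p p) u w = 0) (s : ℝ) :
    sectional (fubiniStudy n) p u (Real.cos s • w + Real.sin s • Complex.I • u : Cn n) =
      1 + 3 * Real.sin s ^ 2 := by
  rw [sectional_fubiniStudy]
  have hwu : coordHerm (chartAt (Cn n) p p) w u = 0 := by rw [← coordHerm_conj, huw, map_zero]
  set t := chartAt (Cn n) p p
  have hv : (Real.cos s • w + Real.sin s • Complex.I • u : Cn n) =
      (Real.cos s : ℂ) • w + (Real.sin s * Complex.I : ℂ) • u := by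
    rw [mul_smul]; rfl
  rw [hv]
  set c := Real.cos s
  set d := Real.sin s
  have hcd : c ^ 2 = 1 - d ^ 2 := Real.cos_sq' s
  have e1 : coordHerm t u ((c : ℂ) • w + (d * Complex.I : ℂ) • u) = d * Complex.I := by
    rw [coordHerm_add_right, coordHerm_smul_right, coordHerm_smul_right, hu, huw]
    ring
  have e2 : coordHerm t ((c : ℂ) • w + (d * Complex.I : ℂ) • u) u = -(d * Complex.I) := by
    rw [coordHerm_add_left, coordHerm_smul_left, coordHerm_smul_left, hu, hwu]
    simp
  have e3 : coordHerm t ((c : ℂ) • w + (d * Complex.I : ℂ) • u)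
      ((c : ℂ) • w + (d * Complex.I : ℂ) • u) = 1 := by
    rw [coordHerm_add_right, coordHerm_smul_right, coordHerm_smul_right, e2, coordHerm_add_left,
      coordHerm_smul_left, coordHerm_smul_left, hw, huw, Complex.conj_ofReal]
    have : (c : ℂ) ^ 2 = 1 - (d : ℂ) ^ 2 := by exact_mod_cast hcd
    linear_combination this - (d : ℂ) ^ 2 * Complex.I_sq
  rw [e1, e2, e3, hu]
  have e4 : coordHerm t ((1 : ℂ) • u
      - (d * Complex.I : ℂ) • ((c : ℂ) • w + (d * Complex.I : ℂ) • u)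
      - (d * Complex.I - -(d * Complex.I) : ℂ) • ((c : ℂ) • w + (d * Complex.I : ℂ) • u)) u =
      ((1 + 3 * d ^ 2 : ℝ) : ℂ) := by
    have : ((1 : ℂ) • u
      - (d * Complex.I : ℂ) • ((c : ℂ) • w + (d * Complex.I : ℂ) • u)
      - (d * Complex.I - -(d * Complex.I) : ℂ) • ((c : ℂ) • w + (d * Complex.I : ℂ) • u)) =
      (1 : ℂ) • u + (-3 * d * Complex.I : ℂ) • ((c : ℂ) • w + (d * Complex.I : ℂ) • u) := by
      module
    rw [this, coordHerm_add_left, coordHerm_smul_left, coordHerm_smul_left, e2, hu]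
    simp only [map_one, map_mul, map_neg, Complex.conj_I, Complex.conj_ofReal, map_ofNat]
    push_cast
    linear_combination -3 * (d : ℂ) ^ 2 * Complex.I_sq
  rw [e4, Complex.ofReal_re]
  simp

theorem exists_coordHerm_normalize (t : Cn n) {v : Cn n} (hv : v ≠ 0) :
    ∃ r : ℂ, coordHerm t (r • v) (r • v) = 1 := by
  have h := coordHerm_self_pos t hv
  refine ⟨((√(coordHerm t v v).re)⁻¹ : ℝ), ?_⟩
  rw [coordHerm_smul_left, coordHerm_smul_right, Complex.conj_ofReal, coordHerm_self]
  norm_cast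
  have := Real.sq_sqrt h.le
  have h2 := Real.sqrt_pos.2 h
  field_simp
  linarith

/-- Gram–Schmidt for the form at `t`, applied to two coordinate vectors; this is where dimension at
least two enters. -/
theorem exists_coordHerm_orthonormal (hn : 2 ≤ n) (t : Cn n) :
    ∃ u w : Cn n, coordHerm t u u = 1 ∧ coordHerm t w w = 1 ∧ coordHerm t u w = 0 := by
  let i : Fin n := ⟨0, by omega⟩
  let j : Fin n := ⟨1, by omega⟩
  have hij : j ≠ i := by simp [i, j]
  have he : (EuclideanSpace.single i (1 : ℂ) : Cn n) ≠ 0 := by simp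
  obtain ⟨r, hr⟩ := exists_coordHerm_normalize t he
  set u : Cn n := r • EuclideanSpace.single i (1 : ℂ) with hu
  set x : Cn n := EuclideanSpace.single j (1 : ℂ)
  -- The `j`-th coordinate of this vector is `1`, since `u` is a multiple of the `i`-th basis
  -- vector.
  have hw0 : x + (-coordHerm t u x) • u ≠ 0 := by
    intro h
    have h1 := congrArg (fun z : Cn n => z j) h
    simp [x, hu, hij] at h1
  obtain ⟨r', hr'⟩ := exists_coordHerm_normalize t hw0
  refine ⟨u, _, hr, hr', ?_⟩
  rw [coordHerm_smul_right, coordHerm_add_right, coordHerm_smul_right, hr]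
  ring

theorem linearIndependent_of_coordHerm (t : Cn n) {u w : Cn n} (hu : (coordHerm t u u).re = 1)
    (hw : (coordHerm t w w).re = 1) (huw : (coordHerm t u w).re = 0) :
    LinearIndependent ℝ ![u, w] := by
  rw [LinearIndependent.pair_iff]
  intro a b hab
  have hab' : (a : ℂ) • u + (b : ℂ) • w = 0 := hab
  have h0 : ∀ x, coordHerm t x (0 : Cn n) = 0 := fun x => by simp [coordHerm]
  have h1 := congrArg (fun x => (coordHerm t u x).re) hab'
  have h2 := congrArg (fun x => (coordHerm t w x).re) hab'
  have hwu : (coordHerm t w u).re = 0 := by rw [coordHerm_re_comm, huw]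
  simp only [coordHerm_add_right, coordHerm_smul_right, Complex.add_re, Complex.re_ofReal_mul,
    h0, hu, hw, huw, hwu] at h1 h2
  simp at h1 h2
  exact ⟨h1, h2⟩

instance instNonemptyCP : Nonempty (CP n) := ⟨proj n 0⟩

theorem not_hasConstantSectionalCurvature (hn : 2 ≤ n) :
    ¬ ∃ c : ℝ, HasConstantSectionalCurvature (fubiniStudy n) c := by
  rintro ⟨c, hc⟩
  obtain ⟨p⟩ := instNonemptyCP (n := n)
  obtain ⟨u, w, hu, hw, huw⟩ := exists_coordHerm_orthonormal hn (chartAt (Cn n) p p)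
  -- The totally real plane `s = 0` has curvature `1`, the complex line `s = π/2` has curvature `4`.
  have h1 := sectional_holomorphic_angle p u w hu hw huw 0
  have h2 := sectional_holomorphic_angle p u w hu hw huw (Real.pi / 2)
  simp only [Real.cos_zero, Real.sin_zero, one_smul, zero_smul, add_zero, Real.cos_pi_div_two,
    Real.sin_pi_div_two, zero_add] at h1 h2
  have h3 := hc p u w
    (linearIndependent_of_coordHerm (chartAt (Cn n) p p) (by simp [hu]) (by simp [hw])
      (by simp [huw]))
  have h4 := hc p u (Complex.I • u : Cn n)
    (linearIndependent_of_coordHerm (chartAt (Cn n) p p) (by simp [hu])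
      (by simp [coordHerm_I_smul, hu]) (by simp [coordHerm_smul_right, hu]))
  have h5 := h1.symm.trans h3
  have h6 := h2.symm.trans h4
  norm_num at h5 h6
  linarith

/-- Translates real orthogonality of `w` to `u` and `Ju` into Hermitian orthogonality. -/
theorem coordHerm_eq_zero {t u w : Cn n} (h1 : (coordHerm t u w).re = 0)
    (h2 : (coordHerm t (Complex.I • u) w).re = 0) : coordHerm t u w = 0 := by
  rw [coordHerm_smul_left] at h2
  apply Complex.ext
  · exact h1
  · simpa using h2

theorem coordHerm_eq_one {t u : Cn n} (h : (coordHerm t u u).re = 1) : coordHerm t u u = 1 := by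
  rw [coordHerm_self, h, Complex.ofReal_one]

theorem sectional_angle (p : CP n) (u w : TangentSpace 𝓘(ℝ, Cn n) p)
    (hu : fubiniStudy n p u u = 1) (hw : fubiniStudy n p w w = 1) (huw : fubiniStudy n p u w = 0)
    (hJ : fubiniStudy n p (complexStructure p u) w = 0) (s : ℝ) :
    sectional (fubiniStudy n) p u (Real.cos s • w + Real.sin s • complexStructure p u) =
      1 + 3 * Real.sin s ^ 2 :=
  sectional_holomorphic_angle p u w
    (coordHerm_eq_one ((fubiniStudy_eq_coordHerm p u u).symm.trans hu))
    (coordHerm_eq_one ((fubiniStudy_eq_coordHerm p w w).symm.trans hw))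
    (coordHerm_eq_zero ((fubiniStudy_eq_coordHerm p u w).symm.trans huw)
      ((fubiniStudy_eq_coordHerm p _ w).symm.trans hJ)) s

end Sectional


/-! ### Conformal changes -/

section Conformal

variable {E : Type*} [NormedAddCommGroup E] [NormedSpace ℝ E]

/-- The Levi-Civita connection is the symmetric connection compatible with the metric. -/
theorem christoffel_eq_of_compatible {G : E → E →L[ℝ] E →L[ℝ] ℝ} {y : E}
    (hG : (G y).IsInvertible) (hs : ∀ u v, G y u v = G y v u) {Γ : E → E → E}
    (hΓ : ∀ u v, Γ u v = Γ v u)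
    (hc : ∀ u v w, fderiv ℝ G y u v w = G y (Γ u v) w + G y v (Γ u w)) (u v : E) :
    christoffel G y u v = Γ u v := by
  refine christoffel_eq_of_koszul hG fun w => ?_
  rw [koszul_apply, hc, hc, hc, hΓ v u, hΓ w u, hΓ w v, hs v (Γ u w), hs u (Γ v w)]
  ring

theorem contDiffAt_koszul {G : E → E →L[ℝ] E →L[ℝ] ℝ} {t : E} (hG : ContDiffAt ℝ ∞ G t) :
    ContDiffAt ℝ ∞ (koszul G) t := by
  have hD : ContDiffAt ℝ ∞ (fderiv ℝ G) t := hG.fderiv_right (m := ∞) (by simp)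
  have hf : ContDiffAt ℝ ∞ (fun y => (fderiv ℝ G y).flip) t :=
    (ContinuousLinearMap.flipₗᵢ ℝ E E (E →L[ℝ] ℝ)).contDiff.contDiffAt.comp t hD
  unfold koszul
  exact ((hD.add hf).sub (contDiffAt_const.clm_comp hf)).const_smul (1 / 2 : ℝ)

theorem contDiffAt_christoffel [CompleteSpace E] {G : E → E →L[ℝ] E →L[ℝ] ℝ} {t : E}
    (hG : ContDiffAt ℝ ∞ G t) (hi : (G t).IsInvertible) : ContDiffAt ℝ ∞ (christoffel G) t := by
  have hinv : ContDiffAt ℝ ∞ (fun y => (G y).inverse) t := by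
    obtain ⟨e, he⟩ := hi
    have h := contDiffAt_map_inverse (𝕜 := ℝ) (n := ∞) e
    rw [he] at h
    exact h.comp t hG
  unfold christoffel
  exact ((ContinuousLinearMap.compL ℝ E (E →L[ℝ] ℝ) E).contDiff.contDiffAt.comp t hinv).clm_comp
    (contDiffAt_koszul hG)

end Conformal

section ConformalFubiniStudy

variable {n : ℕ} {G : Cn n → Cn n →L[ℝ] Cn n →L[ℝ] ℝ}

/-- The classical formula `Γ + dφ(u)v + dφ(v)u - g(u,v) grad φ`, with `(G y).inverse` applied to
`dφ` as the gradient. It is checked by symmetry and compatibility with `e^{2φ}G`, which characterize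
the connection. -/
theorem christoffel_conformal (hG : ∀ t u v, G t u v = (coordHerm t u v).re) {φ : Cn n → ℝ}
    {y : Cn n} (hφ : DifferentiableAt ℝ φ y) (u v : Cn n) :
    christoffel (fun y => Real.exp (2 * φ y) • G y) y u v =
      chernGamma y u v + fderiv ℝ φ y u • v + fderiv ℝ φ y v • u
        - G y u v • (G y).inverse (fderiv ℝ φ y) := by
  have hpos : ∀ v, v ≠ 0 → 0 < (Real.exp (2 * φ y) • G y) v v := fun v hv => by
    have := coordHerm_self_pos y hv
    rw [← hG] at this
    exact mul_pos (Real.exp_pos _) this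
  have hs : ∀ u v, G y u v = G y v u := fun u v => by rw [hG, hG, coordHerm_re_comm]
  have hN : ∀ w, G y ((G y).inverse (fderiv ℝ φ y)) w = fderiv ℝ φ y w := fun w => by
    have h := isInvertible_of_coordHerm hG y
    rw [← (h.inverse_apply_eq (x := (G y).inverse (fderiv ℝ φ y))).1 rfl]
  have hd : DifferentiableAt ℝ G y := (contDiff_of_coordHerm hG).differentiable (by simp) y
  refine christoffel_eq_of_compatible (Γ := fun u v => chernGamma y u v + fderiv ℝ φ y u • v +
    fderiv ℝ φ y v • u - G y u v • (G y).inverse (fderiv ℝ φ y)) (isInvertible_of_pos hpos)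
    (fun u v => congrArg (Real.exp (2 * φ y) * ·) (hs u v)) (fun u v => ?_) (fun u v w => ?_) u v
  · rw [chernGamma_comm, hs u v]; abel
  · have h1 : HasFDerivAt (fun y => Real.exp (2 * φ y) • G y) _ y :=
      ((hφ.hasFDerivAt.const_mul 2).exp).smul hd.hasFDerivAt
    rw [h1.fderiv]
    have hDG := fderiv_of_coordHerm hG y u v w
    rw [Complex.add_re, ← hG, ← hG] at hDG
    have e1 : ∀ a b c d : Cn n, ∀ r : ℝ, G y (a + b + c - r • d) w =
        G y a w + G y b w + G y c w - r * G y d w := fun a b c d r => by simp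
    have e2 : ∀ a b c d : Cn n, ∀ r : ℝ, G y v (a + b + c - r • d) =
        G y v a + G y v b + G y v c - r * G y v d := fun a b c d r => by simp
    change Real.exp (2 * φ y) * fderiv ℝ G y u v w +
      (Real.exp (2 * φ y) * (2 * fderiv ℝ φ y u)) * G y v w =
      Real.exp (2 * φ y) * G y _ w + Real.exp (2 * φ y) * G y v _
    rw [hDG, e1, e2, hN, hs v ((G y).inverse _), hN]
    simp only [map_smul, smul_apply, smul_eq_mul]
    rw [hs v u]
    ring

/-- A conformal change does not affect the curvature on orthogonal vectors. -/
theorem coordCurvature_conformal (hG : ∀ t u v, G t u v = (coordHerm t u v).re) {φ : Cn n → ℝ}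
    {t : Cn n} (hφ : ContDiffAt ℝ ∞ φ t) {u v w z : Cn n} (huw : G t u w = 0) (hvw : G t v w = 0)
    (huz : G t u z = 0) (hvz : G t v z = 0) (hwz : G t w z = 0) :
    G t (coordCurvature (fun y => Real.exp (2 * φ y) • G y) t u v w) z =
      G t (coordCurvature G t u v w) z := by
  set G' : Cn n → Cn n →L[ℝ] Cn n →L[ℝ] ℝ := fun y => Real.exp (2 * φ y) • G y with hG'
  have hGs : ContDiff ℝ ∞ G := contDiff_of_coordHerm hG
  have hG's : ContDiffAt ℝ ∞ G' t := (contDiffAt_const.mul hφ).exp.smul hGs.contDiffAt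
  have hpos : ∀ v, v ≠ 0 → 0 < G' t v v := fun v hv => by
    have := coordHerm_self_pos t hv
    rw [← hG] at this
    exact mul_pos (Real.exp_pos _) this
  have hc' : DifferentiableAt ℝ (christoffel G') t :=
    (contDiffAt_christoffel hG's (isInvertible_of_pos hpos)).differentiableAt (by simp)
  have hc : DifferentiableAt ℝ (christoffel G) t :=
    (contDiffAt_christoffel hGs.contDiffAt (isInvertible_of_coordHerm hG t)).differentiableAt
      (by simp)
  -- The formula for the conformal Christoffel symbols is going to be differentiated at `t`, so it
  -- has to hold in a neighbourhood.
  have hev : ∀ᶠ y in 𝓝 t, DifferentiableAt ℝ φ y :=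
    ((hφ.of_le (m := 1) ENat.LEInfty.out).eventually (mod_cast ENat.one_ne_top)).mono
      fun y hy => hy.differentiableAt (by simp)
  set α := fderiv ℝ φ with hα
  set N : Cn n → Cn n := fun y => (G y).inverse (α y) with hNdef
  have hαd : DifferentiableAt ℝ α t :=
    (hφ.fderiv_right (m := ∞) (by simp)).differentiableAt (by simp)
  have hNd : DifferentiableAt ℝ N t := by
    have hinv : DifferentiableAt ℝ (fun y => (G y).inverse) t := by
      obtain ⟨e, he⟩ := isInvertible_of_coordHerm hG t
      have h := contDiffAt_map_inverse (𝕜 := ℝ) (n := ∞) e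
      rw [he] at h
      exact (h.comp t hGs.contDiffAt).differentiableAt (by simp)
    exact hinv.clm_apply hαd
  have hGd : DifferentiableAt ℝ G t := hGs.differentiable (by simp) t
  have key : ∀ u v w, fderiv ℝ (christoffel G') t u v w = fderiv ℝ (christoffel G) t u v w +
      fderiv ℝ α t u v • w + fderiv ℝ α t u w • v - (fderiv ℝ G t u v w • N t
        + G t v w • fderiv ℝ N t u) := by
    intro u v w
    rw [fderiv_clm_apply_eq hc', fderiv_clm_apply_eq (hc'.clm_apply (differentiableAt_const v)),
      fderiv_clm_apply_eq hc, fderiv_clm_apply_eq (hc.clm_apply (differentiableAt_const v)),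
      fderiv_clm_apply_eq hαd, fderiv_clm_apply_eq hαd, fderiv_clm_apply_eq hGd,
      fderiv_clm_apply_eq (hGd.clm_apply (differentiableAt_const v))]
    have he : (fun y => christoffel G' y v w) =ᶠ[𝓝 t] fun y => christoffel G y v w + α y v • w +
        α y w • v - G y v w • N y := by
      filter_upwards [hev] with y hy
      rw [christoffel_of_coordHerm hG]
      exact christoffel_conformal hG hy v w
    rw [he.fderiv_eq]
    have d1 : DifferentiableAt ℝ (fun y => christoffel G y v w) t := by fun_prop
    have d2 : ∀ v, DifferentiableAt ℝ (fun y => α y v) t := by fun_prop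
    have d3 : DifferentiableAt ℝ (fun y => G y v w) t := by fun_prop
    have h := ((d1.hasFDerivAt.add ((d2 v).hasFDerivAt.smul_const w)).add
      ((d2 w).hasFDerivAt.smul_const v)).sub (d3.hasFDerivAt.smul hNd.hasFDerivAt)
    refine (DFunLike.congr_fun h.fderiv u).trans ?_
    simp
    abel
  have hs : ∀ u v, G t u v = G t v u := fun u v => by rw [hG, hG, coordHerm_re_comm]
  have hΓ : ∀ u v, christoffel G' t u v = chernGamma t u v + α t u • v + α t v • u
        - G t u v • N t := fun u v => christoffel_conformal hG hev.self_of_nhds u v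
  have hΓ0 : ∀ u v, christoffel G t u v = chernGamma t u v := christoffel_of_coordHerm hG t
  have hDG : ∀ u v w, fderiv ℝ G t u v w = G t (chernGamma t u v) w + G t v (chernGamma t u w) :=
    fun u v w => by rw [fderiv_of_coordHerm hG, hG, hG, Complex.add_re]
  have hcomp : ∀ u v w, G t v w = 0 → G t u w = 0 →
      christoffel G' t u (christoffel G' t v w) = christoffel G t u (christoffel G t v w)
        + (α t v • chernGamma t u w + α t u • chernGamma t v w) + α t w • chernGamma t u v
        + α t u • (α t v • w + α t w • v) + α t (chernGamma t v w + α t v • w + α t w • v) • u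
        - (G t u (chernGamma t v w) + α t w * G t u v) • N t := by
    intro u v w hvw huw
    rw [hΓ v w, hvw, zero_smul, sub_zero, map_add, map_add, map_smul, map_smul, hΓ, hΓ, hΓ, hΓ0,
      hΓ0, huw]
    simp only [map_add, map_smul, smul_eq_mul]
    module
  -- The terms in the gradient `N t` cancel after antisymmetrization, by compatibility of
  -- `chernGamma`, and its derivative carries the vanishing factors `G t v w` and `G t u w`. What
  -- remains lies in the span of `u, v, w`, hence is invisible to `z`.
  have hR : coordCurvature G' t u v w = coordCurvature G t u v w
      + (fderiv ℝ α t u v - fderiv ℝ α t v u) • w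
      + (fderiv ℝ α t u w + α t u * α t w - α t (chernGamma t u w + α t u • w + α t w • u)) • v
      + (-fderiv ℝ α t v w - α t v * α t w + α t (chernGamma t v w + α t v • w + α t w • v)) • u
      := by
    rw [coordCurvature_apply, coordCurvature_apply, key, key, hcomp u v w hvw huw,
      hcomp v u w huw hvw, hvw, huw, hDG, hDG, chernGamma_comm t v u, hs v u,
      hs v (chernGamma t u w), hs u (chernGamma t v w)]
    module
  rw [hR]
  simp [huz, hvz, hwz]

theorem not_isLocallyConformallyFlat (hn : 2 ≤ n) :
    ¬ IsLocallyConformallyFlat (fubiniStudy n) := by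
  intro h
  obtain ⟨p⟩ := instNonemptyCP (n := n)
  obtain ⟨U, hU, hp, f, hf, hR⟩ := h p
  set t := chartAt (Cn n) p p with ht
  set φ : Cn n → ℝ := fun y => f ((chartAt (Cn n) p).symm y) with hφ
  have hφs : ContDiffAt ℝ ∞ φ t := by
    have h1 : ContMDiffAt 𝓘(ℝ, Cn n) 𝓘(ℝ, ℝ) ∞ f ((chartAt (Cn n) p).symm t) := by
      rw [ht, (chartAt (Cn n) p).left_inv (mem_chart_source _ p)]
      exact hf.contMDiffAt (hU.mem_nhds hp)
    have h2 : ContMDiffAt 𝓘(ℝ, Cn n) 𝓘(ℝ, Cn n) ∞ (chartAt (Cn n) p).symm t :=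
      contMDiffAt_symm_of_mem_maximalAtlas (IsManifold.chart_mem_maximalAtlas p)
        (mem_chart_target _ p)
    exact (h1.comp t h2).contDiffAt
  have hG := coordMetric_fubiniStudy p
  obtain ⟨u, w, hu, hw, huw⟩ := exists_coordHerm_orthonormal hn t
  have hwu : coordHerm t w u = 0 := by rw [← coordHerm_conj, huw, map_zero]
  have h1 := coordCurvature_conformal hG hφs (u := u) (v := Complex.I • u) (w := w)
    (z := Complex.I • w) (by simp [hG, huw]) (by simp [hG, coordHerm_smul_left, huw])
    (by simp [hG, coordHerm_smul_right, huw])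
    (by simp [hG, coordHerm_I_smul, huw]) (by simp [hG, coordHerm_smul_right, hw])
  -- The coordinate expression of `e^{2f} g` is by definition `e^{2φ}` times that of `g`, so
  -- flatness at `p` is literally this equation.
  have h2 : coordCurvature (fun y => Real.exp (2 * φ y) • coordMetric (fubiniStudy n) p y) t = 0 :=
    hR p hp
  rw [h2, hG, hG, coordCurvature_of_coordHerm hG] at h1
  have e0 : coordHerm t ((0 : Cn n →L[ℝ] Cn n →L[ℝ] Cn n →L[ℝ] Cn n) u (Complex.I • u) w)
      (Complex.I • w) = 0 := by simp [coordHerm]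
  -- For Hermitian orthonormal `u, w` the curvature formula gives `R(u, iu)w = -2i w`.
  have e1 : coordHerm t (coordHerm t (Complex.I • u) w • u - coordHerm t u w • Complex.I • u
      - (coordHerm t u (Complex.I • u) - coordHerm t (Complex.I • u) u) • w) (Complex.I • w) =
      -2 := by
    have : coordHerm t (Complex.I • u) w • u - coordHerm t u w • Complex.I • u
      - (coordHerm t u (Complex.I • u) - coordHerm t (Complex.I • u) u) • w =
      (-2 * Complex.I) • w := by
      rw [coordHerm_smul_left, coordHerm_smul_left, coordHerm_smul_right, huw, hu, Complex.conj_I]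
      module
    rw [this, coordHerm_smul_left, coordHerm_smul_right, hw]
    simp only [map_mul, map_neg, Complex.conj_I, map_ofNat]
    linear_combination 2 * Complex.I_sq
  rw [e0, e1] at h1
  norm_num at h1

end ConformalFubiniStudy


/-! ### The projective line: curvature -/

theorem exists_smul_eq_of_ne_zero {u : Cn 1} (hu : u ≠ 0) (v : Cn 1) : ∃ c : ℂ, v = c • u := by
  have h0 : u 0 ≠ 0 := fun h => hu (by ext j; fin_cases j; simpa using h)
  exact ⟨v 0 / u 0, by ext j; fin_cases j; simp [h0]⟩

/-- Every second vector is `v = c u` with `c` not real, and with `N = h(u,u)` numerator and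
denominator are `4 (N Im c)²` and `(N Im c)²`. -/
theorem hasConstantSectionalCurvature_CP_one :
    HasConstantSectionalCurvature (fubiniStudy 1) 4 := by
  intro p u v huv
  refine (sectional_fubiniStudy p u v).trans ?_
  set t := chartAt (Cn 1) p p
  obtain ⟨u, rfl⟩ : ∃ u' : Cn 1, u' = u := ⟨u, rfl⟩
  obtain ⟨v, rfl⟩ : ∃ v' : Cn 1, v' = v := ⟨v, rfl⟩
  replace huv : LinearIndependent ℝ ![u, v] := huv
  have hu : u ≠ 0 := huv.ne_zero 0
  obtain ⟨c, rfl⟩ := exists_smul_eq_of_ne_zero hu v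
  have hc : c.im ≠ 0 := by
    intro hc
    rw [LinearIndependent.pair_iff] at huv
    have h1 := huv (-c.re) 1 (by
      have : c = (c.re : ℂ) := Complex.ext rfl (by simpa using hc)
      have h2 : c • u = c.re • u := by
        conv_lhs => rw [this]
        rfl
      rw [h2]
      module)
    exact one_ne_zero h1.2
  have hN := coordHerm_self_pos t hu
  set N := (coordHerm t u u).re with hNdef
  have hH : coordHerm t u u = (N : ℂ) := coordHerm_self t u
  have e1 : coordHerm t u (c • u) = c * N := by rw [coordHerm_smul_right, hH]
  have e2 : coordHerm t (c • u) u = (starRingEnd ℂ) c * N := by rw [coordHerm_smul_left, hH]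
  have e3 : coordHerm t (c • u) (c • u) = (starRingEnd ℂ) c * c * N := by
    rw [coordHerm_smul_left, e1]; ring
  have e4 : coordHerm t (c • u) (c • u) • u - coordHerm t u (c • u) • c • u -
      (coordHerm t u (c • u) - coordHerm t (c • u) u) • c • u =
      ((starRingEnd ℂ) c * c * N - (2 * c - (starRingEnd ℂ) c) * c * N) • u := by
    rw [e1, e2, e3]; module
  rw [e4, coordHerm_smul_left, e1, e3, hH, div_eq_iff]
  · simp
    ring
  · have : N * ((starRingEnd ℂ) c * c * (N : ℂ)).re - (c * (N : ℂ)).re ^ 2 = (N * c.im) ^ 2 := by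
      simp
      ring
    rw [this]
    positivity

/-- On a complex line every complex bilinear map is symmetric; this makes the Christoffel symbols of
`coordCurvature_eq_zero_of_affine` torsion free. -/
theorem clm_smul_comm (b : Cn 1 →L[ℂ] ℂ) (u v : Cn 1) : b u • v = b v • u := by
  by_cases hu : u = 0
  · simp [hu]
  · obtain ⟨c, rfl⟩ := exists_smul_eq_of_ne_zero hu v
    rw [map_smul]
    module

theorem hasDerivAt_affine_line {n : ℕ} (a : ℂ) (b : Cn n →L[ℂ] ℂ) (y u : Cn n) :
    HasDerivAt (fun s : ℝ => a + b (y + s • u)) (b u) 0 := by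
  have h : HasFDerivAt (fun y => b y) (b.restrictScalars ℝ) (y + (0 : ℝ) • u) :=
    (b.restrictScalars ℝ).hasFDerivAt
  exact ((h.comp_hasDerivAt (0 : ℝ) (hasDerivAt_line y u))).const_add a

/-- The metric `|dt|² / |a + b t|⁴` of the complex line is flat. -/
theorem coordCurvature_eq_zero_of_affine {G : Cn 1 → Cn 1 →L[ℝ] Cn 1 →L[ℝ] ℝ} (a : ℂ)
    (b : Cn 1 →L[ℂ] ℂ)
    (hG : ∀ y, a + b y ≠ 0 → ∀ u v, G y u v =
      ((((a + b y) * (starRingEnd ℂ) (a + b y))⁻¹) ^ 2 * inner ℂ u v).re)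
    {t : Cn 1} (ht : a + b t ≠ 0) : coordCurvature G t = 0 := by
  set O : Set (Cn 1) := {y | a + b y ≠ 0} with hO
  have hOo : IsOpen O := isOpen_ne_fun (by fun_prop) continuous_const
  have hl : ContDiff ℝ ∞ (fun y => a + b y) :=
    contDiff_const.add (b.restrictScalars ℝ).contDiff
  have hlc : ContDiff ℝ ∞ (fun y => (starRingEnd ℂ) (a + b y)) :=
    Complex.conjCLE.contDiff.comp hl
  have hne : ∀ y ∈ O, (a + b y) * (starRingEnd ℂ) (a + b y) ≠ 0 := fun y hy =>
    mul_ne_zero hy ((map_ne_zero _).2 hy)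
  have hform : ∀ v w : Cn 1, ContDiffOn ℝ ∞ (fun y =>
      ((((a + b y) * (starRingEnd ℂ) (a + b y))⁻¹) ^ 2 * inner ℂ v w).re) O := fun v w =>
    Complex.reCLM.contDiff.comp_contDiffOn
      ((((hl.mul hlc).contDiffOn.inv hne).pow 2).mul contDiffOn_const)
  have hGs : ContDiffOn ℝ ∞ G O := by
    rw [contDiffOn_clm_apply]
    intro v
    rw [contDiffOn_clm_apply]
    intro w
    exact (hform v w).congr fun y hy => hG y hy v w
  have hGa : ∀ y ∈ O, ContDiffAt ℝ ∞ G y := fun y hy => hGs.contDiffAt (hOo.mem_nhds hy)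
  have hk : ∀ y ∈ O, 0 < (((a + b y) * (starRingEnd ℂ) (a + b y))⁻¹ ^ 2).re ∧
      (((a + b y) * (starRingEnd ℂ) (a + b y))⁻¹ ^ 2).im = 0 := fun y hy => by
    have h : ((a + b y) * (starRingEnd ℂ) (a + b y))⁻¹ ^ 2 =
        (((Complex.normSq (a + b y))⁻¹ ^ 2 : ℝ) : ℂ) := by
      rw [Complex.mul_conj]; push_cast; rfl
    rw [h]
    have := Complex.normSq_pos.2 hy
    exact ⟨by rw [Complex.ofReal_re]; positivity, Complex.ofReal_im _⟩
  have hi : ∀ y ∈ O, (G y).IsInvertible := fun y hy => by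
    refine isInvertible_of_pos fun v hv => ?_
    rw [hG y hy, inner_self_complex, ← Complex.ofReal_pow, Complex.re_mul_ofReal]
    exact mul_pos (hk y hy).1 (pow_pos (norm_pos_iff.2 hv) 2)
  -- The conformal factor is `|a + b y|⁻⁴`, and its logarithmic `∂`-derivative `-2b/(a + b y)` is
  -- the connection form. It is holomorphic in `y`, which is why the curvature vanishes.
  have hΓ : ∀ y ∈ O, ∀ u v, christoffel G y u v = (-2 * b u * (a + b y)⁻¹) • v := by
    intro y hy
    refine christoffel_eq_of_compatible (Γ := fun u v => (-2 * b u * (a + b y)⁻¹) • v) (hi y hy)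
      (fun u v => ?_) (fun u v => ?_) fun u v w => ?_
    · rw [hG y hy, hG y hy, Complex.mul_re, Complex.mul_re, (hk y hy).2, ← inner_conj_symm u v,
        Complex.conj_re]
      ring
    · have h := congrArg (fun x => (-2 * (a + b y)⁻¹) • x) (clm_smul_comm b u v)
      simp only [smul_smul] at h
      rw [mul_right_comm, h, mul_right_comm]
    · have hd : DifferentiableAt ℝ G y := (hGa y hy).differentiableAt (by simp)
      rw [fderiv_clm_apply_eq hd, fderiv_clm_apply_eq (by fun_prop)]
      have he : (fun y => G y v w) =ᶠ[𝓝 y] fun y =>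
          ((((a + b y) * (starRingEnd ℂ) (a + b y))⁻¹) ^ 2 * inner ℂ v w).re := by
        filter_upwards [hOo.mem_nhds hy] with x hx
        exact hG x hx v w
      rw [he.fderiv_eq]
      have h1 := hasDerivAt_affine_line a b y u
      have h2 := Complex.conjCLE.hasFDerivAt.comp_hasDerivAt (0 : ℝ) h1
      have h0 : a + b (y + (0 : ℝ) • u) = a + b y := by simp
      have h3 := (((h1.mul h2).inv (by
        simp only [Pi.mul_apply, Function.comp_apply, h0]
        exact hne y hy)).pow 2).mul_const (inner ℂ v w)
      refine fderiv_eq_of_hasDerivAt (((hform v w).contDiffAt (hOo.mem_nhds hy)).differentiableAt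
        (by simp)) ((Complex.reCLM.hasFDerivAt.comp_hasDerivAt (0 : ℝ) h3).congr_deriv ?_)
      rw [hG y hy, hG y hy, ← Complex.add_re]
      change Complex.re _ = _
      congr 1
      have hy0 : a + b y ≠ 0 := hy
      have hy1 : (starRingEnd ℂ) (a + b y) ≠ 0 := (map_ne_zero _).2 hy0
      simp only [inner_smul_left, inner_smul_right, Pi.mul_apply, Pi.inv_apply,
        Function.comp_apply, h0]
      simp only [map_mul, map_neg, map_inv₀, map_ofNat, Complex.conjCLE_apply]
      simp
      field_simp
  have hd : DifferentiableAt ℝ (christoffel G) t :=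
    (contDiffAt_christoffel (hGa t ht) (hi t ht)).differentiableAt (by simp)
  -- The derivative is symmetric in `u` and `v`, and so is the composition of Christoffel symbols;
  -- both drop out of the curvature.
  have hD : ∀ u v w, fderiv ℝ (christoffel G) t u v w =
      (2 * b v * b u * ((a + b t)⁻¹) ^ 2) • w := by
    intro u v w
    rw [fderiv_clm_apply_eq hd, fderiv_clm_apply_eq (by fun_prop)]
    have he : (fun y => christoffel G y v w) =ᶠ[𝓝 t] fun y => (-2 * b v * (a + b y)⁻¹) • w := by
      filter_upwards [hOo.mem_nhds ht] with x hx
      exact hΓ x hx v w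
    rw [he.fderiv_eq]
    have h1 := ((((hasDerivAt_affine_line a b t u).inv (by simpa using ht)).const_mul
      (-2 * b v)).smul_const w)
    have hd : DifferentiableAt ℝ (fun y => (-2 * b v * (a + b y)⁻¹) • w) t :=
      ((contDiffAt_const.mul (hl.contDiffAt.inv ht)).smul contDiffAt_const).differentiableAt
        (n := ∞) (by simp)
    refine fderiv_eq_of_hasDerivAt hd (h1.congr_deriv ?_)
    congr 1
    simp
    field_simp
  ext1 u
  ext1 v
  ext1 w
  rw [coordCurvature_apply, hD, hD, hΓ t ht v w, hΓ t ht u w, hΓ t ht, hΓ t ht]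
  simp only [smul_smul, zero_apply]
  module

/-- In dimension one `⟨u,t⟩⟨t,v⟩ = ⟨t,t⟩⟨u,v⟩`, so the metric is conformal to the Euclidean one in
the chart. -/
theorem coordHerm_one (t u v : Cn 1) : coordHerm t u v = conformalFactor t ^ 2 * inner ℂ u v := by
  have h : conformalFactor t * (1 + inner ℂ t t) = 1 :=
    inv_mul_cancel₀ (one_add_inner_self_ne_zero t)
  have h2 : inner ℂ u t * inner ℂ t v = inner ℂ t t * inner ℂ u v := by
    simp only [PiLp.inner_apply, Fin.sum_univ_one, RCLike.inner_apply]
    ring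
  rw [coordHerm, h2]
  linear_combination (-conformalFactor t * inner ℂ u v) * h

theorem contMDiffOn_affineMap {n : ℕ} (i : Fin (n + 1)) :
    ContMDiffOn 𝓘(ℝ, Cn n) 𝓘(ℝ, Cn n) ∞ (affineMap (n := n) i) (affineSet i) :=
  contMDiffOn_of_mem_maximalAtlas (e := affineChart i)
    (IsManifold.subset_maximalAtlas (Set.mem_range_self i))

theorem isLocallyConformallyFlat_CP_one : IsLocallyConformallyFlat (fubiniStudy 1) := by
  intro p
  set i := chartIndex p
  refine ⟨affineSet i, isOpen_affineSet i, chartIndex_mem p,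
    -- Here `1 + |t|² = |z|²/|z_i|²`, so `e^{2f} = |z|⁴/|z_i|⁴`, while the metric in any chart is
    -- `|dt|²/|z|⁴` for the affine lift `z`.
    fun q => Real.log (1 + ‖affineMap i q‖ ^ 2), ?_, fun q hq => ?_⟩
  · have h : ContDiff ℝ ∞ (fun x : Cn 1 => Real.log (1 + ‖x‖ ^ 2)) :=
      (contDiff_const.add (contDiff_norm_sq ℂ)).log fun x => by positivity
    exact h.contMDiff.comp_contMDiffOn (contMDiffOn_affineMap i)
  · set k := chartIndex q
    -- Curvature at `q` is taken in the preferred chart `k` of `q`, possibly different from `i`;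
    -- there `z_i` is an affine function `a + b y` of the coordinate.
    have hlift : ∀ y, affineLift k y i = (EuclideanSpace.single k (1 : ℂ) : Cn 2) i +
      ((EuclideanSpace.proj (𝕜 := ℂ) i : Cn 2 →L[ℂ] ℂ) ∘L slot k) y := fun y => rfl
    have hq' : affineLift k (chartAt (Cn 1) q q) i ≠ 0 := by
      rw [← proj_mem_affineSet (affineLift_ne_zero k _), proj_affineLift]
      exact ((chartAt (Cn 1) q).left_inv (mem_chart_source _ q)).symm ▸ hq
    refine coordCurvature_eq_zero_of_affine ((EuclideanSpace.single k (1 : ℂ) : Cn 2) i)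
      ((EuclideanSpace.proj (𝕜 := ℂ) i : Cn 2 →L[ℂ] ℂ) ∘L slot k) (fun y hy u v => ?_) ?_
    · rw [← hlift] at hy ⊢
      have h1 : affineMap i ((chartAt (Cn 1) q).symm y) = affineCoord i (affineLift k y) := rfl
      have h2 : coordMetric (fun x => Real.exp (2 * Real.log (1 + ‖affineMap i x‖ ^ 2)) •
          fubiniStudy 1 x : TensorField (Cn 1) (CP 1)) q y u v =
          Real.exp (2 * Real.log (1 + ‖affineMap i ((chartAt (Cn 1) q).symm y)‖ ^ 2)) *
            coordMetric (fubiniStudy 1) q y u v := rfl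
      rw [h2, h1, coordMetric_fubiniStudy, ← norm_affineLift_sq i, affineLift_affineCoord _ _ hy,
        coordHerm_one, ← Complex.re_ofReal_mul, conformalFactor_eq, ← norm_affineLift_sq k]
      congr 1
      have h3 : 0 < ‖affineLift k y‖ := norm_pos_iff.2 (affineLift_ne_zero k y)
      have h4 : 0 < ‖affineLift k y i‖ := norm_pos_iff.2 hy
      rw [← mul_assoc, Complex.mul_conj']
      congr 1
      rw [two_mul, Real.exp_add, Real.exp_log (by rw [norm_smul, norm_inv]; positivity),
        norm_smul, norm_inv]
      norm_cast
      push_cast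
      have := h3.ne'
      field_simp
    · rw [← hlift]
      exact hq'


/-! ### Maps out of projective space -/

/-- The section `q ↦ z_i • (q_k / q_i)_k` of the projection through `z`. -/
noncomputable def projSection {n : ℕ} (i : Fin (n + 1)) (z : Cn (n + 1)) (q : CP n) : Cn (n + 1) :=
  z i • affineLift i (affineMap i q)

section

variable {n : ℕ} {i : Fin (n + 1)} {z : Cn (n + 1)}

theorem ne_zero_of_apply_ne (hz : z i ≠ 0) : z ≠ 0 := by
  rintro rfl
  simp at hz

theorem projSection_proj (hz : z i ≠ 0) : projSection i z (proj n z) = z := by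
  rw [projSection, affineMap_proj _ (ne_zero_of_apply_ne hz), affineLift_affineCoord i z hz,
    smul_smul, mul_inv_cancel₀ hz, one_smul]

theorem proj_projSection (hz : z i ≠ 0) {q : CP n} (hq : q ∈ affineSet i) :
    proj n (projSection i z q) = q := by
  rw [projSection, proj_smul hz (affineLift_ne_zero _ _), proj_affineLift]
  exact (affineChart i).left_inv hq

theorem contMDiffAt_projSection {q : CP n} (hq : q ∈ affineSet i) :
    ContMDiffAt 𝓘(ℝ, Cn n) 𝓘(ℝ, Cn (n + 1)) ∞ (projSection i z) q := by
  have h : ContDiff ℝ ∞ (fun t : Cn n => z i • affineLift i t) := by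
    unfold affineLift
    exact (contDiff_const.add ((slot i).restrictScalars ℝ).contDiff).const_smul (z i)
  exact h.contMDiff.contMDiffAt.comp q
    ((contMDiffOn_affineMap i).contMDiffAt ((isOpen_affineSet i).mem_nhds hq))

theorem eventually_proj_projSection (hz : z i ≠ 0) :
    ∀ᶠ q in 𝓝 (proj n z), proj n (projSection i z q) = q := by
  filter_upwards [(isOpen_affineSet i).mem_nhds
    ((proj_mem_affineSet (ne_zero_of_apply_ne hz)).2 hz)] with q hq
  exact proj_projSection hz hq

/-- Near `proj n z` the map `f` factors as `f ∘ proj` after the smooth section `projSection` through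
`z`. -/
theorem contMDiffAt_of_comp_proj {E N : Type*} [NormedAddCommGroup E] [NormedSpace ℝ E]
    [TopologicalSpace N] [ChartedSpace E N] {f : CP n → N} (hz : z ≠ 0)
    (hf : ContMDiffAt 𝓘(ℝ, Cn (n + 1)) 𝓘(ℝ, E) ∞ (fun z => f (proj n z)) z) :
    ContMDiffAt 𝓘(ℝ, Cn n) 𝓘(ℝ, E) ∞ f (proj n z) := by
  have hi := chartIndex_proj_ne hz
  have h1 : ContMDiffAt 𝓘(ℝ, Cn n) 𝓘(ℝ, E) ∞
      (fun q => f (proj n (projSection (chartIndex (proj n z)) z q))) (proj n z) :=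
    ContMDiffAt.comp (g := fun z => f (proj n z)) (proj n z) (by rw [projSection_proj hi]; exact hf)
      (contMDiffAt_projSection (chartIndex_mem _))
  refine h1.congr_of_eventuallyEq ?_
  filter_upwards [eventually_proj_projSection hi] with q hq
  rw [hq]

/-- Every tangent vector of projective space is the image of a vector orthogonal to `z`. -/
theorem exists_mfderiv_proj_eq (hz : ‖z‖ = 1) (u : Cn n) :
    ∃ v : Cn (n + 1), inner ℂ z v = 0 ∧
      (mfderiv 𝓘(ℝ, Cn (n + 1)) 𝓘(ℝ, Cn n) (proj n) z : Cn (n + 1) →L[ℝ] Cn n) v = u :=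
  (isSubmersionMetric_fubiniStudy n).surjective z hz u

theorem fubiniStudy_mfderiv_proj (hz : z ≠ 0) (v w : Cn (n + 1)) :
    (fubiniStudy n (proj n z) : Cn n →L[ℝ] Cn n →L[ℝ] ℝ)
      ((mfderiv 𝓘(ℝ, Cn (n + 1)) 𝓘(ℝ, Cn n) (proj n) z : Cn (n + 1) →L[ℝ] Cn n) v)
      ((mfderiv 𝓘(ℝ, Cn (n + 1)) 𝓘(ℝ, Cn n) (proj n) z : Cn (n + 1) →L[ℝ] Cn n) w) =
      (hermForm z v w).re :=
  pullback_proj hz v w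

theorem bilin_eq_of_self {E : Type*} [NormedAddCommGroup E] [NormedSpace ℝ E]
    {A B : E →L[ℝ] E →L[ℝ] ℝ} (hA : ∀ u v, A u v = A v u) (hB : ∀ u v, B u v = B v u)
    (h : ∀ u, A u u = B u u) : A = B := by
  ext u v
  have h1 := h (u + v)
  simp only [map_add, add_apply] at h1
  linarith [h u, h v, hA u v, hB u v]

theorem fubiniStudy_symm (p : CP n) (u v : Cn n) :
    (fubiniStudy n p : Cn n →L[ℝ] Cn n →L[ℝ] ℝ) u v =
      (fubiniStudy n p : Cn n →L[ℝ] Cn n →L[ℝ] ℝ) v u :=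
  (fubiniStudy_eq_coordHerm p u v).trans
      ((coordHerm_re_comm _ _ _).trans (fubiniStudy_eq_coordHerm p v u).symm)

theorem fubiniStudy_pos (p : CP n) {u : Cn n} (hu : u ≠ 0) :
    0 < (fubiniStudy n p : Cn n →L[ℝ] Cn n →L[ℝ] ℝ) u u :=
  (coordHerm_self_pos _ hu).trans_eq (fubiniStudy_eq_coordHerm p u u).symm

end

/-! ### The Hopf map -/

/-- The Hopf map `z ↦ (2 z̄₀ z₁, |z₀|² - |z₁|²) / |z|²`. -/
noncomputable def hopf (z : Cn 2) : EuclideanSpace ℝ (Fin 3) :=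
  (‖z‖ ^ 2)⁻¹ • !₂[2 * ((starRingEnd ℂ) (z 0) * z 1).re, 2 * ((starRingEnd ℂ) (z 0) * z 1).im,
    Complex.normSq (z 0) - Complex.normSq (z 1)]

theorem norm_sq_two (z : Cn 2) : ‖z‖ ^ 2 = Complex.normSq (z 0) + Complex.normSq (z 1) := by
  simp [EuclideanSpace.norm_sq_eq, Complex.normSq_eq_norm_sq]

theorem norm_hopf {z : Cn 2} (hz : z ≠ 0) : ‖hopf z‖ = 1 := by
  have h : ‖hopf z‖ ^ 2 = 1 := by
    rw [hopf, norm_smul, mul_pow]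
    have h2 : 0 < ‖z‖ := norm_pos_iff.2 hz
    have h3 := norm_sq_two z
    have h1 : ‖(!₂[2 * ((starRingEnd ℂ) (z 0) * z 1).re, 2 * ((starRingEnd ℂ) (z 0) * z 1).im,
        Complex.normSq (z 0) - Complex.normSq (z 1)] : EuclideanSpace ℝ (Fin 3))‖ ^ 2 =
        (‖z‖ ^ 2) ^ 2 := by
      rw [h3]
      simp [EuclideanSpace.norm_sq_eq, Fin.sum_univ_three, Complex.normSq_apply]
      ring
    rw [h1]
    simp
    field_simp
  have := norm_nonneg (hopf z)
  nlinarith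

theorem hopf_smul {c : ℂ} (hc : c ≠ 0) (z : Cn 2) : hopf (c • z) = hopf z := by
  have h : Complex.normSq c ≠ 0 := by simpa using hc
  have h1 : ‖c • z‖ ^ 2 = Complex.normSq c * ‖z‖ ^ 2 := by
    rw [norm_smul, mul_pow, Complex.normSq_eq_norm_sq]
  have h2 : (starRingEnd ℂ) ((c • z) 0) * (c • z) 1 =
      (Complex.normSq c : ℂ) * ((starRingEnd ℂ) (z 0) * z 1) := by
    rw [Complex.normSq_eq_conj_mul_self]
    simp
    ring
  have h3 : ∀ j, Complex.normSq ((c • z) j) = Complex.normSq c * Complex.normSq (z j) := by simp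
  rw [hopf, hopf, h1, h2, h3, h3, Complex.re_ofReal_mul, Complex.im_ofReal_mul]
  ext j
  fin_cases j <;> simp <;> field_simp

theorem contDiffAt_hopf {z : Cn 2} (hz : z ≠ 0) : ContDiffAt ℝ ∞ hopf z := by
  have hp : ∀ j : Fin 2, ContDiff ℝ ∞ (fun z : Cn 2 => z j) := fun j =>
    ((EuclideanSpace.proj (𝕜 := ℂ) j : Cn 2 →L[ℂ] ℂ).restrictScalars ℝ).contDiff
  have hc : ContDiff ℝ ∞ (fun z : Cn 2 => (starRingEnd ℂ) (z 0) * z 1) :=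
    (Complex.conjCLE.contDiff.comp (hp 0)).mul (hp 1)
  have hs : ∀ j : Fin 2, ContDiff ℝ ∞ (fun z : Cn 2 => Complex.normSq (z j)) := fun j => by
    simp only [Complex.normSq_eq_norm_sq]
    exact (contDiff_norm_sq ℂ).comp (hp j)
  refine ContDiffAt.smul ((contDiff_norm_sq ℂ).contDiffAt.inv (by simpa using hz)) ?_
  rw [contDiffAt_piLp]
  intro j
  fin_cases j
  · exact (contDiff_const.mul (Complex.reCLM.contDiff.comp hc)).contDiffAt
  · exact (contDiff_const.mul (Complex.imCLM.contDiff.comp hc)).contDiffAt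
  · exact ((hs 0).sub (hs 1)).contDiffAt

theorem hasDerivAt_hopf {z v : Cn 2} (hz : ‖z‖ = 1) (hv : inner ℂ z v = 0) :
    HasDerivAt (fun s : ℝ => hopf (z + s • v))
      (!₂[2 * ((starRingEnd ℂ) (v 0) * z 1 + (starRingEnd ℂ) (z 0) * v 1).re,
        2 * ((starRingEnd ℂ) (v 0) * z 1 + (starRingEnd ℂ) (z 0) * v 1).im,
        2 * ((starRingEnd ℂ) (v 0) * z 0 - (starRingEnd ℂ) (v 1) * z 1).re]) 0 := by
  have hl : ∀ j : Fin 2, HasDerivAt (fun s : ℝ => (z + s • v) j) (v j) 0 := fun j =>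
    HasFDerivAt.comp_hasDerivAt (l := fun z : Cn 2 => z j) (0 : ℝ)
      (((EuclideanSpace.proj (𝕜 := ℂ) j : Cn 2 →L[ℂ] ℂ).restrictScalars ℝ).hasFDerivAt)
      (hasDerivAt_line z v)
  have hlc : ∀ j : Fin 2, HasDerivAt (fun s : ℝ => (starRingEnd ℂ) ((z + s • v) j))
      ((starRingEnd ℂ) (v j)) 0 := fun j =>
    (Complex.conjCLE.hasFDerivAt).comp_hasDerivAt (0 : ℝ) (hl j)
  have hc : HasDerivAt (fun s : ℝ => (starRingEnd ℂ) ((z + s • v) 0) * (z + s • v) 1)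
      ((starRingEnd ℂ) (v 0) * z 1 + (starRingEnd ℂ) (z 0) * v 1) 0 := by
    refine ((hlc 0).mul (hl 1)).congr_deriv ?_
    simp
  have hq : ∀ j : Fin 2, HasDerivAt (fun s : ℝ => Complex.normSq ((z + s • v) j))
      (2 * ((starRingEnd ℂ) (v j) * z j).re) 0 := fun j => by
    have h := Complex.reCLM.hasFDerivAt.comp_hasDerivAt (0 : ℝ) ((hlc j).mul (hl j))
    refine (h.congr_of_eventuallyEq (Eventually.of_forall fun s => ?_)).congr_deriv ?_
    · simp [Complex.normSq_apply]
      ring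
    · simp
      ring
  have hvn : (inner ℂ z v : ℂ).re = 0 := by rw [hv]; rfl
  -- For horizontal `v` the norm is stationary to first order, so the normalizing factor of the Hopf
  -- map does not contribute.
  have hn : HasDerivAt (fun s : ℝ => (‖z + s • v‖ ^ 2)⁻¹) 0 0 := by
    have h1 := ((hq 0).add (hq 1))
    have h2 : HasDerivAt (fun s : ℝ => ‖z + s • v‖ ^ 2) 0 0 := by
      refine (h1.congr_of_eventuallyEq (Eventually.of_forall fun s => norm_sq_two _)).congr_deriv ?_
      simp [PiLp.inner_apply] at hvn
      simp
      linarith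
    exact (h2.fun_inv (by simp [hz])).congr_deriv (by simp)
  have hN : HasDerivAt (fun s : ℝ => (!₂[2 * ((starRingEnd ℂ) ((z + s • v) 0) * (z + s • v) 1).re,
      2 * ((starRingEnd ℂ) ((z + s • v) 0) * (z + s • v) 1).im,
      Complex.normSq ((z + s • v) 0) - Complex.normSq ((z + s • v) 1)] : EuclideanSpace ℝ (Fin 3)))
      (!₂[2 * ((starRingEnd ℂ) (v 0) * z 1 + (starRingEnd ℂ) (z 0) * v 1).re,
        2 * ((starRingEnd ℂ) (v 0) * z 1 + (starRingEnd ℂ) (z 0) * v 1).im,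
        2 * ((starRingEnd ℂ) (v 0) * z 0 - (starRingEnd ℂ) (v 1) * z 1).re]) 0 := by
    rw [hasDerivAt_iff_hasFDerivAt, ← hasFDerivWithinAt_univ, hasFDerivWithinAt_piLp]
    intro j
    fin_cases j
    · exact ((Complex.reCLM.hasFDerivAt.comp_hasDerivAt (0 : ℝ) hc).const_mul 2).hasDerivWithinAt.hasFDerivWithinAt
    · exact ((Complex.imCLM.hasFDerivAt.comp_hasDerivAt (0 : ℝ) hc).const_mul 2).hasDerivWithinAt.hasFDerivWithinAt
    · exact (((hq 0).sub (hq 1)).congr_deriv (by simp; ring)).hasDerivWithinAt.hasFDerivWithinAt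
  refine (hn.smul hN).congr_deriv ?_
  simp [hz]

theorem norm_deriv_hopf {z v : Cn 2} (hz : ‖z‖ = 1) (hv : inner ℂ z v = 0) :
    ‖(!₂[2 * ((starRingEnd ℂ) (v 0) * z 1 + (starRingEnd ℂ) (z 0) * v 1).re,
        2 * ((starRingEnd ℂ) (v 0) * z 1 + (starRingEnd ℂ) (z 0) * v 1).im,
        2 * ((starRingEnd ℂ) (v 0) * z 0 - (starRingEnd ℂ) (v 1) * z 1).re] :
        EuclideanSpace ℝ (Fin 3))‖ ^ 2 = 4 * ‖v‖ ^ 2 := by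
  have hz2 : Complex.normSq (z 0) + Complex.normSq (z 1) = 1 := by rw [← norm_sq_two, hz, one_pow]
  have hv' : (starRingEnd ℂ) (z 0) * v 0 + (starRingEnd ℂ) (z 1) * v 1 = 0 := by
    simpa [PiLp.inner_apply, mul_comm] using hv
  have hz3 : (starRingEnd ℂ) (z 0) * z 0 + (starRingEnd ℂ) (z 1) * z 1 = 1 := by
    rw [← Complex.normSq_eq_conj_mul_self, ← Complex.normSq_eq_conj_mul_self]
    exact_mod_cast hz2
  -- The orthogonal complement of `z` in `ℂ²` is spanned by `(-z̄₁, z̄₀)`; the coefficient is the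
  -- determinant of `z` and `v`.
  obtain ⟨c, hc0, hc1⟩ : ∃ c : ℂ, v 0 = -c * (starRingEnd ℂ) (z 1) ∧
      v 1 = c * (starRingEnd ℂ) (z 0) :=
    ⟨z 0 * v 1 - z 1 * v 0,
      by linear_combination (-v 0) * hz3 + z 0 * hv', by
        linear_combination (-v 1) * hz3 + z 1 * hv'⟩
  rw [norm_sq_two v, hc0, hc1]
  simp only [Complex.normSq_apply] at hz2
  simp [EuclideanSpace.norm_sq_eq, Fin.sum_univ_three, Complex.normSq_apply]
  set a := (z 0).re
  set b := (z 0).im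
  set d := (z 1).re
  set e := (z 1).im
  linear_combination (4 * (c.re * c.re + c.im * c.im) * (a * a + b * b + (d * d + e * e))) * hz2

/-- The Hopf map on the projective line. -/
noncomputable def hopfMap (p : CP 1) : Metric.sphere (0 : EuclideanSpace ℝ (Fin 3)) 1 :=
  ⟨hopf p.rep, by simpa using norm_hopf p.rep_nonzero⟩

theorem hopfMap_proj {z : Cn 2} (hz : z ≠ 0) : (hopfMap (proj 1 z)).1 = hopf z := by
  rw [proj_of_ne hz]
  obtain ⟨c, hc⟩ := Projectivization.exists_smul_eq_mk_rep ℂ z hz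
  change hopf (Projectivization.mk ℂ z hz).rep = _
  rw [← hc, Units.smul_def, hopf_smul c.ne_zero]

theorem contMDiff_coe_hopfMap :
    ContMDiff 𝓘(ℝ, Cn 1) 𝓘(ℝ, EuclideanSpace ℝ (Fin 3)) ∞ (fun p => (hopfMap p).1) := by
  intro p
  obtain ⟨z, hz, rfl⟩ := exists_proj_eq p
  have hz0 : z ≠ 0 := norm_ne_zero_iff.1 (by simp [hz])
  refine contMDiffAt_of_comp_proj hz0 ?_
  refine (contDiffAt_hopf hz0).contMDiffAt.congr_of_eventuallyEq ?_
  filter_upwards [isOpen_ne.mem_nhds hz0] with y hy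
  exact hopfMap_proj hy

theorem contMDiff_hopfMap :
    ContMDiff 𝓘(ℝ, Cn 1) 𝓘(ℝ, EuclideanSpace ℝ (Fin 2)) ∞ hopfMap := by
  have : Fact (Module.finrank ℝ (EuclideanSpace ℝ (Fin 3)) = 2 + 1) := ⟨by simp⟩
  exact contMDiff_coe_hopfMap.codRestrict_sphere fun p => (hopfMap p).2

theorem hopfMap_bijective : Function.Bijective hopfMap := by
  constructor
  · intro p q hpq
    obtain ⟨z, hz, rfl⟩ := exists_proj_eq p
    obtain ⟨w, hw, rfl⟩ := exists_proj_eq q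
    have hz0 : z ≠ 0 := norm_ne_zero_iff.1 (by simp [hz])
    have hw0 : w ≠ 0 := norm_ne_zero_iff.1 (by simp [hw])
    have h := congrArg Subtype.val hpq
    rw [hopfMap_proj hz0, hopfMap_proj hw0, hopf, hopf, hz, hw] at h
    have h0 := congrArg (fun x : EuclideanSpace ℝ (Fin 3) => x 0) h
    have h1 := congrArg (fun x : EuclideanSpace ℝ (Fin 3) => x 1) h
    have h2 := congrArg (fun x : EuclideanSpace ℝ (Fin 3) => x 2) h
    have hz2 := norm_sq_two z
    have hw2 := norm_sq_two w
    rw [hz] at hz2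
    rw [hw] at hw2
    -- For unit vectors `|⟨z,w⟩|²` is determined by the scalar product of the Hopf images. Equal
    -- images force equality in Cauchy–Schwarz, hence proportional vectors.
    have hi : Complex.normSq (inner ℂ z w) = 1 := by
      have e : Complex.normSq (inner ℂ z w) = Complex.normSq (z 0) * Complex.normSq (w 0) +
          Complex.normSq (z 1) * Complex.normSq (w 1) +
          2 * (((starRingEnd ℂ) (z 0) * z 1).re * ((starRingEnd ℂ) (w 0) * w 1).re +
            ((starRingEnd ℂ) (z 0) * z 1).im * ((starRingEnd ℂ) (w 0) * w 1).im) := by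
        simp [PiLp.inner_apply, Complex.normSq_apply]
        ring
      have e2 : ((starRingEnd ℂ) (z 0) * z 1).re ^ 2 + ((starRingEnd ℂ) (z 0) * z 1).im ^ 2 =
          Complex.normSq (z 0) * Complex.normSq (z 1) := by
        simp [Complex.normSq_apply]
        ring
      have e0 : ((starRingEnd ℂ) (z 0) * z 1).re = ((starRingEnd ℂ) (w 0) * w 1).re := by
        simpa using h0
      have e1 : ((starRingEnd ℂ) (z 0) * z 1).im = ((starRingEnd ℂ) (w 0) * w 1).im := by
        simpa using h1
      have e3 : Complex.normSq (z 0) - Complex.normSq (z 1) =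
          Complex.normSq (w 0) - Complex.normSq (w 1) := by
        simpa using h2
      have e4 : Complex.normSq (w 0) = Complex.normSq (z 0) := by linarith
      have e5 : Complex.normSq (w 1) = Complex.normSq (z 1) := by linarith
      rw [e, ← e0, ← e1, e4, e5]
      linear_combination 2 * e2 - (1 + Complex.normSq (z 0) + Complex.normSq (z 1)) * hz2
    have hn : ‖inner ℂ z w‖ = ‖z‖ * ‖w‖ := by
      rw [hz, hw, one_mul]
      rw [Complex.normSq_eq_norm_sq] at hi
      nlinarith [norm_nonneg (inner ℂ z w)]
    obtain ⟨r, hr, rfl⟩ := (norm_inner_eq_norm_iff hz0 hw0).1 hn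
    exact (proj_smul hr hz0).symm
  · rintro ⟨x, hx⟩
    have hx' : x 0 ^ 2 + x 1 ^ 2 + x 2 ^ 2 = 1 := by
      have : ‖x‖ ^ 2 = 1 := by rw [mem_sphere_zero_iff_norm.1 hx, one_pow]
      simpa [EuclideanSpace.norm_sq_eq, Fin.sum_univ_three] using this
    -- The preimage is `[1 + x₂ : x₀ + i x₁]`, inverse stereographic projection, which degenerates
    -- at the south pole; that point comes from `[0 : 1]`.
    by_cases h : 1 + x 2 = 0
    · have h2 : x 2 = -1 := by linarith
      have h0 : x 0 = 0 := by nlinarith [sq_nonneg (x 0), sq_nonneg (x 1)]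
      have h1 : x 1 = 0 := by nlinarith [sq_nonneg (x 0), sq_nonneg (x 1)]
      have hz0 : (!₂[0, 1] : Cn 2) ≠ 0 := fun h => by
        simpa using congrArg (fun x : Cn 2 => x 1) h
      refine ⟨proj 1 !₂[0, 1], Subtype.ext ?_⟩
      rw [hopfMap_proj hz0, hopf, norm_sq_two]
      ext j
      fin_cases j <;> simp [h0, h1, h2]
    · have hz0 : (!₂[((1 + x 2 : ℝ) : ℂ), ⟨x 0, x 1⟩] : Cn 2) ≠ 0 := fun h' => by
        have := congrArg (fun x : Cn 2 => x 0) h'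
        have h3 : ((1 + x 2 : ℝ) : ℂ) = 0 := this
        exact h (Complex.ofReal_eq_zero.1 h3)
      refine ⟨proj 1 !₂[((1 + x 2 : ℝ) : ℂ), ⟨x 0, x 1⟩], Subtype.ext ?_⟩
      have hn : ‖(!₂[((1 + x 2 : ℝ) : ℂ), ⟨x 0, x 1⟩] : Cn 2)‖ ^ 2 = 2 * (1 + x 2) := by
        rw [norm_sq_two]
        simp [Complex.normSq_apply]
        linarith
      rw [hopfMap_proj hz0, hopf, hn]
      ext j
      fin_cases j
      · simp; field_simp
      · simp; field_simp
      · simp [Complex.normSq_apply]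
        field_simp
        linarith

theorem mfderiv_coe_hopfMap {z : Cn 2} (hz : ‖z‖ = 1) {v : Cn 2} (hv : inner ℂ z v = 0) :
    norm (E := EuclideanSpace ℝ (Fin 3))
      ((mfderiv 𝓘(ℝ, Cn 1) 𝓘(ℝ, EuclideanSpace ℝ (Fin 3)) (fun p => (hopfMap p).1) (proj 1 z) :
        Cn 1 →L[ℝ] EuclideanSpace ℝ (Fin 3))
      ((mfderiv 𝓘(ℝ, Cn 2) 𝓘(ℝ, Cn 1) (proj 1) z : Cn 2 →L[ℝ] Cn 1) v)) ^ 2 = 4 * ‖v‖ ^ 2 := by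
  have hz0 : z ≠ 0 := norm_ne_zero_iff.1 (by simp [hz])
  have h1 := ((contMDiff_coe_hopfMap (proj 1 z)).mdifferentiableAt (by simp)).hasMFDerivAt.comp z
    (hasMFDerivAt_proj hz0).mdifferentiableAt.hasMFDerivAt
  have h2 : HasMFDerivAt 𝓘(ℝ, Cn 2) 𝓘(ℝ, EuclideanSpace ℝ (Fin 3)) hopf z (fderiv ℝ hopf z) :=
    ((contDiffAt_hopf hz0).differentiableAt (by simp)).hasFDerivAt.hasMFDerivAt
  have h3 := h2.congr_of_eventuallyEq (f₁ := (fun p => (hopfMap p).1) ∘ proj 1) (by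
    filter_upwards [isOpen_ne.mem_nhds hz0] with y hy
    exact hopfMap_proj hy)
  have h4 := DFunLike.congr_fun (hasMFDerivAt_unique h1 h3) v
  have h5 : fderiv ℝ hopf z v = _ := fderiv_eq_of_hasDerivAt
    ((contDiffAt_hopf hz0).differentiableAt (by simp)) (hasDerivAt_hopf hz hv)
  rw [← norm_deriv_hopf hz hv, ← h5]
  exact congrArg (fun x : EuclideanSpace ℝ (Fin 3) => ‖x‖ ^ 2) h4

theorem norm_mfderiv_coe_hopfMap (p : CP 1) (u : Cn 1) :
    norm (E := EuclideanSpace ℝ (Fin 3))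
      ((mfderiv 𝓘(ℝ, Cn 1) 𝓘(ℝ, EuclideanSpace ℝ (Fin 3)) (fun p => (hopfMap p).1) p :
        Cn 1 →L[ℝ] EuclideanSpace ℝ (Fin 3)) u) ^ 2 =
      4 * (fubiniStudy 1 p : Cn 1 →L[ℝ] Cn 1 →L[ℝ] ℝ) u u := by
  obtain ⟨z, hz, rfl⟩ := exists_proj_eq p
  have hz0 : z ≠ 0 := norm_ne_zero_iff.1 (by simp [hz])
  obtain ⟨v, hv, rfl⟩ := exists_mfderiv_proj_eq hz u
  refine (mfderiv_coe_hopfMap hz hv).trans (congrArg (4 * ·) ?_)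
  refine Eq.trans ?_ (fubiniStudy_mfderiv_proj hz0 v v).symm
  rw [hermForm_of_norm_one hz hv, inner_self_complex]
  norm_cast

theorem mfderiv_coe_hopfMap_eq (p : CP 1) (u : Cn 1) :
    (mfderiv 𝓘(ℝ, Cn 1) 𝓘(ℝ, EuclideanSpace ℝ (Fin 3)) (fun p => (hopfMap p).1) p :
        Cn 1 →L[ℝ] EuclideanSpace ℝ (Fin 3)) u =
    (mfderiv 𝓘(ℝ, EuclideanSpace ℝ (Fin 2)) 𝓘(ℝ, EuclideanSpace ℝ (Fin 3))
      (Subtype.val : Metric.sphere (0 : EuclideanSpace ℝ (Fin 3)) 1 → _) (hopfMap p) :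
        EuclideanSpace ℝ (Fin 2) →L[ℝ] EuclideanSpace ℝ (Fin 3))
    ((mfderiv 𝓘(ℝ, Cn 1) 𝓘(ℝ, EuclideanSpace ℝ (Fin 2)) hopfMap p :
        Cn 1 →L[ℝ] EuclideanSpace ℝ (Fin 2)) u) := by
  have : Fact (Module.finrank ℝ (EuclideanSpace ℝ (Fin 3)) = 2 + 1) := ⟨by simp⟩
  have h : MDifferentiableAt 𝓘(ℝ, EuclideanSpace ℝ (Fin 2)) 𝓘(ℝ, EuclideanSpace ℝ (Fin 3))
      (Subtype.val : Metric.sphere (0 : EuclideanSpace ℝ (Fin 3)) 1 → _) (hopfMap p) :=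
    (contMDiff_coe_sphere (m := ∞) (n := 2) (hopfMap p)).mdifferentiableAt (by simp)
  exact DFunLike.congr_fun
    (mfderiv_comp p h ((contMDiff_hopfMap p).mdifferentiableAt (by simp))) u

theorem pullback_hopfMap : pullback hopfMap roundMetric = fun p => (4 : ℝ) • fubiniStudy 1 p := by
  funext p
  refine bilin_eq_of_self (E := Cn 1) (A := pullback hopfMap roundMetric p)
    (B := (4 : ℝ) • fubiniStudy 1 p) (fun u v => ?_) (fun u v => ?_) fun u => ?_
  · exact real_inner_comm (F := EuclideanSpace ℝ (Fin 3)) _ _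
  · exact congrArg (fun x : ℝ => 4 * x) (fubiniStudy_symm p u v)
  · refine Eq.trans ?_ (norm_mfderiv_coe_hopfMap p u)
    rw [mfderiv_coe_hopfMap_eq]
    exact real_inner_self_eq_norm_sq (F := EuclideanSpace ℝ (Fin 3)) _

/-- The differential multiplies the metric by `4`, so it is injective; both tangent spaces have real
dimension two. -/
theorem mfderiv_hopfMap_bijective (p : CP 1) :
    Function.Bijective (mfderiv 𝓘(ℝ, Cn 1) 𝓘(ℝ, EuclideanSpace ℝ (Fin 2)) hopfMap p :
        Cn 1 →L[ℝ] EuclideanSpace ℝ (Fin 2)) := by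
  set D : Cn 1 →L[ℝ] EuclideanSpace ℝ (Fin 2) :=
    mfderiv 𝓘(ℝ, Cn 1) 𝓘(ℝ, EuclideanSpace ℝ (Fin 2)) hopfMap p with hD
  have hinj : Function.Injective D := by
    rw [injective_iff_map_eq_zero]
    intro u hu
    by_contra h0
    have h1 : (roundMetric (hopfMap p) : EuclideanSpace ℝ (Fin 2) →L[ℝ]
        EuclideanSpace ℝ (Fin 2) →L[ℝ] ℝ) (D u) (D u) =
        4 * (fubiniStudy 1 p : Cn 1 →L[ℝ] Cn 1 →L[ℝ] ℝ) u u :=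
      DFunLike.congr_fun (DFunLike.congr_fun (congrFun pullback_hopfMap p) u) u
    have h2 (R : EuclideanSpace ℝ (Fin 2) →L[ℝ] EuclideanSpace ℝ (Fin 2) →L[ℝ] ℝ) :
        R (D u) (D u) = 0 := by
      rw [hu, map_zero]
    have h3 := (h2 _).symm.trans h1
    linarith [fubiniStudy_pos p h0]
  have hfr : Module.finrank ℝ (Cn 1) = Module.finrank ℝ (EuclideanSpace ℝ (Fin 2)) := by
    have := Module.finrank_mul_finrank ℝ ℂ (Cn 1)
    rw [← this]
    simp
  exact ⟨hinj, (LinearMap.injective_iff_surjective_of_finrank_eq_finrank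
    (f := (D : Cn 1 →ₗ[ℝ] EuclideanSpace ℝ (Fin 2))) hfr).1 hinj⟩

theorem exists_isometry_sphere :
    ∃ Φ : Diffeomorph 𝓘(ℝ, Cn 1) 𝓘(ℝ, EuclideanSpace ℝ (Fin 2)) (CP 1)
        (Metric.sphere (0 : EuclideanSpace ℝ (Fin 3)) 1) ∞,
        pullback Φ roundMetric = fun p => (4 : ℝ) • fubiniStudy 1 p := by
  have : Fact (Module.finrank ℝ (EuclideanSpace ℝ (Fin 3)) = 2 + 1) := ⟨by simp⟩
  obtain ⟨Φ, hΦ⟩ := exists_diffeomorph_of_bijective contMDiff_hopfMap hopfMap_bijective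
    mfderiv_hopfMap_bijective
  exact ⟨Φ, by rw [hΦ]; exact pullback_hopfMap⟩


/-! ### The special unitary group -/

section SpecialUnitary

variable {n : ℕ}

theorem SU.star_mul_self (x : SU n) : star x.1 * x.1 = 1 :=
  (Matrix.mem_unitaryGroup_iff').1 (Matrix.mem_specialUnitaryGroup_iff.1 x.2).1

/-- The action of `SU(n+1)` on `ℂⁿ⁺¹`. -/
noncomputable def act (x : SU n) : Cn (n + 1) →L[ℂ] Cn (n + 1) :=
  Matrix.toEuclideanCLM (n := Fin (n + 1)) (𝕜 := ℂ) x.1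

theorem act_apply (x : SU n) (z : Cn (n + 1)) (k : Fin (n + 1)) :
    act x z k = ∑ j, x.1 k j * z j := rfl

theorem act_mul (x y : SU n) (z : Cn (n + 1)) : act (x * y) z = act x (act y z) := by
  have h : act (x * y) = act x * act y := map_mul (Matrix.toEuclideanCLM (𝕜 := ℂ)) x.1 y.1
  rw [h]
  rfl

theorem act_one (z : Cn (n + 1)) : act 1 z = z := by
  have h : act (1 : SU n) = 1 := map_one (Matrix.toEuclideanCLM (𝕜 := ℂ))
  rw [h]
  rfl

theorem inner_act (x : SU n) (v w : Cn (n + 1)) : inner ℂ (act x v) (act x w) = inner ℂ v w := by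
  have h : star (act x) * act x = 1 := by
    have := congrArg (Matrix.toEuclideanCLM (n := Fin (n + 1)) (𝕜 := ℂ)) (SU.star_mul_self x)
    rwa [map_mul, map_star, map_one] at this
  rw [← ContinuousLinearMap.adjoint_inner_right, ← ContinuousLinearMap.star_eq_adjoint]
  exact congrArg (inner ℂ v) (DFunLike.congr_fun h w)

theorem norm_act (x : SU n) (v : Cn (n + 1)) : ‖act x v‖ = ‖v‖ := by
  rw [@norm_eq_sqrt_re_inner ℂ, @norm_eq_sqrt_re_inner ℂ, inner_act]

theorem act_injective (x : SU n) : Function.Injective (act x) := by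
  rw [injective_iff_map_eq_zero]
  intro v hv
  rw [← norm_eq_zero, ← norm_act x, hv, norm_zero]

theorem act_ne_zero (x : SU n) {v : Cn (n + 1)} (hv : v ≠ 0) : act x v ≠ 0 :=
  fun h => hv (act_injective x (by rw [h, map_zero]))

theorem act_single (x : SU n) (j : Fin (n + 1)) :
    act x (EuclideanSpace.single j 1) = WithLp.toLp 2 fun k => x.1 k j := by
  ext k
  simp [act_apply]

theorem act_single_zero (x : SU n) : act x (EuclideanSpace.single 0 1) = firstColumn x :=
  act_single x 0

theorem firstColumn_mul (x y : SU n) : firstColumn (x * y) = act x (firstColumn y) := by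
  rw [← act_single_zero, act_mul, act_single_zero]

theorem norm_firstColumn (x : SU n) : ‖firstColumn x‖ = 1 := by
  rw [← act_single_zero, norm_act]
  simp

theorem hermForm_act (x : SU n) (z v w : Cn (n + 1)) :
    hermForm (act x z) (act x v) (act x w) = hermForm z v w := by
  simp [hermForm, norm_act, inner_act]

/-- Every orthonormal system is, up to a common phase, part of the image of the standard basis
under an element of `SU(n+1)`. -/
theorem exists_act_single_eq {v : Fin (n + 1) → Cn (n + 1)} {s : Set (Fin (n + 1))}
    (hv : Orthonormal ℂ (s.domRestrict v)) :
    ∃ (a : SU n) (c : ℂ), c ≠ 0 ∧ ∀ i ∈ s, act a (EuclideanSpace.single i 1) = c • v i := by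
  obtain ⟨b, hb⟩ := hv.exists_orthonormalBasis_extension_of_card_eq (by simp)
  set B : Matrix (Fin (n + 1)) (Fin (n + 1)) ℂ := Matrix.of fun k j => b j k with hB
  have hBu : star B * B = 1 := by
    ext i j
    have h := orthonormal_iff_ite.1 b.orthonormal i j
    rw [PiLp.inner_apply] at h
    rw [Matrix.mul_apply, Matrix.one_apply, ← h]
    refine Finset.sum_congr rfl fun k _ => ?_
    simp [hB, Matrix.star_apply, mul_comm]
  have hd : star B.det * B.det = 1 := by
    have := congrArg Matrix.det hBu
    rwa [Matrix.det_mul, Matrix.star_eq_conjTranspose, Matrix.det_conjTranspose,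
      Matrix.det_one] at this
  have hd0 : B.det ≠ 0 := right_ne_zero_of_mul_eq_one hd
  -- An `(n+1)`-st root of `(det B)⁻¹` rescales the unitary matrix `B` to determinant one; it has
  -- modulus one and is the common phase.
  obtain ⟨c, hc⟩ := IsAlgClosed.exists_pow_nat_eq (B.det)⁻¹ (Nat.succ_pos n)
  have hc0 : c ≠ 0 := by
    rintro rfl
    rw [zero_pow (Nat.succ_ne_zero n)] at hc
    exact inv_ne_zero hd0 hc.symm
  have hcn : star c * c = 1 := by
    have h1 : ‖B.det‖ = 1 := by
      have := congrArg norm hd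
      rw [norm_mul, norm_star, norm_one] at this
      nlinarith [norm_nonneg B.det]
    have h2 : ‖c‖ ^ (n + 1) = 1 := by rw [← norm_pow, hc, norm_inv, h1, inv_one]
    have h3 : ‖c‖ = 1 := (pow_eq_one_iff_of_nonneg (norm_nonneg c) (Nat.succ_ne_zero n)).1 h2
    have h4 := Complex.conj_mul' c
    rw [h3] at h4
    simpa using h4
  refine ⟨⟨c • B, Matrix.mem_specialUnitaryGroup_iff.2 ⟨Matrix.mem_unitaryGroup_iff'.2 ?_, ?_⟩⟩,
    c, hc0, fun i hi => ?_⟩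
  · rw [star_smul, smul_mul_smul_comm, hBu, hcn, one_smul]
  · rw [Matrix.det_smul, Fintype.card_fin, hc, inv_mul_cancel₀ hd0]
  · rw [act_single, ← hb i hi]
    ext k
    simp [hB]

/-! ### The map to projective space -/

theorem homMap_mk (x : SU n) : homMap n (x : HomSpace n) = proj n (firstColumn x) :=
  (proj_of_ne (firstColumn_ne_zero x)).symm

theorem homMap_injective : Function.Injective (homMap n) := by
  intro c d h
  induction c using Quotient.inductionOn with | _ x
  induction d using Quotient.inductionOn with | _ y
  obtain ⟨r, hr⟩ := (Projectivization.mk_eq_mk_iff' ℂ _ _ (firstColumn_ne_zero x)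
    (firstColumn_ne_zero y)).1 h
  have h1 : firstColumn (y⁻¹ * x) = r • EuclideanSpace.single 0 1 := by
    rw [firstColumn_mul, ← hr, map_smul, ← firstColumn_mul, inv_mul_cancel, ← act_single_zero,
      act_one]
  have h2 : ∀ j : Fin n, (y⁻¹ * x).1 j.succ 0 = 0 := fun j => by
    have := congrArg (fun v : Cn (n + 1) => v j.succ) h1
    simpa [firstColumn, -Submonoid.coe_mul] using this
  have h3 : (y⁻¹ * x).1 0 0 ≠ 0 := by
    intro h0
    refine firstColumn_ne_zero (y⁻¹ * x) ?_
    ext k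
    refine Fin.cases h0 h2 k
  -- The first column is a nonzero multiple of the first basis vector, and the other columns are
  -- orthogonal to it.
  have h4 : ∀ j : Fin n, (y⁻¹ * x).1 0 j.succ = 0 := fun j => by
    have := congrFun (congrFun (SU.star_mul_self (y⁻¹ * x)) 0) j.succ
    rw [Matrix.mul_apply, Fin.sum_univ_succ, Matrix.one_apply_ne (Fin.succ_ne_zero j).symm] at this
    simp only [Matrix.star_apply, h2, star_zero, zero_mul, Finset.sum_const_zero, add_zero] at this
    exact (mul_eq_zero.1 this).resolve_left (star_ne_zero.2 h3)
  have h5 : y⁻¹ * x ∈ blockSubgroup n := fun j => ⟨h4 j, h2 j⟩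
  exact (QuotientGroup.eq.2 h5).symm

theorem exists_proj_firstColumn_eq (p : CP n) : ∃ x : SU n, proj n (firstColumn x) = p := by
  obtain ⟨z, hz, rfl⟩ := exists_proj_eq p
  obtain ⟨a, c, hc, h⟩ := exists_act_single_eq (v := fun _ : Fin (n + 1) => z) (s := {0})
    ⟨fun _ => hz, fun i j hij => (hij (Subsingleton.elim i j)).elim⟩
  refine ⟨a, ?_⟩
  rw [← act_single_zero, h 0 rfl, proj_smul hc (norm_ne_zero_iff.1 (by simp [hz]))]

theorem homMap_bijective : Function.Bijective (homMap n) := by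
  refine ⟨homMap_injective, fun p => ?_⟩
  obtain ⟨x, hx⟩ := exists_proj_firstColumn_eq p
  exact ⟨x, (homMap_mk x).trans hx⟩

/-! ### Exponentials of off-diagonal skew-Hermitian matrices -/

/-- The skew-Hermitian matrix with first column `(0, w)` and vanishing lower right block. -/
noncomputable def offDiag : Cn n →ₗ[ℝ] Matrix (Fin (n + 1)) (Fin (n + 1)) ℂ where
  toFun w := Matrix.of (Fin.cons (Fin.cons 0 fun j => -star (w j)) fun k => Fin.cons (w k) 0)
  map_add' v w := by
    ext i j
    refine Fin.cases ?_ (fun i => ?_) i <;> refine Fin.cases ?_ (fun j => ?_) j <;>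
      simp [add_comm]
  map_smul' r w := by
    ext i j
    refine Fin.cases ?_ (fun i => ?_) i <;> refine Fin.cases ?_ (fun j => ?_) j <;> simp

theorem offDiag_zero_zero (w : Cn n) : offDiag w 0 0 = 0 := rfl
theorem offDiag_zero_succ (w : Cn n) (j : Fin n) : offDiag w 0 j.succ = -star (w j) := rfl
theorem offDiag_succ_zero (w : Cn n) (k : Fin n) : offDiag w k.succ 0 = w k := rfl
theorem offDiag_succ_succ (w : Cn n) (k j : Fin n) : offDiag w k.succ j.succ = 0 := rfl

theorem offDiag_column (w : Cn n) : (WithLp.toLp 2 fun k => offDiag w k 0) = slot 0 w := by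
  ext k
  refine Fin.cases ?_ (fun k => ?_) k
  · simp [offDiag_zero_zero]
  · have := slot_succAbove (0 : Fin (n + 1)) w k
    rw [Fin.succAbove_zero] at this
    rw [this]
    exact offDiag_succ_zero w k

theorem conjTranspose_offDiag (w : Cn n) : (offDiag w).conjTranspose = -offDiag w := by
  ext i j
  refine Fin.cases ?_ (fun i => ?_) i <;> refine Fin.cases ?_ (fun j => ?_) j <;>
    simp [offDiag_zero_zero, offDiag_zero_succ, offDiag_succ_zero, offDiag_succ_succ]

/-- Conjugation by `diag(1, -1, …, -1)` changes the sign of an off-diagonal matrix. -/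
theorem det_exp_offDiag_neg (w : Cn n) :
    (NormedSpace.exp (-offDiag w)).det = (NormedSpace.exp (offDiag w)).det := by
  set D : Matrix (Fin (n + 1)) (Fin (n + 1)) ℂ := Matrix.diagonal (Fin.cons 1 fun _ => -1) with hD
  have hDD : D * D = 1 := by
    rw [hD, Matrix.diagonal_mul_diagonal, ← Matrix.diagonal_one]
    congr 1
    ext k
    refine Fin.cases ?_ (fun k => ?_) k <;> simp
  have hDi : D⁻¹ = D := Matrix.inv_eq_left_inv hDD
  have hconj : D * offDiag w * D⁻¹ = -offDiag w := by
    rw [hDi]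
    ext i j
    rw [hD, Matrix.mul_diagonal, Matrix.diagonal_mul]
    refine Fin.cases ?_ (fun i => ?_) i <;> refine Fin.cases ?_ (fun j => ?_) j <;>
      simp [offDiag_zero_zero, offDiag_zero_succ, offDiag_succ_zero, offDiag_succ_succ]
  have hu : IsUnit D := IsUnit.of_mul_eq_one D hDD
  rw [← hconj, Matrix.exp_conj D _ hu, Matrix.det_conj hu]

/-- Since `exp(A)` and `exp(-A)` are inverse and have equal determinant, `(det exp A)² = 1`. Applied
to `A/2`, this determines `det exp A` itself, with no sign ambiguity. -/
theorem det_exp_offDiag (w : Cn n) : (NormedSpace.exp (offDiag w)).det = 1 := by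
  have h1 (v : Cn n) : (NormedSpace.exp (offDiag v)).det ^ 2 = 1 := by
    have h := Matrix.exp_add_of_commute (offDiag v) (-offDiag v) (Commute.neg_right rfl)
    rw [add_neg_cancel, NormedSpace.exp_zero] at h
    have := congrArg Matrix.det h
    rw [Matrix.det_one, Matrix.det_mul, det_exp_offDiag_neg] at this
    rw [sq, ← this]
  have h2 : offDiag w = (2 : ℕ) • offDiag ((1 / 2 : ℝ) • w) := by
    rw [← map_nsmul, ← Nat.cast_smul_eq_nsmul ℝ, smul_smul]
    norm_num
  rw [h2, Matrix.exp_nsmul, Matrix.det_pow, h1]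

/-- The exponential map at the base point, along the complement of the isotropy algebra. -/
noncomputable def expSU (w : Cn n) : SU n :=
  ⟨NormedSpace.exp (offDiag w), Matrix.mem_specialUnitaryGroup_iff.2
    ⟨Matrix.mem_unitaryGroup_iff'.2 (by
      rw [Matrix.star_eq_conjTranspose, ← Matrix.exp_conjTranspose, conjTranspose_offDiag,
        ← Matrix.exp_add_of_commute (-offDiag w) _ (Commute.neg_left rfl), neg_add_cancel,
        NormedSpace.exp_zero]), det_exp_offDiag w⟩⟩

theorem expSU_zero : expSU (0 : Cn n) = 1 := by
  refine Subtype.ext ?_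
  simp [expSU]

end SpecialUnitary

/-! ### Smoothness of the exponential -/

section Smooth

attribute [local instance] Matrix.linftyOpNormedRing Matrix.linftyOpNormedAlgebra

variable {n : ℕ}

/-- Stated entry by entry because the exponential is differentiated in an algebra norm on matrices,
whereas `IsSmoothIntoSU` uses the entrywise sup norm. -/
theorem contDiff_expSU_apply (i j : Fin (n + 1)) :
    ContDiff ℝ ∞ (fun w : Cn n => (expSU w).1 i j) := by
  have h1 : ContDiff ℝ ∞ (fun w : Cn n => NormedSpace.exp (offDiag w)) :=
    ContDiff.comp (g := NormedSpace.exp)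
      (contDiff_iff_contDiffAt.2 fun x => (NormedSpace.exp_analytic (𝕂 := ℝ) x).contDiffAt)
      (LinearMap.toContinuousLinearMap offDiag).contDiff
  exact (LinearMap.toContinuousLinearMap
    (Matrix.entryLinearMap ℝ ℂ i j :
      Matrix (Fin (n + 1)) (Fin (n + 1)) ℂ →ₗ[ℝ] ℂ)).contDiff.comp h1

theorem hasFDerivAt_expSU_apply (i j : Fin (n + 1)) :
    HasFDerivAt (fun w : Cn n => (expSU w).1 i j)
      (LinearMap.toContinuousLinearMap ((Matrix.entryLinearMap ℝ ℂ i j :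
      Matrix (Fin (n + 1)) (Fin (n + 1)) ℂ →ₗ[ℝ] ℂ) ∘ₗ offDiag)) 0 := by
  have h0 : HasFDerivAt (𝕜 := ℝ) NormedSpace.exp
      (1 : Matrix (Fin (n + 1)) (Fin (n + 1)) ℂ →L[ℝ] _)
      (LinearMap.toContinuousLinearMap offDiag (0 : Cn n)) := by
    rw [map_zero]
    exact hasFDerivAt_exp_zero
  exact (LinearMap.toContinuousLinearMap
    (Matrix.entryLinearMap ℝ ℂ i j :
      Matrix (Fin (n + 1)) (Fin (n + 1)) ℂ →ₗ[ℝ] ℂ)).hasFDerivAt.comp (0 : Cn n)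
    (h0.comp (0 : Cn n) (LinearMap.toContinuousLinearMap offDiag).hasFDerivAt)

end Smooth

/-! ### Smooth maps into the special unitary group -/

section SmoothMaps

variable {n : ℕ} {V : Type*} [NormedAddCommGroup V] [NormedSpace ℝ V]

attribute [local instance] Matrix.normedAddCommGroup Matrix.normedSpace

theorem isSmoothIntoSU_iff {γ : V → SU n} :
    IsSmoothIntoSU γ ↔ ∀ i j, ContDiff ℝ ∞ (fun s => (γ s).1 i j) := by
  refine Iff.trans (contDiff_pi (𝕜 := ℝ) (n := ∞)
    (Φ := fun s => ((γ s).1 : Fin (n + 1) → Fin (n + 1) → ℂ))) ?_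
  exact forall_congr' fun i => contDiff_pi (Φ := fun s => (γ s).1 i)

end SmoothMaps

section SmoothMaps

variable {n : ℕ} {V : Type*} [NormedAddCommGroup V] [NormedSpace ℝ V]

theorem contDiff_firstColumn {γ : V → SU n} (hγ : IsSmoothIntoSU γ) :
    ContDiff ℝ ∞ (fun s => firstColumn (γ s)) :=
  (contDiff_piLp 2).2 fun k => isSmoothIntoSU_iff.1 hγ k 0

theorem contMDiff_proj_firstColumn {γ : V → SU n} (hγ : IsSmoothIntoSU γ) :
    ContMDiff 𝓘(ℝ, V) 𝓘(ℝ, Cn n) ∞ (fun s => proj n (firstColumn (γ s))) := fun s =>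
  ContMDiffAt.comp (g := proj n) s (contMDiffAt_proj (firstColumn_ne_zero (γ s)))
    ((contDiff_firstColumn hγ).contMDiff s)

theorem isSmoothIntoSU_mul_expSU (x : SU n) {f : V → Cn n} (hf : ContDiff ℝ ∞ f) :
    IsSmoothIntoSU (fun s => x * expSU (f s)) := by
  rw [isSmoothIntoSU_iff]
  intro i j
  simp only [Submonoid.coe_mul, Matrix.mul_apply]
  exact ContDiff.sum fun k _ => contDiff_const.mul ((contDiff_expSU_apply k j).comp hf)

theorem hasFDerivAt_firstColumn_expSU :
    HasFDerivAt (fun w : Cn n => firstColumn (expSU w)) ((slot 0).restrictScalars ℝ) 0 := by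
  rw [← hasFDerivWithinAt_univ, hasFDerivWithinAt_piLp]
  intro k
  rw [hasFDerivWithinAt_univ]
  refine (hasFDerivAt_expSU_apply k 0).congr_fderiv ?_
  ext w
  exact congrArg (fun v : Cn (n + 1) => v k) (offDiag_column w)

theorem hasFDerivAt_firstColumn_mul_expSU (x : SU n) :
    HasFDerivAt (fun w : Cn n => firstColumn (x * expSU w))
      ((act x).restrictScalars ℝ ∘L (slot 0).restrictScalars ℝ) 0 := by
  have h : (fun w : Cn n => firstColumn (x * expSU w)) =
      (act x).restrictScalars ℝ ∘ fun w => firstColumn (expSU w) :=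
    funext fun w => firstColumn_mul x (expSU w)
  rw [h]
  exact ((act x).restrictScalars ℝ).hasFDerivAt.comp 0 hasFDerivAt_firstColumn_expSU

end SmoothMaps


/-! ### Local sections of the projection of the special unitary group -/

section Sections

variable {n : ℕ}

theorem exists_slot_zero_eq {v : Cn (n + 1)} (hv : v 0 = 0) : ∃ w : Cn n, slot 0 w = v := by
  refine ⟨WithLp.toLp 2 fun j => v j.succ, ?_⟩
  ext k
  refine Fin.cases ?_ (fun k => ?_) k
  · simp [hv]
  · have := slot_succAbove (0 : Fin (n + 1)) (WithLp.toLp 2 fun j => v j.succ : Cn n) k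
    rwa [Fin.succAbove_zero] at this

/-- The differential at `0` of `w ↦ [x · exp w · m]`. -/
noncomputable def orbitDeriv (x : SU n) : Cn n →L[ℝ] Cn n :=
  (mfderiv 𝓘(ℝ, Cn (n + 1)) 𝓘(ℝ, Cn n) (proj n) (firstColumn x) : Cn (n + 1) →L[ℝ] Cn n) ∘L
    ((act x).restrictScalars ℝ ∘L (slot 0).restrictScalars ℝ)

/-- A horizontal lift `v` of the tangent vector is orthogonal to `x e₀`, so `x⁻¹ v` is orthogonal to
`e₀` and is the first column of an off-diagonal matrix. -/
theorem orbitDeriv_surjective (x : SU n) : Function.Surjective (orbitDeriv x) := by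
  intro u
  obtain ⟨v, hv, rfl⟩ := exists_mfderiv_proj_eq (norm_firstColumn x) u
  have hv' : act x (act x⁻¹ v) = v := by rw [← act_mul, mul_inv_cancel, act_one]
  have h0 : act x⁻¹ v 0 = 0 := by
    have h1 : inner ℂ (EuclideanSpace.single 0 1) (act x⁻¹ v) = 0 := by
      rw [← inner_act x, hv', act_single_zero, hv]
    simpa [EuclideanSpace.inner_single_left] using h1
  obtain ⟨w, hw⟩ := exists_slot_zero_eq h0
  refine ⟨w, ?_⟩
  have h2 : act x (slot 0 w) = v := by rw [hw, hv']
  exact congrArg (mfderiv 𝓘(ℝ, Cn (n + 1)) 𝓘(ℝ, Cn n) (proj n) (firstColumn x) :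
    Cn (n + 1) →L[ℝ] Cn n) h2

theorem bijective_of_surjective {E : Type*} [NormedAddCommGroup E] [NormedSpace ℝ E]
    [FiniteDimensional ℝ E] {D : E →L[ℝ] E} (h : Function.Surjective D) : Function.Bijective D :=
  ⟨(LinearMap.injective_iff_surjective (f := (D : E →ₗ[ℝ] E))).2 h, h⟩

/-- The linear map `A` allows two parameter spaces: `ℝᵏ` for local lifts and `ℝ` for curves with
prescribed velocity. -/
theorem hasMFDerivAt_proj_orbit (x : SU n) {V : Type*} [NormedAddCommGroup V] [NormedSpace ℝ V]
    (A : V →L[ℝ] Cn n) :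
    HasMFDerivAt 𝓘(ℝ, V) 𝓘(ℝ, Cn n) (fun s => proj n (firstColumn (x * expSU (A s)))) 0
      (orbitDeriv x ∘L A : V →L[ℝ] Cn n) := by
  have hx : firstColumn (x * expSU (A 0)) = firstColumn x := by rw [map_zero, expSU_zero, mul_one]
  have h1 : HasFDerivAt (fun s => firstColumn (x * expSU (A s)))
      (((act x).restrictScalars ℝ ∘L (slot 0).restrictScalars ℝ) ∘L A) 0 := by
    have h := hasFDerivAt_firstColumn_mul_expSU x
    rw [← map_zero A] at h
    exact h.comp 0 A.hasFDerivAt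
  have h2 : HasMFDerivAt 𝓘(ℝ, Cn (n + 1)) 𝓘(ℝ, Cn n) (proj n) (firstColumn (x * expSU (A 0)))
      (mfderiv 𝓘(ℝ, Cn (n + 1)) 𝓘(ℝ, Cn n) (proj n) (firstColumn x) :
        Cn (n + 1) →L[ℝ] Cn n) := by
    rw [hx]
    exact (hasMFDerivAt_proj (firstColumn_ne_zero x)).mdifferentiableAt.hasMFDerivAt
  have h3 : HasMFDerivAt 𝓘(ℝ, V) 𝓘(ℝ, Cn n) (fun s => proj n (firstColumn (x * expSU (A s)))) 0
      ((mfderiv 𝓘(ℝ, Cn (n + 1)) 𝓘(ℝ, Cn n) (proj n) (firstColumn x) :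
        Cn (n + 1) →L[ℝ] Cn n) ∘L
        (((act x).restrictScalars ℝ ∘L (slot 0).restrictScalars ℝ) ∘L A) : V →L[ℝ] Cn n) :=
    HasMFDerivAt.comp (g := proj n) (0 : V) h2 h1.hasMFDerivAt
  have h4 : orbitDeriv x ∘L A = _ := ContinuousLinearMap.comp_assoc _ _ A
  rw [h4]
  exact h3

/-- Near each point, the inverse of `homMap` lifts to a smooth map into `SU(n+1)` that factors
through a Euclidean space. -/
theorem exists_local_lift (x : SU n) :
    ∃ (k : ℕ) (γ : EuclideanSpace ℝ (Fin k) → SU n) (L : CP n → EuclideanSpace ℝ (Fin k)),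
      IsSmoothIntoSU γ ∧
      ContMDiffAt 𝓘(ℝ, Cn n) 𝓘(ℝ, EuclideanSpace ℝ (Fin k)) ∞ L (homMap n x) ∧
      ∀ᶠ q in 𝓝 (homMap n x), homMap n (γ (L q) : HomSpace n) = q := by
  -- A homogeneous structure tests smoothness along maps from `ℝᵏ` only, so `ℂⁿ` is replaced by a
  -- Euclidean space of the same real dimension.
  set k := Module.finrank ℝ (Cn n)
  have hk : Module.finrank ℝ (EuclideanSpace ℝ (Fin k)) = Module.finrank ℝ (Cn n) := by
    rw [finrank_euclideanSpace_fin]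
  set e : EuclideanSpace ℝ (Fin k) ≃L[ℝ] Cn n := ContinuousLinearEquiv.ofFinrankEq hk
  set γ : EuclideanSpace ℝ (Fin k) → SU n := fun s => x * expSU (e s)
  have hγ : IsSmoothIntoSU γ := isSmoothIntoSU_mul_expSU x e.contDiff
  have hd := hasMFDerivAt_proj_orbit x (e : EuclideanSpace ℝ (Fin k) →L[ℝ] Cn n)
  have hbij : Function.Bijective (mfderiv 𝓘(ℝ, EuclideanSpace ℝ (Fin k)) 𝓘(ℝ, Cn n)
      (fun s => proj n (firstColumn (γ s))) 0) := by
    rw [show mfderiv 𝓘(ℝ, EuclideanSpace ℝ (Fin k)) 𝓘(ℝ, Cn n)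
      (fun s => proj n (firstColumn (γ s))) 0 = _ from hd.mfderiv]
    exact (bijective_of_surjective (orbitDeriv_surjective x)).comp e.bijective
  obtain ⟨L, hL, -, hLe⟩ := exists_contMDiffAt_rightInverse (contMDiff_proj_firstColumn hγ 0) hbij
  have h0 : proj n (firstColumn (γ 0)) = homMap n x := by
    rw [homMap_mk]
    simp [γ, expSU_zero]
  rw [h0] at hL hLe
  exact ⟨k, γ, L, hγ, hL, hLe.mono fun q hq => (homMap_mk _).trans hq⟩

/-- The inverse of `homMap`. -/
noncomputable def homInv (n : ℕ) : CP n → HomSpace n :=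
  (Equiv.ofBijective (homMap n) homMap_bijective).symm

theorem homInv_homMap (c : HomSpace n) : homInv n (homMap n c) = c :=
  (Equiv.ofBijective (homMap n) homMap_bijective).symm_apply_apply c

theorem homInv_proj_firstColumn (x : SU n) : homInv n (proj n (firstColumn x)) = x := by
  rw [← homMap_mk, homInv_homMap]

theorem homInv_bijective : Function.Bijective (homInv n) :=
  (Equiv.ofBijective (homMap n) homMap_bijective).symm.bijective

theorem continuous_of_isSmoothIntoSU {V : Type*} [NormedAddCommGroup V] [NormedSpace ℝ V]
    {γ : V → SU n} (hγ : IsSmoothIntoSU γ) : Continuous γ :=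
  Continuous.subtype_mk (continuous_pi fun i => continuous_pi fun j =>
    (isSmoothIntoSU_iff.1 hγ i j).continuous) _

theorem continuous_homMap : Continuous (homMap n) := by
  refine continuous_quot_lift _ ?_
  rw [continuous_iff_continuousAt]
  intro x
  have h : Continuous (firstColumn (n := n)) := by
    refine (PiLp.continuous_toLp 2 _).comp (continuous_pi fun k => ?_)
    exact (continuous_apply_apply k 0).comp continuous_subtype_val
  refine ((continuousAt_proj (firstColumn_ne_zero x)).comp h.continuousAt).congr ?_
  exact Eventually.of_forall fun y => proj_of_ne (firstColumn_ne_zero y)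

theorem eventually_homInv_eq {x : SU n} {k : ℕ} {γ : EuclideanSpace ℝ (Fin k) → SU n}
    {L : CP n → EuclideanSpace ℝ (Fin k)}
    (h : ∀ᶠ q in 𝓝 (homMap n x), homMap n (γ (L q) : HomSpace n) = q) :
    homInv n =ᶠ[𝓝 (homMap n x)] fun q => (γ (L q) : HomSpace n) :=
  h.mono fun _ hq => (congrArg (homInv n) hq).symm.trans (homInv_homMap _)

theorem continuous_homInv : Continuous (homInv n) := by
  rw [continuous_iff_continuousAt]
  intro p
  obtain ⟨c, rfl⟩ := homMap_bijective.2 p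
  induction c using Quotient.inductionOn with | _ x
  obtain ⟨k, γ, L, hγ, hL, h⟩ := exists_local_lift x
  refine ContinuousAt.congr ?_ (eventually_homInv_eq h).symm
  exact (continuous_quot_mk.comp (continuous_of_isSmoothIntoSU hγ)).continuousAt.comp
    hL.continuousAt

variable (n) in
/-- `homMap` as a homeomorphism. -/
noncomputable def homHomeomorph : HomSpace n ≃ₜ CP n where
  toEquiv := Equiv.ofBijective (homMap n) homMap_bijective
  continuous_toFun := continuous_homMap
  continuous_invFun := continuous_homInv

end Sections

/-! ### Transport of an atlas along a homeomorphism -/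

section Transport

variable {E : Type*} [NormedAddCommGroup E] {M N : Type*} [TopologicalSpace M]
  [TopologicalSpace N] [ChartedSpace E N]

/-- The atlas of `M` transported from `N` along a homeomorphism. -/
noncomputable abbrev transportCharts (Ψ : M ≃ₜ N) : ChartedSpace E M where
  atlas := (fun e => Ψ.toOpenPartialHomeomorph.trans e) '' atlas E N
  chartAt p := Ψ.toOpenPartialHomeomorph.trans (chartAt E (Ψ p))
  mem_chart_source p := by simp
  chart_mem_atlas p := Set.mem_image_of_mem _ (chart_mem_atlas E (Ψ p))

theorem chartAt_transportCharts_symm (Ψ : M ≃ₜ N) (q : N) :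
    (transportCharts Ψ).chartAt (Ψ.symm q) =
      Ψ.toOpenPartialHomeomorph.trans (chartAt E q) := by
  show Ψ.toOpenPartialHomeomorph.trans (chartAt E (Ψ (Ψ.symm q))) = _
  rw [Ψ.apply_symm_apply]

variable [NormedSpace ℝ E]

theorem isManifold_transportCharts [IsManifold 𝓘(ℝ, E) ∞ N] (Ψ : M ≃ₜ N) :
    @IsManifold ℝ _ E _ _ E _ 𝓘(ℝ, E) ∞ M _ (transportCharts Ψ) := by
  let _ := transportCharts (E := E) Ψ
  refine isManifold_of_contDiffOn 𝓘(ℝ, E) ∞ M ?_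
  rintro _ _ ⟨e, he, rfl⟩ ⟨e', he', rfl⟩
  have h := (contDiffGroupoid ∞ 𝓘(ℝ, E)).compatible he he'
  rw [contDiffGroupoid, mem_groupoid_of_pregroupoid] at h
  replace h : ContDiffOn ℝ ∞ _ _ := h.1
  refine h.congr_mono (fun y _ => ?_) fun y hy => ?_
  · simp
  · simpa using hy

theorem contMDiff_symm_transportCharts [IsManifold 𝓘(ℝ, E) ∞ N] (Ψ : M ≃ₜ N) :
    @ContMDiff ℝ _ E _ _ E _ 𝓘(ℝ, E) N _ _ E _ _ E _ 𝓘(ℝ, E) M _ (transportCharts Ψ) ∞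
      Ψ.symm := by
  let _ := transportCharts (E := E) Ψ
  intro q
  rw [contMDiffAt_iff_target]
  refine ⟨Ψ.symm.continuous.continuousAt, ?_⟩
  have h : (extChartAt 𝓘(ℝ, E) (Ψ.symm q) ∘ Ψ.symm : N → E) = extChartAt 𝓘(ℝ, E) q := by
    ext y
    show chartAt E (Ψ.symm q) (Ψ.symm y) = chartAt E q y
    rw [show chartAt E (Ψ.symm q) = _ from chartAt_transportCharts_symm Ψ q]
    simp
  rw [h]
  exact contMDiffAt_extChartAt

/-- The transported chart at `Ψ.symm q` is the chart at `q` after `Ψ`, so `Ψ.symm` reads as the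
identity in charts. -/
theorem hasMFDerivAt_symm_transportCharts (Ψ : M ≃ₜ N) (q : N) :
    @HasMFDerivAt ℝ _ E _ _ E _ 𝓘(ℝ, E) N _ _ E _ _ E _ 𝓘(ℝ, E) M _ (transportCharts Ψ)
      Ψ.symm q (ContinuousLinearMap.id ℝ E) := by
  let _ := transportCharts (E := E) Ψ
  refine (hasMFDerivAt_iff_chart _).2 ⟨Ψ.symm.continuous.continuousAt, ?_⟩
  refine (hasFDerivAt_id _).congr_of_eventuallyEq ?_
  filter_upwards [(chartAt E q).open_target.mem_nhds (mem_chart_target E q)] with y hy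
  rw [show chartAt E (Ψ.symm q) = _ from chartAt_transportCharts_symm Ψ q]
  simp [hy]

end Transport

/-! ### Smooth structures of the homogeneous space -/

section Structure

variable {n : ℕ}

/-- The atlas of projective space is transported along `homHomeomorph`; the curves `s ↦ x exp(s w)`
realize all tangent vectors by `orbitDeriv_surjective`. -/
theorem exists_isHomogeneousStructure (n : ℕ) :
    ∃ _ : ChartedSpace (Cn n) (HomSpace n), IsHomogeneousStructure n := by
  let _ := transportCharts (E := Cn n) (homHomeomorph n)
  have hmk : ∀ x : SU n, (x : HomSpace n) = (homHomeomorph n).symm (proj n (firstColumn x)) :=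
    fun x => (homInv_proj_firstColumn x).symm
  refine ⟨_, isManifold_transportCharts _, fun k γ hγ => ?_, fun x u => ?_⟩
  · simp only [hmk]
    exact (contMDiff_symm_transportCharts (homHomeomorph n)).comp (contMDiff_proj_firstColumn hγ)
  · obtain ⟨w, hw⟩ := orbitDeriv_surjective x u
    set A : ℝ →L[ℝ] Cn n := (ContinuousLinearMap.id ℝ ℝ).smulRight w
    refine ⟨fun s => x * expSU (A s), isSmoothIntoSU_mul_expSU x A.contDiff, ?_, ?_⟩
    · simp [expSU_zero]
    · have h := HasMFDerivAt.comp (g := (homHomeomorph n).symm) (0 : ℝ)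
        (hasMFDerivAt_symm_transportCharts (homHomeomorph n) _) (hasMFDerivAt_proj_orbit x A)
      have h' : HasMFDerivAt 𝓘(ℝ, ℝ) 𝓘(ℝ, Cn n)
          (fun s => ((x * expSU (A s) : SU n) : HomSpace n)) 0
          (ContinuousLinearMap.id ℝ (Cn n) ∘L (orbitDeriv x ∘L A) : ℝ →L[ℝ] Cn n) := by
        rw [show (fun s => ((x * expSU (A s) : SU n) : HomSpace n)) = _ from
          funext fun s => hmk (x * expSU (A s))]
        exact h
      refine (DFunLike.congr_fun h'.mfderiv (1 : ℝ)).trans ?_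
      have hA : A 1 = w := by simp [A]
      exact (congrArg (orbitDeriv x) hA).trans hw

variable [ChartedSpace (Cn n) (HomSpace n)]

/-- The hypothesis on the atlas controls classes of smooth maps into `SU(n+1)`, hence maps into
`G/H`. So the inverse is the accessible direction: locally it is the class of the lift `γ ∘ L`. -/
theorem contMDiff_homInv (hs : IsHomogeneousStructure n) :
    ContMDiff 𝓘(ℝ, Cn n) 𝓘(ℝ, Cn n) ∞ (homInv n) := by
  intro p
  obtain ⟨c, rfl⟩ := homMap_bijective.2 p
  induction c using Quotient.inductionOn with | _ x
  obtain ⟨k, γ, L, hγ, hL, h⟩ := exists_local_lift x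
  refine ContMDiffAt.congr_of_eventuallyEq ?_ (eventually_homInv_eq h)
  exact (hs.smooth k γ hγ).contMDiffAt.comp _ hL

/-- A tangent vector of `G/H` is the velocity of the class of a curve in `SU(n+1)`, and that class
is `homInv` applied to a smooth curve in projective space. -/
theorem mfderiv_homInv_surjective (hs : IsHomogeneousStructure n) (p : CP n) :
    Function.Surjective (mfderiv 𝓘(ℝ, Cn n) 𝓘(ℝ, Cn n) (homInv n) p : Cn n →L[ℝ] Cn n) := by
  intro u
  obtain ⟨x, rfl⟩ := exists_proj_firstColumn_eq p
  obtain ⟨γ, hγ, rfl, hu⟩ := hs.submersion x u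
  have h1 : (fun s => (γ s : HomSpace n)) = homInv n ∘ fun s => proj n (firstColumn (γ s)) :=
    funext fun s => (homInv_proj_firstColumn (γ s)).symm
  have h2 := mfderiv_comp (0 : ℝ) ((contMDiff_homInv hs _).mdifferentiableAt (by simp))
    ((contMDiff_proj_firstColumn hγ 0).mdifferentiableAt (by simp))
  refine ⟨(mfderiv 𝓘(ℝ, ℝ) 𝓘(ℝ, Cn n) (fun s => proj n (firstColumn (γ s))) 0 :
    ℝ →L[ℝ] Cn n) 1, ?_⟩
  rw [← hu]
  refine (DFunLike.congr_fun h2 (1 : ℝ)).symm.trans ?_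
  rw [h1]
  rfl

theorem exists_diffeomorph_homMap [IsManifold 𝓘(ℝ, Cn n) ∞ (HomSpace n)]
    (hs : IsHomogeneousStructure n) :
    ∃ Φ : Diffeomorph 𝓘(ℝ, Cn n) 𝓘(ℝ, Cn n) (HomSpace n) (CP n) ∞, ⇑Φ = homMap n := by
  obtain ⟨Ψ, hΨ⟩ := exists_diffeomorph_of_bijective (contMDiff_homInv hs) homInv_bijective
    fun p => bijective_of_surjective (E := Cn n) (mfderiv_homInv_surjective hs p)
  refine ⟨Ψ.symm, funext fun c => Ψ.injective ?_⟩
  refine (Ψ.apply_symm_apply c).trans ?_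
  exact ((congrFun hΨ _).trans (homInv_homMap c)).symm

end Structure


/-! ### Pull-backs of metrics -/

section Pullback

variable {E E' E'' : Type*} [NormedAddCommGroup E] [NormedSpace ℝ E] [NormedAddCommGroup E']
  [NormedSpace ℝ E'] [NormedAddCommGroup E''] [NormedSpace ℝ E''] {M N P : Type*}
  [TopologicalSpace M] [ChartedSpace E M] [TopologicalSpace N] [ChartedSpace E' N]
  [TopologicalSpace P] [ChartedSpace E'' P]

theorem pullback_comp_apply {f : M → N} {k : N → P} {x : M}
    (hk : MDifferentiableAt 𝓘(ℝ, E') 𝓘(ℝ, E'') k (f x))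
    (hf : MDifferentiableAt 𝓘(ℝ, E) 𝓘(ℝ, E') f x) (g : TensorField E'' P) :
    pullback (E := E) (k ∘ f) g x = ContinuousLinearMap.precomp ℝ (mfderiv 𝓘(ℝ, E) 𝓘(ℝ, E') f x) ∘L
      pullback (E := E') k g (f x) ∘L mfderiv 𝓘(ℝ, E) 𝓘(ℝ, E') f x := by
  rw [pullback, mfderiv_comp x hk hf]
  rfl

theorem pullback_comp {f : M → N} {k : N → P}
    (hk : MDifferentiable 𝓘(ℝ, E') 𝓘(ℝ, E'') k) (hf : MDifferentiable 𝓘(ℝ, E) 𝓘(ℝ, E') f)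
    (g : TensorField E'' P) : pullback (E := E) (k ∘ f) g = pullback f (pullback (E := E') k g) :=
  funext fun x => pullback_comp_apply (hk (f x)) (hf x) g

/-- The pull-back of a metric by a smooth map is smooth in charts. -/
theorem contDiffAt_coordMetric_pullback [IsManifold 𝓘(ℝ, E) ∞ M] [IsManifold 𝓘(ℝ, E') ∞ N]
    {f : M → N} (hf : ContMDiff 𝓘(ℝ, E) 𝓘(ℝ, E') ∞ f) {g : TensorField E' N} {p : M}
    (hg : ContDiffAt ℝ ∞ (coordMetric g (f p)) (chartAt E' (f p) (f p))) :
    ContDiffAt ℝ ∞ (coordMetric (pullback f g) p) (chartAt E p p) := by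
  set φ : E → E' := chartAt E' (f p) ∘ f ∘ (chartAt E p).symm with hφ
  set y₀ := chartAt E p p with hy₀
  have hp : (chartAt E p).symm y₀ = p := (chartAt E p).left_inv (mem_chart_source E p)
  have hsymm : ∀ y ∈ (chartAt E p).target,
      ContMDiffAt 𝓘(ℝ, E) 𝓘(ℝ, E) ∞ (chartAt E p).symm y := fun y hy =>
    (contMDiffOn_chart_symm (I := 𝓘(ℝ, E)) (n := ∞) (x := p)).contMDiffAt
      ((chartAt E p).open_target.mem_nhds hy)
  have hy₀t : y₀ ∈ (chartAt E p).target := mem_chart_target E p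
  have hcont : ContinuousAt (f ∘ (chartAt E p).symm) y₀ :=
    hf.continuous.continuousAt.comp (hsymm y₀ hy₀t).continuousAt
  have hev : ∀ᶠ y in 𝓝 y₀, y ∈ (chartAt E p).target ∧
      f ((chartAt E p).symm y) ∈ (chartAt E' (f p)).source := by
    refine Filter.Eventually.and ((chartAt E p).open_target.mem_nhds hy₀t) (hcont ?_)
    simp only [Function.comp_apply, hp]
    exact chart_source_mem_nhds E' (f p)
  have hφs : ∀ y, y ∈ (chartAt E p).target ∧
      f ((chartAt E p).symm y) ∈ (chartAt E' (f p)).source → ContDiffAt ℝ ∞ φ y := by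
    rintro y ⟨hy1, hy2⟩
    refine ContMDiffAt.contDiffAt ?_
    exact ((contMDiffOn_chart (I := 𝓘(ℝ, E')) (n := ∞) (x := f p)).contMDiffAt
      ((chartAt E' (f p)).open_source.mem_nhds hy2)).comp y ((hf _).comp y (hsymm y hy1))
  -- Near `y₀`, `f` after the inverse chart equals the inverse chart at `f p` after `φ`; the
  -- pull-back then goes through `φ` between model spaces, where derivatives are ordinary ones.
  have heq : coordMetric (pullback f g) p =ᶠ[𝓝 y₀] fun y =>
      ContinuousLinearMap.precomp ℝ (fderiv ℝ φ y) ∘L coordMetric g (f p) (φ y) ∘L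
        fderiv ℝ φ y := by
    filter_upwards [hev.eventually_nhds] with y hy
    have hy0 := hy.self_of_nhds
    have hsy := (hsymm y hy0.1).mdifferentiableAt (by simp)
    have h1 : coordMetric (pullback f g) p y =
        pullback (E := E) (f ∘ (chartAt E p).symm) g y :=
      (pullback_comp_apply ((hf _).mdifferentiableAt (by simp)) hsy g).symm
    have h2 : f ∘ (chartAt E p).symm =ᶠ[𝓝 y] (chartAt E' (f p)).symm ∘ φ := by
      filter_upwards [hy] with t ht
      exact ((chartAt E' (f p)).left_inv ht.2).symm
    have h3 : pullback (E := E) (f ∘ (chartAt E p).symm) g y =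
        pullback (E := E) ((chartAt E' (f p)).symm ∘ φ) g y := by
      have h4 := h2.self_of_nhds
      rw [pullback, pullback, h2.mfderiv_eq]
      rw [h4]
    have h5 : MDifferentiableAt 𝓘(ℝ, E') 𝓘(ℝ, E') (chartAt E' (f p)).symm (φ y) :=
      ((contMDiffOn_chart_symm (I := 𝓘(ℝ, E')) (n := ∞) (x := f p)).contMDiffAt
        ((chartAt E' (f p)).open_target.mem_nhds
          ((chartAt E' (f p)).map_source hy0.2))).mdifferentiableAt (by simp)
    have h6 : MDifferentiableAt 𝓘(ℝ, E) 𝓘(ℝ, E') φ y :=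
      ((hφs y hy0).differentiableAt (by simp)).mdifferentiableAt
    rw [h1, h3, pullback_comp_apply h5 h6, mfderiv_eq_fderiv]
    rfl
  have hy₀e := hev.self_of_nhds
  have hD : ContDiffAt ℝ ∞ (fderiv ℝ φ) y₀ := (hφs y₀ hy₀e).fderiv_right (by simp)
  have hφ0 : φ y₀ = chartAt E' (f p) (f p) := by simp [hφ, hp]
  have hG : ContDiffAt ℝ ∞ (fun y => coordMetric g (f p) (φ y)) y₀ :=
    ContDiffAt.comp (g := coordMetric g (f p)) y₀ (by rw [hφ0]; exact hg) (hφs y₀ hy₀e)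
  refine ContDiffAt.congr_of_eventuallyEq ?_ heq
  exact ContDiffAt.clm_comp
    (((ContinuousLinearMap.compL ℝ E E' ℝ).flip.contDiff.contDiffAt).comp y₀ hD)
    (hG.clm_comp hD)

end Pullback

/-! ### Translations -/

section Translation

variable {n : ℕ}

/-- The action of `SU(n+1)` on projective space. -/
noncomputable def actCP (a : SU n) : CP n → CP n :=
  Projectivization.map (act a : Cn (n + 1) →ₗ[ℂ] Cn (n + 1)) (act_injective a)

theorem actCP_proj (a : SU n) {z : Cn (n + 1)} (hz : z ≠ 0) :
    actCP a (proj n z) = proj n (act a z) := by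
  rw [proj_of_ne hz, proj_of_ne (act_ne_zero a hz)]
  rfl

theorem contMDiff_actCP (a : SU n) : ContMDiff 𝓘(ℝ, Cn n) 𝓘(ℝ, Cn n) ∞ (actCP a) := by
  intro p
  obtain ⟨z, hz, rfl⟩ := exists_proj_eq p
  have hz0 : z ≠ 0 := norm_ne_zero_iff.1 (by simp [hz])
  refine contMDiffAt_of_comp_proj hz0 ?_
  have h : ContMDiffAt 𝓘(ℝ, Cn (n + 1)) 𝓘(ℝ, Cn n) ∞ (fun z => proj n (act a z)) z :=
    ContMDiffAt.comp (g := proj n) z (contMDiffAt_proj (act_ne_zero a hz0))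
      ((act a).restrictScalars ℝ).contDiff.contMDiff.contMDiffAt
  refine h.congr_of_eventuallyEq ?_
  filter_upwards [isOpen_ne.mem_nhds hz0] with y hy
  exact actCP_proj a hy

/-- The differential of the projection. -/
noncomputable def dproj (z : Cn (n + 1)) : Cn (n + 1) →L[ℝ] Cn n :=
  mfderiv 𝓘(ℝ, Cn (n + 1)) 𝓘(ℝ, Cn n) (proj n) z

theorem hasMFDerivAt_dproj {z : Cn (n + 1)} (hz : z ≠ 0) :
    HasMFDerivAt 𝓘(ℝ, Cn (n + 1)) 𝓘(ℝ, Cn n) (proj n) z (dproj z) :=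
  (hasMFDerivAt_proj hz).mdifferentiableAt.hasMFDerivAt

theorem mfderiv_actCP_dproj (a : SU n) {z : Cn (n + 1)} (hz : z ≠ 0) (v : Cn (n + 1)) :
    (mfderiv 𝓘(ℝ, Cn n) 𝓘(ℝ, Cn n) (actCP a) (proj n z) : Cn n →L[ℝ] Cn n) (dproj z v) =
      dproj (act a z) (act a v) := by
  have h1 := HasMFDerivAt.comp (g := actCP a) z
    ((contMDiff_actCP a (proj n z)).mdifferentiableAt (by simp)).hasMFDerivAt
    (hasMFDerivAt_dproj hz)
  have h2 := HasMFDerivAt.comp (g := proj n) z (hasMFDerivAt_dproj (act_ne_zero a hz))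
    ((act a).restrictScalars ℝ).hasFDerivAt.hasMFDerivAt
  have h3 := h2.congr_of_eventuallyEq (f₁ := actCP a ∘ proj n) (by
    filter_upwards [isOpen_ne.mem_nhds hz] with y hy
    exact actCP_proj a hy)
  exact DFunLike.congr_fun (hasMFDerivAt_unique h1 h3) v

theorem dproj_smul {c : ℂ} (hc : c ≠ 0) {z : Cn (n + 1)} (hz : z ≠ 0) (v : Cn (n + 1)) :
    dproj (c • z) (c • v) = dproj z v := by
  have h2 := HasMFDerivAt.comp (g := proj n) z (hasMFDerivAt_dproj (smul_ne_zero hc hz))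
    ((c • ContinuousLinearMap.id ℂ (Cn (n + 1))).restrictScalars ℝ).hasFDerivAt.hasMFDerivAt
  have h3 := h2.congr_of_eventuallyEq (f₁ := proj n) (by
    filter_upwards [isOpen_ne.mem_nhds hz] with y hy
    exact (proj_smul hc hy).symm)
  exact (DFunLike.congr_fun (hasMFDerivAt_unique (hasMFDerivAt_dproj hz) h3) v).symm

theorem fubiniStudy_dproj {z : Cn (n + 1)} (hz : z ≠ 0) (v w : Cn (n + 1)) :
    (fubiniStudy n (proj n z) : Cn n →L[ℝ] Cn n →L[ℝ] ℝ) (dproj z v) (dproj z w) =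
      (hermForm z v w).re :=
  fubiniStudy_mfderiv_proj hz v w

theorem exists_dproj_eq {z : Cn (n + 1)} (hz : ‖z‖ = 1) (u : Cn n) :
    ∃ v : Cn (n + 1), inner ℂ z v = 0 ∧ dproj z v = u :=
  exists_mfderiv_proj_eq hz u

theorem fubiniStudy_congr {p q : CP n} (h : p = q) (u v : Cn n) :
    (fubiniStudy n p : Cn n →L[ℝ] Cn n →L[ℝ] ℝ) u v =
      (fubiniStudy n q : Cn n →L[ℝ] Cn n →L[ℝ] ℝ) u v := by
  subst h
  rfl

/-- The action lifts to a unitary map of `ℂⁿ⁺¹`, which preserves `hermForm`, and every tangent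
vector is the image of one upstairs. -/
theorem pullback_actCP (a : SU n) :
    pullback (E := Cn n) (actCP a) (fubiniStudy n) = fubiniStudy n := by
  funext p
  obtain ⟨z, hz, rfl⟩ := exists_proj_eq p
  have hz0 : z ≠ 0 := norm_ne_zero_iff.1 (by simp [hz])
  have h (u v : Cn n) :
      (pullback (E := Cn n) (actCP a) (fubiniStudy n) (proj n z) : Cn n →L[ℝ] Cn n →L[ℝ] ℝ) u v =
        (fubiniStudy n (proj n z) : Cn n →L[ℝ] Cn n →L[ℝ] ℝ) u v := by
    obtain ⟨u, -, rfl⟩ := exists_dproj_eq hz u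
    obtain ⟨v, -, rfl⟩ := exists_dproj_eq hz v
    refine (pullback_apply_of_hasMFDerivAt
      ((contMDiff_actCP a (proj n z)).mdifferentiableAt (by simp)).hasMFDerivAt _ _ _).trans ?_
    refine (congrArg₂ (fun u v => (fubiniStudy n (actCP a (proj n z)) :
      Cn n →L[ℝ] Cn n →L[ℝ] ℝ) u v) (mfderiv_actCP_dproj a hz0 u)
      (mfderiv_actCP_dproj a hz0 v)).trans ?_
    refine (fubiniStudy_congr (actCP_proj a hz0) _ _).trans ?_
    rw [fubiniStudy_dproj (act_ne_zero a hz0), fubiniStudy_dproj hz0, hermForm_act]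
  exact ContinuousLinearMap.ext fun u => ContinuousLinearMap.ext fun v => h u v

theorem homMap_smul (a : SU n) (c : HomSpace n) : homMap n (a • c) = actCP a (homMap n c) := by
  induction c using Quotient.inductionOn with | _ x
  refine (homMap_mk (a * x)).trans ?_
  refine Eq.trans ?_ (congrArg (actCP a) (homMap_mk x)).symm
  rw [actCP_proj a (firstColumn_ne_zero x), firstColumn_mul]

variable [ChartedSpace (Cn n) (HomSpace n)]
  (Φ : Diffeomorph 𝓘(ℝ, Cn n) 𝓘(ℝ, Cn n) (HomSpace n) (CP n) ∞)

theorem contMDiff_smul_homSpace (hΦ : ⇑Φ = homMap n) (a : SU n) :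
    ContMDiff 𝓘(ℝ, Cn n) 𝓘(ℝ, Cn n) ∞ (fun c : HomSpace n => a • c) := by
  have h : (fun c : HomSpace n => a • c) = Φ.symm ∘ actCP a ∘ Φ := by
    funext c
    refine homMap_injective ((homMap_smul a c).trans ?_)
    rw [← hΦ]
    exact (Φ.apply_symm_apply _).symm
  rw [h]
  exact Φ.symm.contMDiff.comp ((contMDiff_actCP a).comp Φ.contMDiff)

variable (n) in
/-- The pull-back of the Fubini-Study metric to the homogeneous space. -/
noncomputable abbrev homMetric : TensorField (Cn n) (HomSpace n) :=
  pullback (homMap n) (fubiniStudy n)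

/-- The differential of `homMap`. -/
noncomputable def dhom (c : HomSpace n) : Cn n →L[ℝ] Cn n :=
  mfderiv 𝓘(ℝ, Cn n) 𝓘(ℝ, Cn n) (homMap n) c

theorem homMetric_apply (c : HomSpace n) (u v : Cn n) :
    (homMetric n c : Cn n →L[ℝ] Cn n →L[ℝ] ℝ) u v =
      (fubiniStudy n (homMap n c) : Cn n →L[ℝ] Cn n →L[ℝ] ℝ) (dhom c u) (dhom c v) := rfl

theorem isInvariantMetric_homMetric (hΦ : ⇑Φ = homMap n) : IsInvariantMetric n (homMetric n) := by
  intro a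
  have hF : MDifferentiable 𝓘(ℝ, Cn n) 𝓘(ℝ, Cn n) (homMap n) :=
    hΦ ▸ Φ.contMDiff.mdifferentiable (by simp)
  rw [homMetric, ← pullback_comp hF ((contMDiff_smul_homSpace Φ hΦ a).mdifferentiable (by simp)),
    show homMap n ∘ (fun c : HomSpace n => a • c) = actCP a ∘ homMap n from
      funext (homMap_smul a),
    pullback_comp ((contMDiff_actCP a).mdifferentiable (by simp)) hF, pullback_actCP]

theorem dhom_bijective (hΦ : ⇑Φ = homMap n) (c : HomSpace n) : Function.Bijective (dhom c) := by
  have h := (Φ.mfderivToContinuousLinearEquiv (by simp) c).bijective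
  rw [dhom, ← hΦ]
  exact h

theorem homMetric_symm (c : HomSpace n) (u v : Cn n) :
    (homMetric n c : Cn n →L[ℝ] Cn n →L[ℝ] ℝ) u v =
      (homMetric n c : Cn n →L[ℝ] Cn n →L[ℝ] ℝ) v u := by
  rw [homMetric_apply, homMetric_apply, fubiniStudy_symm]

theorem homMetric_pos (hΦ : ⇑Φ = homMap n) (c : HomSpace n) {u : Cn n} (hu : u ≠ 0) :
    0 < (homMetric n c : Cn n →L[ℝ] Cn n →L[ℝ] ℝ) u u := by
  rw [homMetric_apply]
  exact fubiniStudy_pos (homMap n c) fun h => hu ((dhom_bijective Φ hΦ c).1 (by rw [h, map_zero]))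

theorem isSmoothMetric_homMetric [IsManifold 𝓘(ℝ, Cn n) ∞ (HomSpace n)]
    (hΦ : ⇑Φ = homMap n) : IsSmoothMetric (homMetric n) := by
  refine isSmoothMetric_of_coordMetric _ homMetric_symm
    (fun c u hu => homMetric_pos Φ hΦ c hu) fun c => ?_
  refine contDiffAt_coordMetric_pullback (hΦ ▸ Φ.contMDiff) ?_
  exact (contDiff_of_coordHerm (coordMetric_fubiniStudy _)).contDiffAt

/-! ### Uniqueness of the invariant metric -/

theorem dhom_smul (hΦ : ⇑Φ = homMap n) (a : SU n) (c : HomSpace n) (u : Cn n) :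
    dhom (a • c) ((mfderiv 𝓘(ℝ, Cn n) 𝓘(ℝ, Cn n) (fun c : HomSpace n => a • c) c :
      Cn n →L[ℝ] Cn n) u) =
    (mfderiv 𝓘(ℝ, Cn n) 𝓘(ℝ, Cn n) (actCP a) (homMap n c) : Cn n →L[ℝ] Cn n) (dhom c u) := by
  have hF : MDifferentiable 𝓘(ℝ, Cn n) 𝓘(ℝ, Cn n) (homMap n) :=
    hΦ ▸ Φ.contMDiff.mdifferentiable (by simp)
  have h1 := mfderiv_comp c (hF (a • c))
    ((contMDiff_smul_homSpace Φ hΦ a c).mdifferentiableAt (by simp))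
  have h2 := mfderiv_comp c ((contMDiff_actCP a (homMap n c)).mdifferentiableAt (by simp)) (hF c)
  have hcomp : (homMap n ∘ fun c : HomSpace n => a • c) = actCP a ∘ homMap n :=
    funext (homMap_smul a)
  have h3 {f k : HomSpace n → CP n} (hfk : f = k) :
      (mfderiv 𝓘(ℝ, Cn n) 𝓘(ℝ, Cn n) f c : Cn n →L[ℝ] Cn n) =
        (mfderiv 𝓘(ℝ, Cn n) 𝓘(ℝ, Cn n) k c : Cn n →L[ℝ] Cn n) := by
    subst hfk
    rfl
  exact DFunLike.congr_fun (h1.symm.trans ((h3 hcomp).trans h2)) u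

theorem apply_smul_of_isInvariantMetric {h : TensorField (Cn n) (HomSpace n)}
    (hinv : IsInvariantMetric n h) (a : SU n) (c : HomSpace n) (u : Cn n) :
    (h (a • c) : Cn n →L[ℝ] Cn n →L[ℝ] ℝ)
      ((mfderiv 𝓘(ℝ, Cn n) 𝓘(ℝ, Cn n) (fun c : HomSpace n => a • c) c : Cn n →L[ℝ] Cn n) u)
      ((mfderiv 𝓘(ℝ, Cn n) 𝓘(ℝ, Cn n) (fun c : HomSpace n => a • c) c : Cn n →L[ℝ] Cn n) u) =
    (h c : Cn n →L[ℝ] Cn n →L[ℝ] ℝ) u u :=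
  DFunLike.congr_fun (DFunLike.congr_fun (congrFun (hinv a) c) u) u

theorem bilin_eq_mul_of_unit {E : Type*} [NormedAddCommGroup E] [NormedSpace ℝ E]
    {A B : E →L[ℝ] E →L[ℝ] ℝ} {m : ℝ} (hB : ∀ u, u ≠ 0 → 0 < B u u)
    (h : ∀ u, B u u = 1 → A u u = m) (u : E) : A u u = m * B u u := by
  rcases eq_or_ne u 0 with rfl | hu
  · simp
  · have hs : Real.sqrt (B u u) ^ 2 = B u u := Real.sq_sqrt (hB u hu).le
    have hs0 : Real.sqrt (B u u) ≠ 0 := (Real.sqrt_pos.2 (hB u hu)).ne'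
    have h3 := h ((Real.sqrt (B u u))⁻¹ • u)
    generalize Real.sqrt (B u u) = s at hs hs0 h3
    simp only [map_smul, smul_apply, smul_eq_mul, ← hs] at h3
    rw [← hs, ← h3 (by field_simp)]
    field_simp

/-- `SU(n+1)` acts transitively on the unit tangent vectors. -/
theorem exists_smul_eq_of_homMetric_eq_one (hΦ : ⇑Φ = homMap n) {j : Fin (n + 1)} (hj : j ≠ 0)
    {u₀ : Cn n} (hu₀ : dhom ((1 : SU n) : HomSpace n) u₀ =
      dproj (EuclideanSpace.single 0 1) (EuclideanSpace.single j 1))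
    (c : HomSpace n) (u : Cn n) (hu : (homMetric n c : Cn n →L[ℝ] Cn n →L[ℝ] ℝ) u u = 1) :
    ∃ a : SU n, a • ((1 : SU n) : HomSpace n) = c ∧
      (mfderiv 𝓘(ℝ, Cn n) 𝓘(ℝ, Cn n) (fun c : HomSpace n => a • c) ((1 : SU n) : HomSpace n) :
        Cn n →L[ℝ] Cn n) u₀ = u := by
  have he : (EuclideanSpace.single 0 1 : Cn (n + 1)) ≠ 0 := by
    rw [← norm_ne_zero_iff]
    simp
  have h1 : homMap n ((1 : SU n) : HomSpace n) = proj n (EuclideanSpace.single 0 1) := by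
    rw [homMap_mk, ← act_single_zero, act_one]
  obtain ⟨z, hz, hzc⟩ := exists_proj_eq (homMap n c)
  have hz0 : z ≠ 0 := norm_ne_zero_iff.1 (by simp [hz])
  obtain ⟨v, hv, hvu⟩ := exists_dproj_eq hz (dhom c u)
  have hvn : ‖v‖ = 1 := by
    have h2 : (fubiniStudy n (proj n z) : Cn n →L[ℝ] Cn n →L[ℝ] ℝ) (dproj z v) (dproj z v) = 1 := by
      rw [hvu]
      exact (fubiniStudy_congr hzc _ _).trans hu
    rw [fubiniStudy_dproj hz0, hermForm_of_norm_one hz hv, inner_self_complex] at h2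
    norm_cast at h2
    exact (pow_eq_one_iff_of_nonneg (norm_nonneg v) two_ne_zero).1 h2
  -- The base vector `z` is placed at index `0` and the horizontal unit lift `v` of `u` at index
  -- `j`.
  have hon : Orthonormal ℂ (Set.domRestrict {0, j} (Function.update (fun _ => v) 0 z)) := by
    refine ⟨?_, ?_⟩
    · rintro ⟨i, rfl | rfl⟩
      · simpa using hz
      · simpa [hj] using hvn
    · have hv' := inner_eq_zero_symm.1 hv
      rintro ⟨i, rfl | rfl⟩ ⟨k, rfl | rfl⟩ hik
      · exact (hik rfl).elim
      · simpa [hj] using hv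
      · simpa [hj] using hv'
      · exact (hik rfl).elim
  obtain ⟨a, r, hr, ha⟩ := exists_act_single_eq hon
  have ha0 : act a (EuclideanSpace.single 0 1) = r • z := by simpa using ha 0 (by simp)
  have haj : act a (EuclideanSpace.single j 1) = r • v := by simpa [hj] using ha j (by simp)
  have hac : a • ((1 : SU n) : HomSpace n) = c := by
    refine homMap_injective ?_
    rw [homMap_smul, h1, actCP_proj a he, ha0, proj_smul hr hz0, hzc]
  subst hac
  refine ⟨a, rfl, (dhom_bijective Φ hΦ (a • ((1 : SU n) : HomSpace n))).1 ?_⟩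
  -- The common phase `r` of the images of `e₀` and `e_j` disappears by `dproj_smul`.
  refine (dhom_smul Φ hΦ a _ u₀).trans ?_
  rw [hu₀, ← hvu, ← dproj_smul hr hz0, ← ha0, ← haj, ← mfderiv_actCP_dproj a he]
  exact congrArg (fun q => (mfderiv 𝓘(ℝ, Cn n) 𝓘(ℝ, Cn n) (actCP a) q : Cn n →L[ℝ] Cn n)
    (dproj (EuclideanSpace.single 0 1) (EuclideanSpace.single j 1))) h1

/-- By transitivity on unit vectors an invariant `h` takes one value `m` on all vectors of
`homMetric`-length one, so `h = m · homMetric` by homogeneity and polarization, and `μ = m⁻¹`. -/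
theorem exists_homMetric_eq_smul [IsManifold 𝓘(ℝ, Cn n) ∞ (HomSpace n)] (hn : 1 ≤ n)
    (hΦ : ⇑Φ = homMap n) {h : TensorField (Cn n) (HomSpace n)} (hh : IsSmoothMetric h)
    (hinv : IsInvariantMetric n h) : ∃ μ : ℝ, 0 < μ ∧ homMetric n = fun c => μ • h c := by
  have hj : Fin.last n ≠ 0 := fun h => by
    have := congrArg Fin.val h
    simp at this
    omega
  obtain ⟨u₀, hu₀⟩ := (dhom_bijective Φ hΦ ((1 : SU n) : HomSpace n)).2
    (dproj (EuclideanSpace.single 0 1) (EuclideanSpace.single (Fin.last n) 1))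
  obtain ⟨h', rfl⟩ := hh
  have hsymm (c : HomSpace n) (u v : Cn n) :
      (h'.inner c : Cn n →L[ℝ] Cn n →L[ℝ] ℝ) u v =
        (h'.inner c : Cn n →L[ℝ] Cn n →L[ℝ] ℝ) v u := h'.symm c u v
  set o : HomSpace n := ((1 : SU n) : HomSpace n)
  set m : ℝ := (h'.inner o : Cn n →L[ℝ] Cn n →L[ℝ] ℝ) u₀ u₀ with hm
  have h1 (c : HomSpace n) (u : Cn n)
      (hu : (homMetric n c : Cn n →L[ℝ] Cn n →L[ℝ] ℝ) u u = 1) :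
      (h'.inner c : Cn n →L[ℝ] Cn n →L[ℝ] ℝ) u u = m := by
    obtain ⟨a, rfl, rfl⟩ := exists_smul_eq_of_homMetric_eq_one Φ hΦ hj hu₀ c u hu
    exact apply_smul_of_isInvariantMetric hinv a o u₀
  have h2 (c : HomSpace n) (u : Cn n) : (h'.inner c : Cn n →L[ℝ] Cn n →L[ℝ] ℝ) u u =
      m * (homMetric n c : Cn n →L[ℝ] Cn n →L[ℝ] ℝ) u u :=
    bilin_eq_mul_of_unit (fun _ hu => homMetric_pos Φ hΦ c hu) (h1 c) u
  -- The reference vector `u₀` is nonzero because its image under `dhom` has Fubini–Study length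
  -- one; its direction `e_n` differs from `e₀` since `n ≥ 1`.
  have hm0 : 0 < m := by
    refine h'.pos o u₀ fun h0 => ?_
    have h4 := fubiniStudy_dproj (n := n) (z := EuclideanSpace.single 0 1)
      (by rw [← norm_ne_zero_iff]; simp) (EuclideanSpace.single (Fin.last n) 1)
      (EuclideanSpace.single (Fin.last n) 1)
    have h5 : dhom o u₀ = 0 := by
      rw [show u₀ = 0 from h0, map_zero]
    rw [← hu₀, h5, hermForm_of_norm_one (by simp)
      (by simp [EuclideanSpace.inner_single_left, hj.symm])] at h4
    simp at h4
    have h6 (B : Cn n →L[ℝ] Cn n →L[ℝ] ℝ) : B 0 0 = 0 := by simp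
    exact zero_ne_one ((h6 _).symm.trans h4)
  refine ⟨m⁻¹, inv_pos.2 hm0, funext fun c => ?_⟩
  refine bilin_eq_of_self (E := Cn n) (A := homMetric n c) (B := m⁻¹ • h'.inner c)
    (homMetric_symm c) (fun u v => congrArg (m⁻¹ * ·) (hsymm c u v)) fun u => ?_
  refine Eq.trans ?_ (congrArg (m⁻¹ * ·) (h2 c u)).symm
  exact (inv_mul_cancel_left₀ hm0.ne' _).symm

end Translation

end FubiniStudy

theorem mainTheorem3 :
    (∀ n : ℕ, IsSubmersionMetric n (fubiniStudy n)) ∧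
    (∀ n : ℕ, 2 ≤ n →
      T2Space (CP n) ∧ SecondCountableTopology (CP n) ∧
      IsKahler (fubiniStudy n) ∧
      (∀ p : CP n, IsChernConnection (fubiniStudy n) p (leviCivita (fubiniStudy n) p)) ∧
      (∃ c : ℝ, 0 < c ∧ IsEinstein (fubiniStudy n) c) ∧
      (∀ (p : CP n) (u w : TangentSpace 𝓘(ℝ, Cn n) p),
        fubiniStudy n p u u = 1 → fubiniStudy n p w w = 1 →
        fubiniStudy n p u w = 0 → fubiniStudy n p (complexStructure p u) w = 0 →
        ∀ s : ℝ, sectional (fubiniStudy n) p u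
          (Real.cos s • w + Real.sin s • complexStructure p u) = 1 + 3 * Real.sin s ^ 2) ∧
      (¬ ∃ c : ℝ, HasConstantSectionalCurvature (fubiniStudy n) c) ∧
      ¬ IsLocallyConformallyFlat (fubiniStudy n) ∧
      IsOrientable (Cn n) (CP n)) ∧
    ((∃ Φ : Diffeomorph 𝓘(ℝ, Cn 1) 𝓘(ℝ, EuclideanSpace ℝ (Fin 2)) (CP 1)
        (Metric.sphere (0 : EuclideanSpace ℝ (Fin 3)) 1) ∞,
        pullback Φ roundMetric = fun p => (4 : ℝ) • fubiniStudy 1 p) ∧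
      HasConstantSectionalCurvature (fubiniStudy 1) 4 ∧
      IsLocallyConformallyFlat (fubiniStudy 1)) ∧
    (∀ n : ℕ, 1 ≤ n →
      (∃ _ : ChartedSpace (Cn n) (HomSpace n), IsHomogeneousStructure n) ∧
      ∀ (_ : ChartedSpace (Cn n) (HomSpace n)) (_ : IsManifold 𝓘(ℝ, Cn n) ∞ (HomSpace n)),
        IsHomogeneousStructure n →
        (∃ Φ : Diffeomorph 𝓘(ℝ, Cn n) 𝓘(ℝ, Cn n) (HomSpace n) (CP n) ∞, ⇑Φ = homMap n) ∧
        (∃ h : TensorField (Cn n) (HomSpace n), IsSmoothMetric h ∧ IsInvariantMetric n h) ∧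
        ∀ h : TensorField (Cn n) (HomSpace n), IsSmoothMetric h → IsInvariantMetric n h →
          ∃ μ : ℝ, 0 < μ ∧ pullback (homMap n) (fubiniStudy n) = fun c => μ • h c) := by
  refine ⟨isSubmersionMetric_fubiniStudy, fun n hn => ?_, ?_, fun n hn => ?_⟩
  · exact ⟨inferInstance, inferInstance, isKahler_fubiniStudy n, isChernConnection_fubiniStudy,
      ⟨2 * (n + 1), by positivity, isEinstein_fubiniStudy n⟩, sectional_angle,
      not_hasConstantSectionalCurvature hn, not_isLocallyConformallyFlat hn, isOrientable_CP n⟩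
  · exact ⟨exists_isometry_sphere, hasConstantSectionalCurvature_CP_one,
      isLocallyConformallyFlat_CP_one⟩
  · refine ⟨exists_isHomogeneousStructure n, fun _ _ hs => ?_⟩
    obtain ⟨Φ, hΦ⟩ := exists_diffeomorph_homMap hs
    exact ⟨⟨Φ, hΦ⟩, ⟨homMetric n, isSmoothMetric_homMetric Φ hΦ, isInvariantMetric_homMetric Φ hΦ⟩,
      fun h hh hinv => exists_homMetric_eq_smul Φ hn hΦ hh hinv⟩
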